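/- Let $N$ be a natural number, let $\theta\neq0$ be real, and let $S=\begin{pmatrix}0&1_N\\-1_N&0\end{pmatrix}$. For Schwartz functions $f,g$ on $\mathbb R^{2N}$ let $$(f\star_\theta g)(x)=(\pi\theta)^{-2N}\iint f(y)\,g(z)\,e^{\frac{2i}{\theta}(x-y)\cdot S(x-z)}\,d^{2N}y\,d^{2N}z$$ be their Moyal product. For a tempered distribution $f$ and a Schwartz function $g$, the product $f\star_\theta g$ is the tempered distribution defined by $\langle f\star_\theta g,h\rangle=\langle f,g\star_\theta h\rangle$ for all Schwartz functions $h$. Let $\mathcal B(\mathbb R^{2N})$ be the space of smooth complex functions on $\mathbb R^{2N}$ that are bounded together with all their derivatives. Let $\mathcal H=L^2(\mathbb R^{2N})\otimes\mathbb C^{2^N}$. Let $\gamma^1,\dots,\gamma^{2N}$ be hermitian $2^N\times2^N$ matrices with $\gamma^\mu\gamma^\nu+\gamma^\nu\gamma^\mu=2\delta^{\mu\nu}$, and let $D=-i\sum_\mu\gamma^\mu\partial_\mu$ be the Dirac operator on $\mathcal H$, with domain the set of all $\Psi\in\mathcal H$ whose distributional image $-i\sum_\mu\gamma^\mu\partial_\mu\Psi$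 lies in $\mathcal H$. Let $|D|$ be the unique positive self-adjoint operator with $|D|^2=D^2$ (with equality of domains). For $f\in\mathcal B(\mathbb R^{2N})$ let $\pi^\theta(f)$ be the operator on $\mathcal H$ of componentwise left Moyal multiplication by $f$, that is, the bounded extension to $\mathcal H$ of the map $\Psi\mapsto(f\star_\theta\Psi_j)_j$ on Schwartz spinors. For an unbounded operator $M$ and a bounded operator $T$ on $\mathcal H$, the commutator $[M,T]$ is said to exist as a bounded operator if $T(\operatorname{Dom}M)\subseteq\operatorname{Dom}M$ and $MT-TM$, defined on $\operatorname{Dom}M$, extends to a bounded operator on $\mathcal H$, which is then denoted $[M,T]$. Let $\delta(T)=[|D|,T]$, with domain the bounded operators $T$ for which this commutator exists as a bounded operator. The smooth domain of $\delta$ is $\bigcap_{n\in\mathbb N}\operatorname{Dom}(\delta^n)$. Theorem. The operator $|D|$ exists, and for every $f\in\mathcal B(\mathbb R^{2N})$ the operator $\pi^\theta(f)$ exists as a bounded operator on $\mathcal H$, the commutator $[D,\pi^\theta(f)]$ exists as a bounded operator on $\mathcal H$, and both $\pi^\theta(f)$ and $[D,\pi^\theta(f)]$ lie in the smooth domain of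 $\delta$. -/

import Mathlib

open MeasureTheory SchwartzMap LineDeriv
open scoped ContDiff

namespace MoyalPlane

noncomputable section

/-- The phase space `ℝ^{2N}` with its Euclidean structure; the first copy of `Fin N` labels the
coordinates `x_1, …, x_N`, the second one `x_{N+1}, …, x_{2N}`. -/
abbrev PhaseSpace (N : ℕ) : Type := EuclideanSpace ℝ (Fin N ⊕ Fin N)

/-- The spinor fibre `ℂ^{2^N}`. -/
abbrev Spinor (N : ℕ) : Type := EuclideanSpace ℂ (Fin (2 ^ N))

/-- The Hilbert space `L²(ℝ^{2N}) ⊗ ℂ^{2^N}` of square-integrable spinors. -/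
abbrev SpinorL2 (N : ℕ) : Type := Lp (Spinor N) 2 (volume : Measure (PhaseSpace N))

/-- The space `𝓑(ℝ^{2N})` of smooth complex functions bounded together with all derivatives. -/
def smoothBounded (N : ℕ) : Set (PhaseSpace N → ℂ) :=
  {f | ContDiff ℝ ∞ f ∧ ∀ n : ℕ, ∃ K : ℝ, ∀ x, ‖iteratedFDeriv ℝ n f x‖ ≤ K}

/-- The symplectic matrix `S = (0, 1; -1, 0)`. -/
def symplecticMatrix (N : ℕ) : Matrix (Fin N ⊕ Fin N) (Fin N ⊕ Fin N) ℝ :=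
  Matrix.fromBlocks 0 1 (-1) 0

/-- The bilinear form `s · S t`. -/
def symplecticPairing {N : ℕ} (s t : PhaseSpace N) : ℝ :=
  s.ofLp ⬝ᵥ (symplecticMatrix N).mulVec t.ofLp

/-- The Moyal product
`(f ⋆ g)(x) = (πθ)^{-2N} ∬ f(y) g(z) exp((2i/θ) (x-y) · S(x-z)) dy dz`, used for Schwartz `f`, `g`
and `θ ≠ 0`. -/
def moyalProduct {N : ℕ} (θ : ℝ) (f g : PhaseSpace N → ℂ) (x : PhaseSpace N) : ℂ :=
  (((Real.pi * θ) ^ (2 * N))⁻¹ : ℝ) *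
    ∫ y, ∫ z, f y * g z *
      Complex.exp (((2 / θ * symplecticPairing (x - y) (x - z) : ℝ) : ℂ) * Complex.I)

/-- The bounded operator `A` is `π^θ(f) = L^θ_f ⊗ 1`: on every Schwartz spinor `Ψ` it is the
componentwise left Moyal product `f ⋆ Ψ_j`. The product of the tempered distribution `f` with a
Schwartz function `g` is given by duality, `⟨f ⋆ g, h⟩ = ⟨f, g ⋆ h⟩` for all Schwartz `h`. As the
Schwartz spinors are dense, there is at most one such `A`. -/
def IsMoyalRep {N : ℕ} (θ : ℝ) (f : PhaseSpace N → ℂ) (A : SpinorL2 N →L[ℂ] SpinorL2 N) : Prop :=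
  ∀ (Ψ : 𝓢(PhaseSpace N, Spinor N)) (j : Fin (2 ^ N)) (h : 𝓢(PhaseSpace N, ℂ)),
    ∫ x, (A (Ψ.toLp 2)) x j * h x = ∫ x, f x * moyalProduct θ (fun y => Ψ y j) h x

/-- Hermitian Dirac matrices `γ^μ` of size `2^N` with `γ^μ γ^ν + γ^ν γ^μ = 2 δ^{μν}`. (Because of
their size they automatically act irreducibly.) -/
def IsDiracMatrices {N : ℕ}
    (γ : Fin N ⊕ Fin N → Matrix (Fin (2 ^ N)) (Fin (2 ^ N)) ℂ) : Prop :=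
  (∀ μ, (γ μ).IsHermitian) ∧
    ∀ μ ν, γ μ * γ ν + γ ν * γ μ = if μ = ν then 2 else 0

/-- The differential operator `-i γ^μ ∂_μ` on Schwartz spinors. -/
def diracSchwartz {N : ℕ} (γ : Fin N ⊕ Fin N → Matrix (Fin (2 ^ N)) (Fin (2 ^ N)) ℂ)
    (Ψ : 𝓢(PhaseSpace N, Spinor N)) : 𝓢(PhaseSpace N, Spinor N) :=
  -Complex.I • ∑ μ, postcompCLM (Matrix.toEuclideanCLM (𝕜 := ℂ) (γ μ))
    (∂_{(EuclideanSpace.single μ (1 : ℝ) : PhaseSpace N)} Ψ : 𝓢(PhaseSpace N, Spinor N))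

/-- The graph of the Dirac operator: pairs `(Ψ, Φ)` of square-integrable spinors such that
`-i γ^μ ∂_μ Ψ = Φ` in the sense of distributions. -/
def diracGraph {N : ℕ} (γ : Fin N ⊕ Fin N → Matrix (Fin (2 ^ N)) (Fin (2 ^ N)) ℂ) :
    Submodule ℂ (SpinorL2 N × SpinorL2 N) where
  carrier := {p | ∀ χ : 𝓢(PhaseSpace N, Spinor N),
    inner ℂ ((diracSchwartz γ χ).toLp 2) p.1 = inner ℂ (χ.toLp 2) p.2}
  add_mem' := by
    intro p q hp hq χ
    simp only [Prod.fst_add, Prod.snd_add, inner_add_right, hp χ, hq χ]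
  zero_mem' := by
    intro χ
    simp
  smul_mem' := by
    intro c p hp χ
    simp only [Prod.smul_fst, Prod.smul_snd, inner_smul_right, hp χ]

theorem snd_eq_zero_of_mem_diracGraph {N : ℕ}
    (γ : Fin N ⊕ Fin N → Matrix (Fin (2 ^ N)) (Fin (2 ^ N)) ℂ)
    (p : SpinorL2 N × SpinorL2 N) (hp : p ∈ diracGraph γ) (h0 : p.1 = 0) : p.2 = 0 := by
  have hd : DenseRange (toLpCLM ℝ (Spinor N) 2 (volume : Measure (PhaseSpace N))) :=
    denseRange_toLpCLM (by norm_num)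
  have h : ∀ v : SpinorL2 N, inner ℂ v p.2 = 0 := fun v =>
    hd.induction_on (p := fun v => inner ℂ v p.2 = 0) v
      (isClosed_eq (by fun_prop) continuous_const) fun χ => by
        have h := hp χ
        rw [h0, inner_zero_right] at h
        exact h.symm
  exact inner_self_eq_zero.mp (h p.2)

/-- The Dirac operator `D = -i γ^μ ∂_μ` as an unbounded operator on `L²(ℝ^{2N}) ⊗ ℂ^{2^N}`, with
its natural domain of all `Ψ` in `L²` for which the distribution `-i γ^μ ∂_μ Ψ` lies in `L²`. -/
def dirac {N : ℕ} (γ : Fin N ⊕ Fin N → Matrix (Fin (2 ^ N)) (Fin (2 ^ N)) ℂ) :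
    SpinorL2 N →ₗ.[ℂ] SpinorL2 N :=
  (diracGraph γ).toLinearPMap

theorem graph_dirac {N : ℕ} (γ : Fin N ⊕ Fin N → Matrix (Fin (2 ^ N)) (Fin (2 ^ N)) ℂ) :
    (dirac γ).graph = diracGraph γ :=
  Submodule.toLinearPMap_graph_eq _ (snd_eq_zero_of_mem_diracGraph γ)

/-- `M = |T|` for a self-adjoint operator `T`: the positive self-adjoint operator `M` with
`M² = T²` (equality of unbounded operators, domains included), which is unique. -/
def IsAbsoluteValue {H : Type*} [NormedAddCommGroup H] [InnerProductSpace ℂ H] [CompleteSpace H]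
    (T M : H →ₗ.[ℂ] H) : Prop :=
  IsSelfAdjoint M ∧ (∀ x : M.domain, 0 ≤ (inner ℂ (x : H) (M x)).re) ∧
    ∀ x z : H, (∃ y, (x, y) ∈ M.graph ∧ (y, z) ∈ M.graph) ↔
      ∃ y, (x, y) ∈ T.graph ∧ (y, z) ∈ T.graph

/-- The bounded operator `B` is the commutator `[M, A]` of the unbounded operator `M` with the
bounded operator `A`: `A` maps the domain of `M` into itself, and `M A - A M` agrees with `B`
there. For densely defined `M` there is at most one such `B`. -/
def IsCommutator {H : Type*} [NormedAddCommGroup H] [InnerProductSpace ℂ H]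
    (M : H →ₗ.[ℂ] H) (A B : H →L[ℂ] H) : Prop :=
  ∀ x : M.domain, ∃ hx : A x ∈ M.domain, M ⟨A x, hx⟩ - A (M x) = B x

/-- The bounded operator `A` lies in the domain of `δⁿ`, where `δ(A) = [M, A]`. -/
def InDomainDeltaPow {H : Type*} [NormedAddCommGroup H] [InnerProductSpace ℂ H]
    (M : H →ₗ.[ℂ] H) : ℕ → (H →L[ℂ] H) → Prop
  | 0, _ => True
  | n + 1, A => ∃ B : H →L[ℂ] H, IsCommutator M A B ∧ InDomainDeltaPow M n B

/-- The smooth domain of `δ(A) = [M, A]`, the intersection of the domains of all powers `δⁿ`. -/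
def InSmoothDomain {H : Type*} [NormedAddCommGroup H] [InnerProductSpace ℂ H]
    (M : H →ₗ.[ℂ] H) (A : H →L[ℂ] H) : Prop :=
  ∀ n, InDomainDeltaPow M n A

end

end MoyalPlane

/-! Let P_μ be the momentum with Fourier symbol ξ_μ, λ = (1 + |P|²)^{1/2} and s = 1/λ, so that D =
2π Σ γ^μ P_μ. Unbounded operators are written as quotients Q/S of bounded commuting symmetric
operators with S² + κQ² = 1. Self-adjointness, squares and commutators then become identities
between bounded operators. The Clifford relations give D² = (2π)²|P|², hence |D| = 2π|P|, which
differs from 2πλ by a bounded multiplier. So δ is governed by [λ, ·].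

The first pillar (`exists_commutator`) is that [λ, T] is bounded as soon as the first and second
commutators of T with the momenta are. With L and R for left and right multiplication, [λ, T] = Σ_i
(P_i^L + P_i^R)/(λ^L + λ^R) [P_i, T]. For e = P/λ the quotient is ½(e_i^L + e_i^R) + ½(e_i^L -
e_i^R)(λ^L - λ^R)/(λ^L + λ^R), and the remaining fraction, applied to [P_i, T], is Σ_j (P_j^L +
P_j^R)/(λ^L + λ^R)² [P_j, [P_i, T]]. The inverse square is expanded in a norm-convergent series. As
[P_i, [λ, T]] = [λ, [P_i, T]], smoothness with respect to the momenta survives, at the cost of two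
orders per application of δ.

The second pillar (`exists_norm_twistedForm_le`) is a Calderón–Vaillancourt bound: left Moyal
multiplication by f in the space 𝓑 is bounded on L². If f is replaced by a sufficiently wide
Gaussian smoothing, the form is a superposition of products of short-time Fourier transforms, and
Plancherel with Cauchy–Schwarz bounds it. The bound blows up like r^{-2N} as the width r of the
smoothing tends to 0. But the r-derivative of the heat flow is r/2 times the flow of the second
derivatives of f, which are again in 𝓑, so integrating in r removes one power of r⁻¹ at a time.

Finally the Leibniz rule gives [P_μ, π(f)] = (-i/2π) π(∂_μ f), so π(f) has bounded momentum
commutators of all orders. The matrices γ^μ commute with π(f) and with all multipliers, so [D, π(f)]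
= -i Σ γ^μ π(∂_μ f) inherits the same property. -/

namespace MoyalPlane

/-! ### The algebraic commutator identity and scalar bounds for its series -/

open scoped TensorProduct

/-- The purely algebraic part of the construction of the commutator with `λ = 1/s - 1`, where
`Σ pᵢ² = 1 - 2 s`: the elements `ls, rs, …` stand for left and right multiplications. -/
theorem smul_commutator_eq_of_smul_sq_eq {C M ι : Type*} [CommRing C] [AddCommGroup M] [Module C M]
    [Fintype ι]
    (ls rs : C) (lp rp le re : ι → C)
    (hlp : ∑ i, lp i ^ 2 = 1 - 2 * ls) (hrp : ∑ i, rp i ^ 2 = 1 - 2 * rs)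
    (hle : ∀ i, le i * (1 - ls) = lp i) (hre : ∀ i, re i * (1 - rs) = rp i)
    (inj : ∀ X : M, (1 - (1 - 2 * ls) * (1 - 2 * rs)) • X = 0 → X = 0)
    (half : C) (hhalf : half * 2 = 1)
    (T : M) (T1 : ι → M) (T2 : ι → ι → M)
    (h1 : ∀ i, (ls * rs) • T1 i = (lp i * rs - ls * rp i) • T)
    (h2 : ∀ i j, (ls * rs) • T2 i j = (lp j * rs - ls * rp j) • T1 i)
    (K : ι → ι → M)
    (hK : ∀ i j, (1 - (1 - 2 * ls) * (1 - 2 * rs)) ^ 2 • K i j =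
      (lp j * ls * rs ^ 2 + rp j * ls ^ 2 * rs) • T2 i j) :
    (ls * rs) • (∑ i, ((half * (le i + re i)) • T1 i +
      (half * (le i - re i)) • ((4 : C) • ∑ j, K i j))) = (rs - ls) • T := by
  -- With λ = 1/s - 1 on each side, `D` is 2 · `ls` · `rs` · (λ^L + λ^R). Division by λ^L + λ^R is
  -- thus division by `D`, which is 1 minus a product.
  set D : C := 1 - (1 - 2 * ls) * (1 - 2 * rs) with hD
  -- `4 Σ_j K i j` plays the role of (λ^L - λ^R)/(λ^L + λ^R) applied to `T1 i`, since λ^L - λ^R =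
  -- (rs - ls)/(ls · rs). It comes from λ² = 1 + Σ P_j², which turns λ^L - λ^R into second
  -- commutators.
  have hQ : ∀ i, D • ((4 : C) • ∑ j, K i j) = (2 * (rs - ls)) • T1 i := by
    intro i
    have key : D • (D • ((4 : C) • ∑ j, K i j) - (2 * (rs - ls)) • T1 i) = 0 := by
      have e1 : D • (D • ((4 : C) • ∑ j, K i j)) =
          (4 : C) • ∑ j, (lp j ^ 2 * rs ^ 2 - ls ^ 2 * rp j ^ 2) • T1 i := by
        rw [← mul_smul D D, smul_comm, ← pow_two, Finset.smul_sum]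
        congr 1
        refine Finset.sum_congr rfl fun j _ => ?_
        rw [hK]
        have := congrArg (fun x => (lp j * rs + rp j * ls) • x) (h2 i j)
        simp only [smul_smul] at this
        convert this using 2 <;> ring
      rw [smul_sub, e1, ← Finset.sum_smul, Finset.sum_sub_distrib, ← Finset.sum_mul,
        ← Finset.mul_sum, hlp, hrp, smul_smul, smul_smul, ← sub_smul]
      convert zero_smul C (T1 i) using 2
      rw [hD]; ring
    exact sub_eq_zero.mp (inj _ key)
  -- Here `le`, `re` stand for e = P/λ, and e^L λ^L + e^R λ^R = ½(e^L + e^R)(λ^L + λ^R) + ½(e^L -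
  -- e^R)(λ^L - λ^R). Injectivity of `D` allows checking the claim after multiplying by it.
  have key : D • ((ls * rs) • (∑ i, ((half * (le i + re i)) • T1 i +
      (half * (le i - re i)) • ((4 : C) • ∑ j, K i j))) - (rs - ls) • T) = 0 := by
    have e1 : ∀ i, (D * (ls * rs)) • ((half * (le i + re i)) • T1 i +
        (half * (le i - re i)) • ((4 : C) • ∑ j, K i j)) =
        (2 * (lp i ^ 2 * rs ^ 2 - ls ^ 2 * rp i ^ 2)) • T := by
      intro i
      have e2 : (D * (ls * rs)) • ((half * (le i - re i)) • ((4 : C) • ∑ j, K i j)) =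
          (ls * rs * (half * (le i - re i)) * (2 * (rs - ls))) • T1 i := by
        rw [mul_smul _ (2 * (rs - ls)), ← hQ i]
        simp only [smul_smul]; congr 1; ring
      have e3 := congrArg (fun x => (2 * (lp i * rs + rp i * ls)) • x) (h1 i)
      simp only [smul_smul] at e3
      rw [smul_add, e2, smul_smul, ← add_smul]
      convert e3 using 2
      · rw [← hle, ← hre, hD]
        linear_combination (ls * rs * 2 * (le i * (1 - ls) * rs + re i * (1 - rs) * ls)) * hhalf
      · ring
    rw [smul_sub, smul_smul, Finset.smul_sum, Finset.sum_congr rfl fun i _ => e1 i,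
      ← Finset.sum_smul, ← Finset.mul_sum, Finset.sum_sub_distrib, ← Finset.sum_mul,
      ← Finset.mul_sum, hlp, hrp, smul_smul, ← sub_smul]
    convert zero_smul C T using 2
    rw [hD]; ring
  exact sub_eq_zero.mp (inj _ key)

/-- Inverting `(1 - L)²` on `z` by the series `Σ (n + 1) Lⁿ z`. -/
theorem exists_sub_sub_eq {X : Type*} [NormedAddCommGroup X] [NormedSpace ℝ X] [CompleteSpace X]
    (L : X →L[ℝ] X) (z : X) (hs : Summable fun n : ℕ => (n + 1 : ℝ) * ‖(L ^ n) z‖) :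
    ∃ k : X, (k - L k) - L (k - L k) = z := by
  set a : ℕ → X := fun n => (n + 1 : ℝ) • (L ^ n) z with ha
  have hsa : Summable a := by
    refine Summable.of_norm ?_
    convert hs using 2 with n
    rw [norm_smul, Real.norm_of_nonneg (by positivity)]
  have hsb : Summable fun n => (L ^ n) z := by
    refine Summable.of_norm_bounded hs fun n => ?_
    nlinarith [norm_nonneg ((L ^ n) z), (n.cast_nonneg : (0 : ℝ) ≤ n)]
  have step : ∀ n, L ((L ^ n) z) = (L ^ (n + 1)) z := fun n => by rw [pow_succ']; rfl
  have e1 : (∑' n, a n) - L (∑' n, a n) = ∑' n, (L ^ n) z := by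
    rw [L.map_tsum hsa, hsa.tsum_eq_zero_add, hsb.tsum_eq_zero_add]
    have h1 : Summable fun n => a (n + 1) := (summable_nat_add_iff 1).2 hsa
    have h2 : Summable fun n => L (a n) := hsa.map L L.continuous
    rw [add_sub_assoc, ← h1.tsum_sub h2]
    congr 1
    · simp [ha]
    · refine tsum_congr fun n => ?_
      simp only [ha, map_smul, step, ← sub_smul]
      push_cast
      rw [add_sub_cancel_left, one_smul]
  refine ⟨∑' n, a n, ?_⟩
  rw [e1, L.map_tsum hsb, hsb.tsum_eq_zero_add, tsum_congr step, add_sub_cancel_right]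
  rfl

/-- Since (1 - 2s)(1 + 2s) ≤ 1, the power is at most the inverse of (1 + 2s)^n, hence of its
Bernoulli minorant 1 + 2ns, which dominates (n + 1)s. -/
theorem mul_one_sub_two_mul_pow_le {s : ℝ} (h0 : 0 ≤ s) (h1 : s ≤ 1 / 2) (n : ℕ) :
    s * (1 - 2 * s) ^ n ≤ 1 / (n + 1) := by
  have h : (1 - 2 * s) ^ n * (1 + 2 * n * s) ≤ 1 := by
    induction n with
    | zero => simp
    | succ n ih =>
      refine le_trans ?_ ih
      rw [pow_succ, mul_assoc]
      refine mul_le_mul_of_nonneg_left ?_ (pow_nonneg (by linarith) n)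
      push_cast
      nlinarith [mul_nonneg h0 h0, mul_nonneg (mul_nonneg h0 h0) (n.cast_nonneg : (0 : ℝ) ≤ n)]
  rw [le_div_iff₀ (by positivity)]
  refine le_trans ?_ h
  rw [mul_comm s, mul_assoc]
  refine mul_le_mul_of_nonneg_left ?_ (pow_nonneg (by linarith) n)
  nlinarith [mul_nonneg h0 (n.cast_nonneg : (0 : ℝ) ≤ n)]

/-- Same argument with one more term of the binomial expansion of (1 + 2s)^n; the truncation
dominates (n + 1)² s². -/
theorem sq_mul_one_sub_two_mul_pow_le {s : ℝ} (h0 : 0 ≤ s) (h1 : s ≤ 1 / 2) (n : ℕ) :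
    s ^ 2 * (1 - 2 * s) ^ n ≤ 1 / (n + 1) ^ 2 := by
  have h : (1 - 2 * s) ^ n * (1 + 2 * n * s + 2 * n * (n - 1) * s ^ 2) ≤ 1 := by
    induction n with
    | zero => simp
    | succ n ih =>
      refine le_trans ?_ ih
      rw [pow_succ, mul_assoc]
      refine mul_le_mul_of_nonneg_left ?_ (pow_nonneg (by linarith) n)
      push_cast
      have hn : (0 : ℝ) ≤ n := n.cast_nonneg
      have := mul_nonneg (mul_nonneg (mul_nonneg h0 h0) h0) (mul_nonneg hn hn)
      have := mul_nonneg (mul_nonneg (mul_nonneg h0 h0) h0) hn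
      nlinarith [mul_nonneg h0 h0, mul_nonneg (mul_nonneg h0 h0) hn]
  rw [le_div_iff₀ (by positivity)]
  refine le_trans ?_ h
  rw [mul_comm (s ^ 2), mul_assoc]
  refine mul_le_mul_of_nonneg_left ?_ (pow_nonneg (by linarith) n)
  have hn : (0 : ℝ) ≤ n := n.cast_nonneg
  nlinarith [mul_nonneg h0 hn, mul_nonneg (mul_nonneg h0 hn) (sub_nonneg.2 h1),
    mul_nonneg (mul_nonneg h0 h0) (mul_nonneg hn hn)]

end MoyalPlane

/-! ### Boundedness of the commutator with λ in a Banach algebra -/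

namespace MoyalPlane

open scoped TensorProduct
open Filter Topology

variable {R A : Type*} [CommRing R] [Algebra ℝ R] [NormedRing A] [NormedAlgebra ℝ A]

noncomputable section

/-- Left and right multiplication by the images of `R` in `A`, as an action of `R ⊗ R`. -/
def bimoduleHom (φ : R →ₐ[ℝ] A) : R ⊗[ℝ] R →ₐ[ℝ] Module.End ℝ A :=
  Algebra.TensorProduct.lift ((Algebra.lmul ℝ A).comp φ)
    (AlgHom.ofLinearMap ((LinearMap.mul ℝ A).flip ∘ₗ φ.toLinearMap) (by ext; simp) (fun a b => by
      ext x; simp [← map_mul, mul_comm a b, mul_assoc]))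
    (fun a b => (commute_iff_eq _ _).2 (by ext x; simp [mul_assoc]))

theorem bimoduleHom_tmul (φ : R →ₐ[ℝ] A) (a b : R) (x : A) :
    bimoduleHom φ (a ⊗ₜ b) x = φ a * x * φ b := by
  rw [bimoduleHom, Algebra.TensorProduct.lift_tmul, Module.End.mul_apply]
  exact (mul_assoc _ _ _).symm

/-- Bounded form of `[M, T] = T'` for an unbounded `M` such that `p = M s` is bounded. -/
def Intertwines (φ : R →ₐ[ℝ] A) (s p : R) (T T' : A) : Prop :=
  φ p * T * φ s - φ s * T * φ p = φ s * T' * φ s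

/-- The element `B` is [1/s, T], stated without inverses. Left and right multiplications commute, so
A is a module over the commutative ring R ⊗ R and the scalar identity
`smul_commutator_eq_of_smul_sq_eq` applies; the analysis lies in producing `K`. -/
theorem exists_commutator [CompleteSpace A] {ι : Type*} [Fintype ι] (φ : R →ₐ[ℝ] A)
    (s v : R) (p : ι → R)
    (hv : v * (1 + s) = 1) (hp : ∑ i, p i ^ 2 + s ^ 2 = 1)
    (hc : ∀ X : A, φ s * X * φ s = 0 → X = 0)
    (hn1 : ∀ n : ℕ, ‖φ (s * v * (1 - 2 * (s * v)) ^ n)‖ ≤ 1 / (n + 1))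
    (hn2 : ∀ n : ℕ, ‖φ ((s * v) ^ 2 * (1 - 2 * (s * v)) ^ n)‖ ≤ 1 / (n + 1) ^ 2)
    (T : A) (T1 : ι → A) (T2 : ι → ι → A)
    (h1 : ∀ i, Intertwines φ s (p i) T (T1 i))
    (h2 : ∀ i j, Intertwines φ s (p j) (T1 i) (T2 i j)) :
    ∃ B : A, T * φ s - φ s * T = φ s * B * φ s := by
  let _ : Module (R ⊗[ℝ] R) A := Module.compHom A (bimoduleHom φ).toRingHom
  have smul_def : ∀ (c : R ⊗[ℝ] R) (x : A), c • x = bimoduleHom φ c x := fun c x => rfl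
  have tmul_smul : ∀ (a b : R) (x : A), (a ⊗ₜ[ℝ] b : R ⊗[ℝ] R) • x = φ a * x * φ b :=
    bimoduleHom_tmul φ
  -- t = s/(1 + s), so 1/t = 1/s + 1 has the same commutators as 1/s. The shift makes `D` equal to 1
  -- - α ⊗ α with α = 1 - 2t = (1 - s)/(1 + s), a Cayley transform, so that a Neumann series is
  -- available.
  set t := s * v with ht
  set α := 1 - 2 * t with hα
  have hvt : 1 - t = v := by rw [ht]; linear_combination -hv
  have hpt : ∑ i, (p i * v) ^ 2 = 1 - 2 * t := by
    simp only [mul_pow]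
    rw [← Finset.sum_mul, ht]
    linear_combination v ^ 2 * hp - (v * s - v - 1) * hv
  have hcomm : ∀ a b : R, φ a * φ b = φ b * φ a := fun a b => by
    rw [← map_mul, mul_comm, map_mul]
  have sand : ∀ (a b c d : R) (x : A), φ a * (φ c * x * φ d) * φ b = φ (a * c) * x * φ (d * b) :=
    fun a b c d x => by simp only [map_mul, mul_assoc]
  set L : A →L[ℝ] A := ContinuousLinearMap.mulLeftRight ℝ A (φ α) (φ α) with hL
  have hLx : ∀ x, L x = φ α * x * φ α := fun x => by
    rw [hL, ContinuousLinearMap.mulLeftRight_apply]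
  have hLn : ∀ (n : ℕ) x, (L ^ n) x = φ (α ^ n) * x * φ (α ^ n) := by
    intro n x
    induction n with
    | zero => simp
    | succ n ih =>
      rw [pow_succ', mul_apply_eq_comp, ih, hLx, sand, ← pow_succ', ← pow_succ]
  set ls : R ⊗[ℝ] R := t ⊗ₜ 1 with hls
  set rs : R ⊗[ℝ] R := 1 ⊗ₜ t with hrs
  have one_def : (1 : R ⊗[ℝ] R) = 1 ⊗ₜ 1 := rfl
  have two_l : (2 : R ⊗[ℝ] R) * ls = (2 * t) ⊗ₜ 1 := by
    rw [two_mul, two_mul, TensorProduct.add_tmul]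
  have two_r : (2 : R ⊗[ℝ] R) * rs = 1 ⊗ₜ (2 * t) := by
    rw [two_mul, two_mul, TensorProduct.tmul_add]
  have hαα : (1 - 2 * ls) * (1 - 2 * rs) = α ⊗ₜ[ℝ] α := by
    rw [two_l, two_r, one_def, ← TensorProduct.sub_tmul, ← TensorProduct.tmul_sub,
      Algebra.TensorProduct.tmul_mul_tmul, one_mul, mul_one]
  have hD : ∀ x : A, (1 - (1 - 2 * ls) * (1 - 2 * rs)) • x = x - L x := fun x => by
    rw [hαα, sub_smul, one_smul, tmul_smul, hLx]
  have hcv : ∀ X : A, φ t * X * φ t = 0 → X = 0 := by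
    intro X hX
    have h := hc (φ v * X * φ v) (by rw [sand, ← hX, mul_comm v s])
    have h2 := congrArg (fun Y => φ (1 + s) * Y * φ (1 + s)) h
    simp only [sand, mul_comm (1 + s) v, hv, map_one, mul_zero, zero_mul, one_mul, mul_one] at h2
    exact h2
  -- A fixed point X = αXα satisfies X = αⁿXαⁿ, and tαⁿ tends to 0 in norm, so tXt = 0.
  have inj : ∀ X : A, (1 - (1 - 2 * ls) * (1 - 2 * rs)) • X = 0 → X = 0 := by
    intro X hX
    rw [hD, sub_eq_zero] at hX
    have hX' : ∀ n : ℕ, X = φ (α ^ n) * X * φ (α ^ n) := by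
      intro n
      rw [← hLn]
      induction n with
      | zero => simp
      | succ n ih => rw [pow_succ, mul_apply_eq_comp, ← hX, ← ih]
    refine hcv X ?_
    have hbd : ∀ n : ℕ, ‖φ t * X * φ t‖ ≤ 1 / (n + 1) * ‖X‖ := by
      intro n
      have e : φ t * X * φ t = φ (t * α ^ n) * X * φ (t * α ^ n) := by
        nth_rewrite 1 [hX' n]; rw [sand, mul_comm (α ^ n)]
      rw [e]
      have hle : (1 : ℝ) / (n + 1) ≤ 1 := by
        rw [div_le_one (by positivity)]; linarith [(n.cast_nonneg : (0 : ℝ) ≤ n)]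
      calc _ ≤ ‖φ (t * α ^ n)‖ * ‖X‖ * ‖φ (t * α ^ n)‖ := norm_mul₃_le
        _ ≤ 1 / (n + 1) * ‖X‖ * 1 := by
          gcongr
          · exact hn1 n
          · exact (hn1 n).trans hle
        _ = _ := mul_one _
    have hlim : Tendsto (fun n : ℕ => 1 / ((n : ℝ) + 1) * ‖X‖) atTop (𝓝 0) := by
      simpa using tendsto_one_div_add_atTop_nhds_zero_nat.mul_const ‖X‖
    exact norm_le_zero_iff.mp (ge_of_tendsto' hlim hbd)
  -- The series for (1 - L)⁻² carries the weight n + 1, so cubic decay leaves the summable 1/(n +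
  -- 1)².
  have hsum : ∀ (a b : R) (X : A) (C : ℝ), (∀ n : ℕ, ‖φ (a * α ^ n)‖ * ‖φ (b * α ^ n)‖ ≤
      C * (1 / (n + 1) ^ 3)) → ∃ k : A,
      (1 - (1 - 2 * ls) * (1 - 2 * rs)) ^ 2 • k = (a ⊗ₜ[ℝ] b : R ⊗[ℝ] R) • X := by
    intro a b X C hC
    obtain ⟨k, hk⟩ := exists_sub_sub_eq L (φ a * X * φ b) (by
      have hs : Summable fun n : ℕ => (C * ‖X‖) * (1 / ((n + 1 : ℕ) : ℝ) ^ 2) :=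
        ((summable_nat_add_iff 1).2 (Real.summable_one_div_nat_pow.2 one_lt_two)).mul_left _
      refine Summable.of_nonneg_of_le (fun n => by positivity) (fun n => ?_) hs
      have e : φ (α ^ n) * (φ a * X * φ b) * φ (α ^ n) = φ (a * α ^ n) * X * φ (b * α ^ n) := by
        rw [sand, mul_comm a]
      rw [hLn, e]
      have hp : (0 : ℝ) < n + 1 := by positivity
      calc _ ≤ (n + 1 : ℝ) * (‖φ (a * α ^ n)‖ * ‖X‖ * ‖φ (b * α ^ n)‖) := by
            gcongr; exact norm_mul₃_le
        _ = (n + 1 : ℝ) * ‖X‖ * (‖φ (a * α ^ n)‖ * ‖φ (b * α ^ n)‖) := by ring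
        _ ≤ (n + 1 : ℝ) * ‖X‖ * (C * (1 / (n + 1) ^ 3)) := 
            mul_le_mul_of_nonneg_left (hC n) (by positivity)
        _ = _ := by push_cast; field_simp)
    refine ⟨k, ?_⟩
    rw [pow_two, mul_smul, hD k, hD, hk, tmul_smul]
  -- In each of the two terms one side carries t, giving 1/(n + 1), and the other t², giving 1/(n +
  -- 1)²: exactly the cubic decay required.
  have hK : ∀ i j, ∃ k : A, (1 - (1 - 2 * ls) * (1 - 2 * rs)) ^ 2 • k =
      (((p j * v) ⊗ₜ[ℝ] 1 : R ⊗[ℝ] R) * ls * rs ^ 2 + (1 ⊗ₜ[ℝ] (p j * v)) * ls ^ 2 * rs) •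
        T2 i j := by
    intro i j
    have hb1 : ∀ n : ℕ, ‖φ (p j * v * t * α ^ n)‖ ≤ ‖φ (p j * v)‖ * (1 / (n + 1)) := fun n => by
      rw [mul_assoc, map_mul]
      exact (norm_mul_le _ _).trans (by gcongr; exact hn1 n)
    have hp : ∀ n : ℕ, (0 : ℝ) < n + 1 := fun n => by positivity
    obtain ⟨k1, hk1⟩ := hsum (p j * v * t) (t ^ 2) (T2 i j) ‖φ (p j * v)‖ (fun n => by
      calc _ ≤ ‖φ (p j * v)‖ * (1 / (n + 1)) * (1 / (n + 1) ^ 2) := by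
            gcongr
            · exact hb1 n
            · exact hn2 n
        _ = _ := by have := hp n; field_simp)
    obtain ⟨k2, hk2⟩ := hsum (t ^ 2) (p j * v * t) (T2 i j) ‖φ (p j * v)‖ (fun n => by
      calc _ ≤ (1 / (n + 1) ^ 2) * (‖φ (p j * v)‖ * (1 / (n + 1))) := by
            gcongr
            · exact hn2 n
            · exact hb1 n
        _ = _ := by have := hp n; field_simp)
    refine ⟨k1 + k2, ?_⟩
    rw [smul_add, hk1, hk2, ← add_smul]
    simp [hls, hrs, Algebra.TensorProduct.tmul_mul_tmul, pow_two]
  choose K hK using hK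
  have hrel : ∀ (j : ι) (X Y : A), Intertwines φ s (p j) X Y → (ls * rs) • Y =
      (((p j * v) ⊗ₜ[ℝ] 1 : R ⊗[ℝ] R) * rs - ls * (1 ⊗ₜ[ℝ] (p j * v))) • X := by
    intro j X Y h
    have h' := congrArg (fun Z => φ v * Z * φ v) h
    simp only [hls, hrs, Algebra.TensorProduct.tmul_mul_tmul, one_mul, mul_one, sub_smul,
      tmul_smul, ht, mul_comm _ v]
    simp only [hcomm _ v, map_mul, mul_sub, sub_mul, mul_assoc] at h' ⊢
    exact h'.symm
  have main := smul_commutator_eq_of_smul_sq_eq ls rs (fun i => (p i * v) ⊗ₜ[ℝ] 1)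
    (fun i => 1 ⊗ₜ[ℝ] (p i * v)) (fun i => p i ⊗ₜ[ℝ] 1) (fun i => 1 ⊗ₜ[ℝ] p i)
    (by
      rw [two_l, one_def, ← TensorProduct.sub_tmul, ← hpt, TensorProduct.sum_tmul]
      simp)
    (by
      rw [two_r, one_def, ← TensorProduct.tmul_sub, ← hpt, TensorProduct.tmul_sum]
      simp)
    (fun i => by
      rw [hls, one_def, ← TensorProduct.sub_tmul, hvt, Algebra.TensorProduct.tmul_mul_tmul,
        mul_one])
    (fun i => by
      rw [hrs, one_def, ← TensorProduct.tmul_sub, hvt, Algebra.TensorProduct.tmul_mul_tmul,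
        mul_one])
    inj (algebraMap ℝ _ (1 / 2)) (by
      rw [← map_ofNat (algebraMap ℝ (R ⊗[ℝ] R)) 2, ← map_mul,
        show (1 / 2 : ℝ) * 2 = 1 by norm_num, map_one])
    T T1 T2 (fun i => hrel i _ _ (h1 i)) (fun i j => hrel j _ _ (h2 i j)) K hK
  obtain ⟨B, hB⟩ : ∃ B : A, (ls * rs) • B = (rs - ls) • T := ⟨_, main⟩
  refine ⟨B, ?_⟩
  -- As t(1 + s) = s, multiplying both sides by 1 + s turns tBt into sBs, and the extra terms sTs on
  -- the other side cancel.
  · have h' := congrArg (fun Z => φ (1 + s) * Z * φ (1 + s)) hB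
    rw [hls, hrs, Algebra.TensorProduct.tmul_mul_tmul, one_mul, mul_one, tmul_smul, sub_smul,
      tmul_smul, tmul_smul] at h'
    have e1 : t * (1 + s) = s := by rw [ht]; linear_combination s * hv
    have e2 : (1 + s) * t = s := by rw [mul_comm, e1]
    have e3 : ∀ X : A, φ (1 + s) * (φ t * X * φ t) * φ (1 + s) = φ s * X * φ s := fun X => by
      rw [sand, e1, e2]
    rw [e3] at h'
    rw [h']
    simp only [map_one, one_mul, mul_one, mul_sub, sub_mul]
    have e4 : φ (1 + s) * (T * φ t) * φ (1 + s) = φ (1 + s) * T * φ s := by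
      rw [mul_assoc, mul_assoc, ← map_mul, e1, ← mul_assoc]
    have e5 : φ (1 + s) * (φ t * T) * φ (1 + s) = φ s * T * φ (1 + s) := by
      rw [← mul_assoc, ← map_mul, e2]
    rw [e4, e5]
    simp only [map_add, map_one]
    noncomm_ring
end

end MoyalPlane

/-! ### Iterated commutators with the momenta -/

namespace MoyalPlane

section Smooth

variable {R A ι : Type*} [CommRing R] [Algebra ℝ R] [NormedRing A] [NormedAlgebra ℝ A]

/-- The iterated commutators of order at most `n` with the operators `Pᵢ = pᵢ / s` are bounded. -/
def CommutatorSmooth (φ : R →ₐ[ℝ] A) (s : R) (p : ι → R) : ℕ → A → Prop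
  | 0, _ => True
  | n + 1, T => ∀ i, ∃ T', Intertwines φ s (p i) T T' ∧ CommutatorSmooth φ s p n T'

variable {φ : R →ₐ[ℝ] A} {s : R} {p : ι → R}

theorem CommutatorSmooth.of_succ {n : ℕ} {T : A} (h : CommutatorSmooth φ s p (n + 1) T) :
    CommutatorSmooth φ s p n T := by
  induction n generalizing T with
  | zero => trivial
  | succ n ih => exact fun i => (h i).imp fun T' hT' => ⟨hT'.1, ih hT'.2⟩

theorem CommutatorSmooth.add {n : ℕ} {T U : A} (hT : CommutatorSmooth φ s p n T)
    (hU : CommutatorSmooth φ s p n U) : CommutatorSmooth φ s p n (T + U) := by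
  induction n generalizing T U with
  | zero => trivial
  | succ n ih =>
    intro i
    obtain ⟨T', h1, h2⟩ := hT i
    obtain ⟨U', h3, h4⟩ := hU i
    refine ⟨T' + U', ?_, ih h2 h4⟩
    simp only [Intertwines, mul_add, add_mul] at *
    rw [← h1, ← h3]; abel

theorem CommutatorSmooth.smul {n : ℕ} {T : A} (c : ℝ) (hT : CommutatorSmooth φ s p n T) :
    CommutatorSmooth φ s p n (c • T) := by
  induction n generalizing T with
  | zero => trivial
  | succ n ih =>
    intro i
    obtain ⟨T', h1, h2⟩ := hT i
    refine ⟨c • T', ?_, ih h2⟩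
    simp only [Intertwines, mul_smul_comm, smul_mul_assoc] at *
    rw [← h1, smul_sub]

/-- Multiplying from the left by an element of `A` that commutes with the image of `R`. -/
theorem CommutatorSmooth.mul_left {n : ℕ} {T : A} (b : A) (hb : ∀ r, Commute b (φ r))
    (hT : CommutatorSmooth φ s p n T) : CommutatorSmooth φ s p n (b * T) := by
  induction n generalizing T with
  | zero => trivial
  | succ n ih =>
    intro i
    obtain ⟨T', h1, h2⟩ := hT i
    refine ⟨b * T', ?_, ih h2⟩
    have h := congrArg (fun X => b * X) h1
    simp only [Intertwines, mul_sub, ← mul_assoc, (hb _).eq] at *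
    exact h

theorem CommutatorSmooth.mul_right {n : ℕ} {T : A} (b : A) (hb : ∀ r, Commute b (φ r))
    (hT : CommutatorSmooth φ s p n T) : CommutatorSmooth φ s p n (T * b) := by
  induction n generalizing T with
  | zero => trivial
  | succ n ih =>
    intro i
    obtain ⟨T', h1, h2⟩ := hT i
    refine ⟨T' * b, ?_, ih h2⟩
    have h := congrArg (fun X => X * b) h1
    simp only [Intertwines, sub_mul, mul_assoc, (hb _).symm.eq] at *
    exact h

theorem commute_map (φ : R →ₐ[ℝ] A) (a b : R) : Commute (φ a) (φ b) := by
  rw [commute_iff_eq, ← map_mul, mul_comm, map_mul]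

/-- The Jacobi identity for the commuting operators r/s and 1/s, namely [r/s, [1/s, T]] = [1/s,
[r/s, T]]. Denominators are cleared by one more factor s on each side, which `hc` then removes. -/
theorem intertwines_of_commutator (hc : ∀ X : A, φ s * X * φ s = 0 → X = 0)
    {T T' B B' : A} {r : R} (h : Intertwines φ s r T T')
    (hB : T * φ s - φ s * T = φ s * B * φ s) (hB' : T' * φ s - φ s * T' = φ s * B' * φ s) :
    Intertwines φ s r B B' := by
  refine sub_eq_zero.mp (hc _ ?_)
  have e : φ r * φ s = φ s * φ r := commute_map φ r s
  have e1 := congrArg (fun X => φ r * X * φ s) hB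
  have e2 := congrArg (fun X => φ s * X * φ r) hB
  have e3 := congrArg (fun X => φ s * X * φ s) hB'
  have e4 := congrArg (fun X => X * φ s) h
  have e5 := congrArg (fun X => φ s * X) h
  have e6 : φ s * (φ r * B * φ s - φ s * B * φ r - φ s * B' * φ s) * φ s =
      φ r * (φ s * B * φ s) * φ s - φ s * (φ s * B * φ s) * φ r
        - φ s * (φ s * B' * φ s) * φ s := by
    simp only [mul_sub, sub_mul, ← mul_assoc, e]
    congr 2
    simp only [mul_assoc, e]
  rw [e6, ← e1, ← e2, ← e3]
  have e7 : φ r * (T * φ s - φ s * T) * φ s - φ s * (T * φ s - φ s * T) * φ r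
      = (φ r * T * φ s - φ s * T * φ r) * φ s - φ s * (φ r * T * φ s - φ s * T * φ r) := by
    simp only [mul_sub, sub_mul, ← mul_assoc, e]
    have : φ s * T * φ r * φ s = φ s * T * φ s * φ r := by rw [mul_assoc, e, ← mul_assoc]
    rw [this]; abel
  rw [e7, e4, e5]
  simp only [mul_sub, sub_mul, ← mul_assoc, sub_self]

/-- Existence of [1/s, T] consumes two orders. The others pass to `B`, since its momentum
commutators are the commutators of 1/s with those of T, which exist by the same result. -/
theorem CommutatorSmooth.exists_commutator [CompleteSpace A] [Fintype ι] (v : R)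
    (hv : v * (1 + s) = 1) (hp : ∑ i, p i ^ 2 + s ^ 2 = 1)
    (hc : ∀ X : A, φ s * X * φ s = 0 → X = 0)
    (hn1 : ∀ n : ℕ, ‖φ (s * v * (1 - 2 * (s * v)) ^ n)‖ ≤ 1 / (n + 1))
    (hn2 : ∀ n : ℕ, ‖φ ((s * v) ^ 2 * (1 - 2 * (s * v)) ^ n)‖ ≤ 1 / (n + 1) ^ 2)
    {n : ℕ} {T : A} (hT : CommutatorSmooth φ s p (n + 2) T) :
    ∃ B : A, T * φ s - φ s * T = φ s * B * φ s ∧ CommutatorSmooth φ s p n B := by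
  have ex : ∀ (m : ℕ) (T : A), CommutatorSmooth φ s p (m + 2) T →
      ∃ B : A, T * φ s - φ s * T = φ s * B * φ s := by
    intro m T hT
    choose T1 h1 h1' using hT
    choose T2 h2 _ using h1'
    exact MoyalPlane.exists_commutator φ s v p hv hp hc hn1 hn2 T T1 T2 h1 h2
  have key : ∀ B : A, T * φ s - φ s * T = φ s * B * φ s → CommutatorSmooth φ s p n B := by
    induction n generalizing T with
    | zero => exact fun _ _ => trivial
    | succ n ih =>
      intro B hB i
      obtain ⟨T', h1, h2⟩ := hT i
      obtain ⟨B', hB'⟩ := ex n T' h2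
      exact ⟨B', intertwines_of_commutator hc h1 hB hB', ih h2 B' hB'⟩
  obtain ⟨B, hB⟩ := ex n T hT
  exact ⟨B, hB, key B hB⟩

end Smooth

end MoyalPlane

/-! ### Bounded Fourier multipliers on L² -/

namespace MoyalPlane

noncomputable section Multipliers

open MeasureTheory SchwartzMap FourierTransform
open scoped BoundedContinuousFunction ENNReal InnerProductSpace

variable {V F : Type*} [NormedAddCommGroup V] [InnerProductSpace ℝ V] [FiniteDimensional ℝ V]
  [MeasurableSpace V] [BorelSpace V] [NormedAddCommGroup F] [InnerProductSpace ℂ F]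

theorem memLp_bounded_smul (r : V →ᵇ ℝ) (f : Lp F 2 (volume : Measure V)) :
    MemLp (fun x => (r x : ℂ) • f x) 2 volume := by
  refine MemLp.of_le_mul (c := ‖r‖) (Lp.memLp f) ?_ (ae_of_all _ fun x => ?_)
  · exact (by fun_prop : Continuous fun x => (r x : ℂ)).aestronglyMeasurable.smul
      (Lp.aestronglyMeasurable f)
  · rw [norm_smul, Complex.norm_real]
    exact mul_le_mul_of_nonneg_right (r.norm_coe_le_norm x) (norm_nonneg _)

/-- Multiplication by a bounded continuous function on `L²`. -/
def multiplicationCLM (r : V →ᵇ ℝ) :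
    Lp F 2 (volume : Measure V) →L[ℂ] Lp F 2 (volume : Measure V) :=
  LinearMap.mkContinuous
    { toFun := fun f => (memLp_bounded_smul r f).toLp
      map_add' := fun f g => by
        rw [← MemLp.toLp_add, MemLp.toLp_eq_toLp_iff]
        filter_upwards [Lp.coeFn_add f g] with x hx
        simp only [hx, Pi.add_apply, smul_add]
      map_smul' := fun c f => by
        rw [RingHom.id_apply, ← MemLp.toLp_const_smul, MemLp.toLp_eq_toLp_iff]
        filter_upwards [Lp.coeFn_smul c f] with x hx
        simp only [hx, Pi.smul_apply]
        rw [smul_comm] } ‖r‖ fun f => by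
    refine Lp.norm_le_mul_norm_of_ae_le_mul ?_
    filter_upwards [(memLp_bounded_smul r f).coeFn_toLp] with x hx
    simp only [LinearMap.coe_mk, AddHom.coe_mk, hx]
    rw [norm_smul, Complex.norm_real]
    exact mul_le_mul_of_nonneg_right (r.norm_coe_le_norm x) (norm_nonneg _)

theorem coeFn_multiplicationCLM (r : V →ᵇ ℝ) (f : Lp F 2 (volume : Measure V)) :
    multiplicationCLM r f =ᵐ[volume] fun x => (r x : ℂ) • f x :=
  (memLp_bounded_smul r f).coeFn_toLp

theorem norm_multiplicationCLM_le (r : V →ᵇ ℝ) : ‖multiplicationCLM (F := F) r‖ ≤ ‖r‖ :=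
  LinearMap.mkContinuous_norm_le _ (norm_nonneg r) _

/-- Multiplication by bounded continuous functions as an algebra homomorphism. -/
def multiplicationHom : (V →ᵇ ℝ) →ₐ[ℝ]
    (Lp F 2 (volume : Measure V) →L[ℂ] Lp F 2 (volume : Measure V)) where
  toFun := multiplicationCLM
  map_one' := by
    ext1 f; refine Lp.ext ?_
    filter_upwards [coeFn_multiplicationCLM 1 f] with x hx
    simp [hx]
  map_mul' a b := by
    ext1 f; refine Lp.ext ?_
    filter_upwards [coeFn_multiplicationCLM (a * b) f, coeFn_multiplicationCLM b f,
      coeFn_multiplicationCLM a (multiplicationCLM b f)] with x h1 h2 h3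
    rw [h1, mul_apply_eq_comp, h3, h2, smul_smul]
    simp
  map_zero' := by
    ext1 f; refine Lp.ext ?_
    filter_upwards [coeFn_multiplicationCLM 0 f, Lp.coeFn_zero F 2 (volume : Measure V)] with x hx h
    rw [hx, show ((0 : V →ᵇ ℝ) x : ℂ) = 0 by simp, zero_smul]
    exact h.symm
  map_add' a b := by
    ext1 f; refine Lp.ext ?_
    filter_upwards [coeFn_multiplicationCLM (a + b) f, coeFn_multiplicationCLM b f,
      coeFn_multiplicationCLM a f, Lp.coeFn_add (multiplicationCLM a f) (multiplicationCLM b f)]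
      with x h1 h2 h3 h4
    rw [add_apply, h4, h1, Pi.add_apply, h2, h3, ← add_smul]
    simp
  commutes' c := by
    ext1 f; refine Lp.ext ?_
    filter_upwards [coeFn_multiplicationCLM (algebraMap ℝ (V →ᵇ ℝ) c) f,
      Lp.coeFn_smul c f] with x h1 h2
    have e : (algebraMap ℝ (Lp F 2 (volume : Measure V) →L[ℂ] Lp F 2 (volume : Measure V)) c) f =
        c • f := by rw [Algebra.algebraMap_eq_smul_one]; rfl
    rw [e, h1, h2, Pi.smul_apply, Algebra.algebraMap_eq_smul_one]
    simp

variable [CompleteSpace F]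

/-- Bounded continuous Fourier multipliers on `L²`. -/
def multiplierHom : (V →ᵇ ℝ) →ₐ[ℝ]
    (Lp F 2 (volume : Measure V) →L[ℂ] Lp F 2 (volume : Measure V)) :=
  (((Lp.fourierTransformₗᵢ V F).symm.toContinuousLinearEquiv.conjContinuousAlgEquiv :
    _ ≃A[ℂ] _).toAlgEquiv.toAlgHom.restrictScalars ℝ).comp multiplicationHom

theorem fourier_multiplierHom (r : V →ᵇ ℝ) (f : Lp F 2 (volume : Measure V)) :
    𝓕 (multiplierHom r f) = multiplicationCLM r (𝓕 f) := by
  have : multiplierHom r f = 𝓕⁻ (multiplicationCLM r (𝓕 f)) := rfl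
  rw [this, FourierTransform.fourier_fourierInv_eq]

attribute [irreducible] multiplierHom

theorem norm_multiplierHom_le (r : V →ᵇ ℝ) : ‖multiplierHom (F := F) r‖ ≤ ‖r‖ := by
  refine ContinuousLinearMap.opNorm_le_bound _ (norm_nonneg r) fun f => ?_
  rw [← Lp.norm_fourier_eq, fourier_multiplierHom, ← Lp.norm_fourier_eq f]
  exact ContinuousLinearMap.le_of_opNorm_le _ (norm_multiplicationCLM_le r) _

theorem inner_multiplierHom (r : V →ᵇ ℝ) (f g : Lp F 2 (volume : Measure V)) :
    inner ℂ (multiplierHom r f) g = inner ℂ f (multiplierHom r g) := by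
  rw [← Lp.inner_fourier_eq, fourier_multiplierHom, ← Lp.inner_fourier_eq f,
    fourier_multiplierHom, L2.inner_def, L2.inner_def]
  refine integral_congr_ae ?_
  filter_upwards [coeFn_multiplicationCLM r (𝓕 f), coeFn_multiplicationCLM r (𝓕 g)] with x h1 h2
  rw [h1, h2, inner_smul_left, inner_smul_right, Complex.conj_ofReal]

theorem multiplierHom_injective {r : V →ᵇ ℝ} (hr : ∀ x, r x ≠ 0)
    {f : Lp F 2 (volume : Measure V)} (hf : multiplierHom r f = 0) : f = 0 := by
  have h : multiplicationCLM r (𝓕 f) = 0 := by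
    rw [← fourier_multiplierHom, hf, FourierTransform.fourier_zero]
  have : 𝓕 f = 0 := by
    refine Lp.ext ?_
    have h' := coeFn_multiplicationCLM r (𝓕 f)
    rw [h] at h'
    filter_upwards [h', Lp.coeFn_zero F 2 (volume : Measure V)] with x h1 h2
    rw [h2] at h1 ⊢
    exact (smul_eq_zero.1 h1.symm).resolve_left (Complex.ofReal_ne_zero.2 (hr x))
  have h2 := congrArg (fun g => 𝓕⁻ g) this
  simpa only [FourierTransform.fourierInv_fourier_eq, FourierTransform.fourierInv_zero] using h2

/-- X vanishes on the range of an injective symmetric multiplier. That range is dense, which is used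
through the adjoint: the multiplier annihilates every X*g, so X* = 0. -/
theorem eq_zero_of_multiplierHom_mul_mul {r : V →ᵇ ℝ} (hr : ∀ x, r x ≠ 0)
    (X : Lp F 2 (volume : Measure V) →L[ℂ] Lp F 2 (volume : Measure V))
    (h : multiplierHom r * X * multiplierHom r = 0) : X = 0 := by
  have h1 : ∀ f, X (multiplierHom r f) = 0 := fun f =>
    multiplierHom_injective hr (by
      rw [← mul_apply_eq_comp, ← mul_apply_eq_comp, h, zero_apply])
  have h2 : ∀ g, ContinuousLinearMap.adjoint X g = 0 := by
    intro g
    have h3 : ∀ f, inner ℂ (multiplierHom r (ContinuousLinearMap.adjoint X g)) f = 0 := by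
      intro f
      rw [inner_multiplierHom, ContinuousLinearMap.adjoint_inner_left, h1, inner_zero_right]
    exact multiplierHom_injective hr (inner_self_eq_zero.1 (h3 _))
  ext1 f
  have h4 : inner ℂ (X f) (X f) = 0 := by
    rw [← ContinuousLinearMap.adjoint_inner_right, h2, inner_zero_right]
  exact inner_self_eq_zero.1 h4

/-- On Schwartz functions the multipliers are the usual ones. -/
theorem multiplierHom_toLp {r : V →ᵇ ℝ} (hr : (r : V → ℝ).HasTemperateGrowth) (f : 𝓢(V, F)) :
    multiplierHom r (f.toLp 2) = (SchwartzMap.fourierMultiplierCLM F (r : V → ℝ) f).toLp 2 := by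
  have h : 𝓕 (multiplierHom r (f.toLp 2)) =
      𝓕 ((SchwartzMap.fourierMultiplierCLM F (r : V → ℝ) f).toLp 2 (volume : Measure V)) := by
    rw [fourier_multiplierHom, SchwartzMap.toLp_fourier_eq, SchwartzMap.toLp_fourier_eq,
      SchwartzMap.fourierMultiplierCLM_apply, FourierTransform.fourier_fourierInv_eq]
    refine Lp.ext ?_
    filter_upwards [coeFn_multiplicationCLM r ((𝓕 f).toLp 2), (𝓕 f).coeFn_toLp 2 volume,
      (smulLeftCLM F (r : V → ℝ) (𝓕 f)).coeFn_toLp 2 volume] with x h1 h2 h3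
    rw [h1, h2, h3, smulLeftCLM_apply_apply hr]
    simp
  have := congrArg (fun g => 𝓕⁻ g) h
  simpa only [FourierTransform.fourierInv_fourier_eq] using this

end Multipliers

end MoyalPlane

/-! ### Self-adjoint operators as quotients of bounded operators -/

namespace MoyalPlane

noncomputable section BoundedPairs

open scoped InnerProductSpace

variable {H : Type*} [NormedAddCommGroup H] [InnerProductSpace ℂ H]

/-- A pair of bounded operators that represents the self-adjoint operator `Q / S`, whose graph is
`{(S z, Q z)}`. -/
structure IsBoundedPair (S Q : H →L[ℂ] H) (κ : ℝ) : Prop where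
  symm_left : ∀ x y, inner ℂ (S x) y = inner ℂ x (S y)
  symm_right : ∀ x y, inner ℂ (Q x) y = inner ℂ x (Q y)
  comm : ∀ x, S (Q x) = Q (S x)
  inj : ∀ x, S x = 0 → x = 0
  sq_add_sq : ∀ x, S (S x) + (κ : ℂ) • Q (Q x) = x

variable {S Q : H →L[ℂ] H} {κ : ℝ} {M : H →ₗ.[ℂ] H}

/-- The graph `{(x, y) | Q x = S y}` of `Q / S`. -/
def quotientGraph (S Q : H →L[ℂ] H) : Submodule ℂ (H × H) :=
  LinearMap.ker (Q.toLinearMap ∘ₗ LinearMap.fst ℂ H H - S.toLinearMap ∘ₗ LinearMap.snd ℂ H H)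

theorem mem_quotientGraph {p : H × H} : p ∈ quotientGraph S Q ↔ Q p.1 = S p.2 := by
  simp [quotientGraph, sub_eq_zero]

namespace IsBoundedPair

theorem mem_graph (h : IsBoundedPair S Q κ) (z : H) : (S z, Q z) ∈ quotientGraph S Q :=
  mem_quotientGraph.2 (h.comm z).symm

/-- Identifies the two descriptions of the graph. The witness z = Sx + κQy is forced by S²z + κQ²z =
z. -/
theorem exists_of_mem_graph (h : IsBoundedPair S Q κ) {x y : H}
    (hxy : (x, y) ∈ quotientGraph S Q) : ∃ z, S z = x ∧ Q z = y := by
  have e : Q x = S y := mem_quotientGraph.1 hxy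
  refine ⟨S x + (κ : ℂ) • Q y, ?_, ?_⟩
  · rw [map_add, map_smul, h.comm, ← e, h.sq_add_sq]
  · rw [map_add, map_smul, ← h.comm, e, h.sq_add_sq]

theorem graph_toLinearPMap (h : IsBoundedPair S Q κ) :
    (quotientGraph S Q).toLinearPMap.graph = quotientGraph S Q := by
  refine Submodule.toLinearPMap_graph_eq _ fun p hp h0 => h.inj _ ?_
  rw [← mem_quotientGraph.1 hp, h0, map_zero]

theorem dense_range [CompleteSpace H] (h : IsBoundedPair S Q κ) : DenseRange S := by
  change Dense (LinearMap.range S.toLinearMap : Set H)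
  rw [Submodule.dense_iff_topologicalClosure_eq_top,
    Submodule.topologicalClosure_eq_top_iff, Submodule.eq_bot_iff]
  intro x hx
  refine h.inj x ((inner_self_eq_zero (𝕜 := ℂ)).1 ?_)
  rw [← h.symm_left (S x) x]
  exact Submodule.inner_right_of_mem_orthogonal (K := LinearMap.range S.toLinearMap)
    (LinearMap.mem_range_self _ _) hx

theorem dense_domain [CompleteSpace H] (h : IsBoundedPair S Q κ) (hM : M.graph = quotientGraph S Q) :
    Dense (M.domain : Set H) := by
  refine h.dense_range.mono ?_
  rintro _ ⟨z, rfl⟩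
  have hz : (S z, Q z) ∈ M.graph := hM ▸ h.mem_graph z
  exact LinearPMap.mem_domain_of_mem_graph hz

/-- Tested against the pairs (Sz, Qz), membership of (x, y) in the adjoint graph reads Qx = Sy,
because S and Q are symmetric. -/
theorem isSelfAdjoint [CompleteSpace H] (h : IsBoundedPair S Q κ) (hM : M.graph = quotientGraph S Q) :
    IsSelfAdjoint M := by
  rw [LinearPMap.isSelfAdjoint_def]
  refine LinearPMap.eq_of_eq_graph ?_
  rw [LinearPMap.adjoint_graph_eq_graph_adjoint (h.dense_domain hM), hM]
  ext ⟨x, y⟩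
  rw [Submodule.mem_adjoint_iff, mem_quotientGraph]
  constructor
  · intro hxy
    refine ext_inner_left ℂ fun z => ?_
    have := hxy _ _ (h.mem_graph z)
    rwa [sub_eq_zero, h.symm_right, h.symm_left] at this
  · intro e a b hab
    obtain ⟨z, rfl, rfl⟩ := h.exists_of_mem_graph hab
    rw [sub_eq_zero, h.symm_right, h.symm_left, e]

theorem exists_mem_graph_iff (h : IsBoundedPair S Q κ) (x w : H) :
    (∃ y, (x, y) ∈ quotientGraph S Q ∧ (y, w) ∈ quotientGraph S Q) ↔ Q (Q x) = S (S w) := by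
  simp only [mem_quotientGraph]
  constructor
  · rintro ⟨y, h1, h2⟩
    rw [h1, ← h.comm, h2]
  · intro e
    -- From Q²x = S²w and S²x + κQ²x = x. So x lies in the range of S², and the intermediate vector
    -- QS(x + κw) can be written down.
    have e1 : x = S (S (x + (κ : ℂ) • w)) := by
      conv_lhs => rw [← h.sq_add_sq x, e]
      simp
    refine ⟨Q (S (x + (κ : ℂ) • w)), ?_, sub_eq_zero.1 (h.inj _ ?_)⟩
    · rw [h.comm, ← e1]
    · rw [map_sub, h.comm, h.comm, ← e1, e, sub_self]

theorem isAbsoluteValue [CompleteSpace H] {Q' : H →L[ℂ] H} {T : H →ₗ.[ℂ] H} (h : IsBoundedPair S Q κ)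
    (h' : IsBoundedPair S Q' κ) (hM : M.graph = quotientGraph S Q)
    (hT : T.graph = quotientGraph S Q') (hsq : ∀ x, Q (Q x) = Q' (Q' x))
    (hpos : ∀ z, 0 ≤ (inner ℂ (S z) (Q z)).re) : IsAbsoluteValue T M := by
  refine ⟨h.isSelfAdjoint hM, fun x => ?_, fun x z => ?_⟩
  · obtain ⟨z, h1, h2⟩ := h.exists_of_mem_graph (hM ▸ M.mem_graph x)
    rw [← h1, ← h2]
    exact hpos z
  · rw [hM, hT, h.exists_mem_graph_iff, h'.exists_mem_graph_iff, hsq]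

/-- Evaluated at z with x = Sz and Mx = Qz, the hypothesis says that (Ax, AMx + Cx) lies in the
graph. This yields invariance of the domain and the commutator at once. -/
theorem isCommutator (h : IsBoundedPair S Q κ) (hM : M.graph = quotientGraph S Q)
    {A C : H →L[ℂ] H} (hA : Q * A * S - S * A * Q = S * C * S) : IsCommutator M A C := by
  intro x
  obtain ⟨z, h1, h2⟩ := h.exists_of_mem_graph (hM ▸ M.mem_graph x)
  have key : (A x, A (M x) + C x) ∈ M.graph := by
    rw [hM, mem_quotientGraph, ← h1, ← h2]
    have := congrArg (fun X => X z) hA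
    simp only [sub_apply, mul_apply_eq_comp] at this
    rw [map_add, ← this]; abel
  have hx := LinearPMap.mem_domain_of_mem_graph key
  refine ⟨hx, ?_⟩
  have e := LinearPMap.mem_graph_snd_inj M (M.mem_graph ⟨A x, hx⟩) key rfl
  rw [e]; abel

end IsBoundedPair

end BoundedPairs

end MoyalPlane

/-! ### The bounded symbols of the momenta and of |D| -/

namespace MoyalPlane

noncomputable section Symbols

open MeasureTheory SchwartzMap
open scoped BoundedContinuousFunction InnerProductSpace

variable {V : Type*} [NormedAddCommGroup V] [InnerProductSpace ℝ V]

/-- The function `(1 + |ξ|²)^{-1/2}`. -/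
def japaneseInv (V : Type*) [NormedAddCommGroup V] [InnerProductSpace ℝ V] (ξ : V) : ℝ :=
  (1 + ‖ξ‖ ^ 2) ^ (-(1 / 2) : ℝ)

theorem japaneseInv_pos (ξ : V) : 0 < japaneseInv V ξ := Real.rpow_pos_of_pos (by positivity) _

theorem sq_japaneseInv (ξ : V) : japaneseInv V ξ ^ 2 * (1 + ‖ξ‖ ^ 2) = 1 := by
  have h : (0 : ℝ) < 1 + ‖ξ‖ ^ 2 := by positivity
  rw [japaneseInv, ← Real.rpow_natCast, ← Real.rpow_mul h.le]
  norm_num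
  rw [Real.rpow_neg_one, inv_mul_cancel₀ h.ne']

theorem japaneseInv_le_one (ξ : V) : japaneseInv V ξ ≤ 1 := by
  nlinarith [sq_japaneseInv ξ, japaneseInv_pos ξ, sq_nonneg ‖ξ‖,
    mul_nonneg (sq_nonneg (japaneseInv V ξ)) (sq_nonneg ‖ξ‖)]

theorem norm_mul_japaneseInv_le_one (ξ : V) : ‖ξ‖ * japaneseInv V ξ ≤ 1 := by
  have h1 := sq_japaneseInv ξ
  have h2 := mul_nonneg (norm_nonneg ξ) (japaneseInv_pos ξ).le
  nlinarith [sq_nonneg (japaneseInv V ξ)]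

theorem hasTemperateGrowth_japaneseInv : (japaneseInv V).HasTemperateGrowth :=
  Function.hasTemperateGrowth_one_add_norm_sq_rpow V _

theorem continuous_japaneseInv : Continuous (japaneseInv V) :=
  hasTemperateGrowth_japaneseInv.1.continuous

/-- The bounded symbol `s = (1 + |ξ|²)^{-1/2}`. -/
def symbolS (V : Type*) [NormedAddCommGroup V] [InnerProductSpace ℝ V] : V →ᵇ ℝ :=
  .ofNormedAddCommGroup (japaneseInv V) continuous_japaneseInv 1 fun ξ => by
    rw [Real.norm_of_nonneg (japaneseInv_pos ξ).le]; exact japaneseInv_le_one ξ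

/-- The bounded symbol `⟨e, ξ⟩ s`. -/
def symbolP (e : V) : V →ᵇ ℝ :=
  .ofNormedAddCommGroup (fun ξ => inner ℝ ξ e * japaneseInv V ξ)
    ((by fun_prop : Continuous fun ξ : V => inner ℝ ξ e).mul continuous_japaneseInv) ‖e‖ fun ξ => by
    rw [norm_mul, Real.norm_of_nonneg (japaneseInv_pos ξ).le]
    calc _ ≤ ‖ξ‖ * ‖e‖ * japaneseInv V ξ :=
          mul_le_mul_of_nonneg_right (norm_inner_le_norm ξ e) (japaneseInv_pos ξ).le
      _ = ‖e‖ * (‖ξ‖ * japaneseInv V ξ) := by ring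
      _ ≤ ‖e‖ * 1 := by gcongr; exact norm_mul_japaneseInv_le_one ξ
      _ = _ := mul_one _

/-- The bounded symbol `2π |ξ| s`. -/
def symbolQ (V : Type*) [NormedAddCommGroup V] [InnerProductSpace ℝ V] : V →ᵇ ℝ :=
  .ofNormedAddCommGroup (fun ξ => 2 * Real.pi * (‖ξ‖ * japaneseInv V ξ))
    (continuous_const.mul (continuous_norm.mul continuous_japaneseInv)) (2 * Real.pi) fun ξ => by
    have := mul_nonneg (norm_nonneg ξ) (japaneseInv_pos ξ).le
    rw [Real.norm_of_nonneg (by positivity)]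
    have := norm_mul_japaneseInv_le_one ξ
    have := Real.pi_pos
    nlinarith

/-- The bounded symbol `2π (|ξ| - 1 / s)`. -/
def symbolB (V : Type*) [NormedAddCommGroup V] [InnerProductSpace ℝ V] : V →ᵇ ℝ :=
  .ofNormedAddCommGroup (fun ξ => 2 * Real.pi * (‖ξ‖ - (japaneseInv V ξ)⁻¹))
    (continuous_const.mul (continuous_norm.sub
      (continuous_japaneseInv.inv₀ fun ξ => (japaneseInv_pos ξ).ne'))) (2 * Real.pi) fun ξ => by
    have h0 := japaneseInv_pos ξ
    have h1 : (japaneseInv V ξ)⁻¹ ^ 2 = 1 + ‖ξ‖ ^ 2 := by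
      have := sq_japaneseInv ξ
      field_simp
      linarith
    have h2 : 0 < (japaneseInv V ξ)⁻¹ := inv_pos.2 h0
    have h3 := norm_nonneg ξ
    have h4 : |‖ξ‖ - (japaneseInv V ξ)⁻¹| ≤ 1 := by
      rw [abs_le]; constructor <;> nlinarith
    rw [norm_mul, Real.norm_of_nonneg (by positivity), Real.norm_eq_abs]
    have := Real.pi_pos
    nlinarith

/-- The bounded symbol `1 / (1 + s)`. -/
def symbolV (V : Type*) [NormedAddCommGroup V] [InnerProductSpace ℝ V] : V →ᵇ ℝ :=
  .ofNormedAddCommGroup (fun ξ => (1 + japaneseInv V ξ)⁻¹)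
    ((continuous_const.add continuous_japaneseInv).inv₀ fun ξ => by
      have := japaneseInv_pos ξ; exact (by linarith : 0 < 1 + japaneseInv V ξ).ne') 1 fun ξ => by
    have := japaneseInv_pos ξ
    rw [Real.norm_of_nonneg (by positivity)]
    exact inv_le_one_of_one_le₀ (by linarith)

@[simp] theorem symbolS_apply (ξ : V) : symbolS V ξ = japaneseInv V ξ := rfl
@[simp] theorem symbolP_apply (e ξ : V) : symbolP e ξ = inner ℝ ξ e * japaneseInv V ξ := rfl
@[simp] theorem symbolQ_apply (ξ : V) :
    symbolQ V ξ = 2 * Real.pi * (‖ξ‖ * japaneseInv V ξ) := rfl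
@[simp] theorem symbolB_apply (ξ : V) :
    symbolB V ξ = 2 * Real.pi * (‖ξ‖ - (japaneseInv V ξ)⁻¹) := rfl
@[simp] theorem symbolV_apply (ξ : V) : symbolV V ξ = (1 + japaneseInv V ξ)⁻¹ := rfl

/-- Divided by s this reads |D| = 2πλ + b with b a bounded multiplier, so commutators with |D|
reduce to those with λ. -/
theorem symbolQ_eq : symbolQ V = algebraMap ℝ _ (2 * Real.pi) + symbolB V * symbolS V := by
  ext ξ
  have := japaneseInv_pos ξ
  rw [Algebra.algebraMap_eq_smul_one]
  simp
  field_simp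
  ring

theorem symbolV_mul : symbolV V * (1 + symbolS V) = 1 := by
  ext ξ
  have := japaneseInv_pos ξ
  simp
  field_simp

theorem sum_symbolP_sq {ι : Type*} [Fintype ι] (b : OrthonormalBasis ι ℝ V) :
    ∑ i, symbolP (b i) ^ 2 = ((2 * Real.pi) ^ 2)⁻¹ • symbolQ V ^ 2 := by
  ext ξ
  have h := b.sum_sq_inner_left ξ
  have : ∑ i, (inner ℝ ξ (b i) * japaneseInv V ξ) ^ 2 = ‖ξ‖ ^ 2 * japaneseInv V ξ ^ 2 := by
    simp_rw [mul_pow]; rw [← Finset.sum_mul, h]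
  simp [this]
  field_simp

theorem symbolS_sq_add : symbolS V ^ 2 + ((2 * Real.pi) ^ 2)⁻¹ • symbolQ V ^ 2 = 1 := by
  ext ξ
  have := sq_japaneseInv ξ
  simp
  field_simp
  linarith

theorem norm_symbol_pow_le (n : ℕ) :
    ‖symbolS V * symbolV V * (1 - 2 * (symbolS V * symbolV V)) ^ n‖ ≤ 1 / (n + 1) ∧
    ‖(symbolS V * symbolV V) ^ 2 * (1 - 2 * (symbolS V * symbolV V)) ^ n‖ ≤ 1 / (n + 1) ^ 2 := by
  have h : ∀ ξ : V, 0 ≤ symbolS V ξ * symbolV V ξ ∧ symbolS V ξ * symbolV V ξ ≤ 1 / 2 := by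
    intro ξ
    have h1 := japaneseInv_pos ξ
    have h2 := japaneseInv_le_one ξ
    refine ⟨by simp; positivity, ?_⟩
    simp only [symbolS_apply, symbolV_apply]
    rw [← div_eq_mul_inv, div_le_div_iff₀ (by positivity) (by positivity)]
    linarith
  have h2 : ∀ ξ : V, (2 : V →ᵇ ℝ) ξ = 2 := fun ξ => rfl
  constructor
  · refine (BoundedContinuousFunction.norm_le (by positivity)).2 fun ξ => ?_
    have := mul_one_sub_two_mul_pow_le (h ξ).1 (h ξ).2 n
    rw [Real.norm_of_nonneg]
    · exact this
    · exact mul_nonneg (h ξ).1 (pow_nonneg (sub_nonneg.2 (by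
        change 2 * (symbolS V ξ * symbolV V ξ) ≤ 1; linarith [(h ξ).2])) n)
  · refine (BoundedContinuousFunction.norm_le (by positivity)).2 fun ξ => ?_
    have := sq_mul_one_sub_two_mul_pow_le (h ξ).1 (h ξ).2 n
    rw [Real.norm_of_nonneg]
    · exact this
    · exact mul_nonneg (sq_nonneg _) (pow_nonneg (sub_nonneg.2 (by
        change 2 * (symbolS V ξ * symbolV V ξ) ≤ 1; linarith [(h ξ).2])) n)

end Symbols

end MoyalPlane

/-! ### The Dirac operator and its bounded form -/

namespace MoyalPlane

noncomputable section Dirac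

open FourierTransform
open scoped BoundedContinuousFunction InnerProductSpace

variable {N : ℕ}

/-- The constant matrices acting on square-integrable spinors. -/
def spinorHom (N : ℕ) :
    Matrix (Fin (2 ^ N)) (Fin (2 ^ N)) ℂ →ₐ[ℂ] (SpinorL2 N →L[ℂ] SpinorL2 N) where
  toFun M := (Matrix.toEuclideanCLM (𝕜 := ℂ) M).compLpL 2 volume
  map_one' := by
    ext1 f; refine Lp.ext ?_
    filter_upwards [ContinuousLinearMap.coeFn_compLpL (Matrix.toEuclideanCLM (𝕜 := ℂ)
      (1 : Matrix (Fin (2 ^ N)) (Fin (2 ^ N)) ℂ)) f] with x hx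
    rw [hx, map_one]; rfl
  map_mul' A B := by
    ext1 f; refine Lp.ext ?_
    filter_upwards [ContinuousLinearMap.coeFn_compLpL (Matrix.toEuclideanCLM (𝕜 := ℂ) (A * B)) f,
      ContinuousLinearMap.coeFn_compLpL (Matrix.toEuclideanCLM (𝕜 := ℂ) B) f,
      ContinuousLinearMap.coeFn_compLpL (Matrix.toEuclideanCLM (𝕜 := ℂ) A)
        ((Matrix.toEuclideanCLM (𝕜 := ℂ) B).compLpL 2 volume f)] with x h1 h2 h3
    rw [h1, mul_apply_eq_comp, h3, h2, map_mul, mul_apply_eq_comp]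
  map_zero' := by
    ext1 f; refine Lp.ext ?_
    filter_upwards [ContinuousLinearMap.coeFn_compLpL (Matrix.toEuclideanCLM (𝕜 := ℂ)
      (0 : Matrix (Fin (2 ^ N)) (Fin (2 ^ N)) ℂ)) f,
      Lp.coeFn_zero (Spinor N) 2 (volume : Measure (PhaseSpace N))] with x hx h0
    rw [hx, map_zero]
    exact h0.symm
  map_add' A B := by
    ext1 f; refine Lp.ext ?_
    filter_upwards [ContinuousLinearMap.coeFn_compLpL (Matrix.toEuclideanCLM (𝕜 := ℂ) (A + B)) f,
      ContinuousLinearMap.coeFn_compLpL (Matrix.toEuclideanCLM (𝕜 := ℂ) B) f,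
      ContinuousLinearMap.coeFn_compLpL (Matrix.toEuclideanCLM (𝕜 := ℂ) A) f,
      Lp.coeFn_add ((Matrix.toEuclideanCLM (𝕜 := ℂ) A).compLpL 2 volume f)
        ((Matrix.toEuclideanCLM (𝕜 := ℂ) B).compLpL 2 volume f)] with x h1 h2 h3 h4
    rw [h1, add_apply, h4, Pi.add_apply, h2, h3, map_add, add_apply]
  commutes' c := by
    ext1 f; refine Lp.ext ?_
    filter_upwards [ContinuousLinearMap.coeFn_compLpL (Matrix.toEuclideanCLM (𝕜 := ℂ)
      (algebraMap ℂ (Matrix (Fin (2 ^ N)) (Fin (2 ^ N)) ℂ) c)) f, Lp.coeFn_smul c f] with x h1 h2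
    have e : (algebraMap ℂ (SpinorL2 N →L[ℂ] SpinorL2 N) c) f = c • f := by
      rw [Algebra.algebraMap_eq_smul_one]; rfl
    rw [e, h1, h2, Algebra.algebraMap_eq_smul_one, map_smul, map_one]; rfl

theorem coeFn_spinorHom (M : Matrix (Fin (2 ^ N)) (Fin (2 ^ N)) ℂ) (f : SpinorL2 N) :
    spinorHom N M f =ᵐ[volume] fun x => Matrix.toEuclideanCLM (𝕜 := ℂ) M (f x) :=
  ContinuousLinearMap.coeFn_compLpL _ f

theorem spinorHom_toLp (M : Matrix (Fin (2 ^ N)) (Fin (2 ^ N)) ℂ)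
    (Ψ : 𝓢(PhaseSpace N, Spinor N)) : spinorHom N M (Ψ.toLp 2) =
      (postcompCLM (Matrix.toEuclideanCLM (𝕜 := ℂ) M) Ψ).toLp 2 := by
  refine Lp.ext ?_
  filter_upwards [coeFn_spinorHom M (Ψ.toLp 2), Ψ.coeFn_toLp 2 volume,
    (postcompCLM (Matrix.toEuclideanCLM (𝕜 := ℂ) M) Ψ).coeFn_toLp 2 volume] with x h1 h2 h3
  rw [h1, h2, h3, postcompCLM_apply]

theorem inner_spinorHom {M : Matrix (Fin (2 ^ N)) (Fin (2 ^ N)) ℂ} (hM : M.IsHermitian)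
    (f g : SpinorL2 N) : inner ℂ (spinorHom N M f) g = inner ℂ f (spinorHom N M g) := by
  rw [L2.inner_def, L2.inner_def]
  refine integral_congr_ae ?_
  filter_upwards [coeFn_spinorHom M f, coeFn_spinorHom M g] with x h1 h2
  rw [h1, h2]
  have : ContinuousLinearMap.adjoint (Matrix.toEuclideanCLM (𝕜 := ℂ) M) =
      Matrix.toEuclideanCLM (𝕜 := ℂ) M := by
    rw [← ContinuousLinearMap.star_eq_adjoint, ← map_star, Matrix.star_eq_conjTranspose, hM.eq]
  conv_lhs => rw [← this]
  exact ContinuousLinearMap.adjoint_inner_left _ _ _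

theorem denseRange_toLp_spinor :
    DenseRange fun Ψ : 𝓢(PhaseSpace N, Spinor N) => (Ψ.toLp 2 : SpinorL2 N) :=
  denseRange_toLpCLM (p := 2) (by norm_num)

/-- A constant matrix can be pulled through the Fourier integral of a Schwartz spinor; density
extends this to L². -/
theorem fourier_spinorHom (M : Matrix (Fin (2 ^ N)) (Fin (2 ^ N)) ℂ) (f : SpinorL2 N) :
    𝓕 (spinorHom N M f) = spinorHom N M (𝓕 f) := by
  refine denseRange_toLp_spinor.induction_on (p := fun f => 𝓕 (spinorHom N M f) =
    spinorHom N M (𝓕 f)) f (isClosed_eq ?_ ?_) fun Ψ => ?_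
  · exact (Lp.fourierTransformₗᵢ _ _).continuous.comp (spinorHom N M).continuous
  · exact (spinorHom N M).continuous.comp (Lp.fourierTransformₗᵢ _ _).continuous
  · rw [spinorHom_toLp, toLp_fourier_eq, toLp_fourier_eq, spinorHom_toLp]
    congr 1
    ext1 ξ
    rw [postcompCLM_apply, fourier_coe, fourier_coe]
    rw [Real.fourier_eq', Real.fourier_eq', ← ContinuousLinearMap.integral_comp_comm]
    · simp only [postcompCLM_apply, map_smul]
    · have h := (Real.fourierIntegral_convergent_iff (μ := volume) (f := (Ψ : _ → Spinor N)) ξ).2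
        Ψ.integrable
      simpa only [Circle.smul_def, Real.fourierChar_apply, mul_neg, neg_mul, Complex.ofReal_neg,
        Complex.ofReal_mul] using h

theorem commute_spinorHom_multiplierHom (M : Matrix (Fin (2 ^ N)) (Fin (2 ^ N)) ℂ)
    (r : PhaseSpace N →ᵇ ℝ) : Commute (spinorHom N M) (multiplierHom r) := by
  rw [commute_iff_eq]
  ext1 f
  have h : 𝓕 (spinorHom N M (multiplierHom r f)) = 𝓕 (multiplierHom r (spinorHom N M f)) := by
    rw [fourier_spinorHom, fourier_multiplierHom, fourier_multiplierHom, fourier_spinorHom]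
    refine Lp.ext ?_
    filter_upwards [coeFn_spinorHom M (multiplicationCLM r (𝓕 f)),
      coeFn_multiplicationCLM r (𝓕 f), coeFn_multiplicationCLM r (spinorHom N M (𝓕 f)),
      coeFn_spinorHom M (𝓕 f)] with x h1 h2 h3 h4
    rw [h1, h2, h3, h4, map_smul]
  have h' := congrArg (fun g => 𝓕⁻ g) h
  simp only [FourierTransform.fourierInv_fourier_eq] at h'
  exact h'

/-- The bounded operator `D (1 + |P|²)^{-1/2}`. -/
def diracBounded (γ : Fin N ⊕ Fin N → Matrix (Fin (2 ^ N)) (Fin (2 ^ N)) ℂ) :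
    SpinorL2 N →L[ℂ] SpinorL2 N :=
  ((2 * Real.pi : ℝ) : ℂ) • ∑ μ, spinorHom N (γ μ) *
    multiplierHom (symbolP (EuclideanSpace.single μ (1 : ℝ) : PhaseSpace N))

theorem diracBounded_apply (γ : Fin N ⊕ Fin N → Matrix (Fin (2 ^ N)) (Fin (2 ^ N)) ℂ)
    (f : SpinorL2 N) : diracBounded γ f = ((2 * Real.pi : ℝ) : ℂ) • ∑ μ, spinorHom N (γ μ)
      (multiplierHom (symbolP (EuclideanSpace.single μ (1 : ℝ) : PhaseSpace N)) f) := by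
  rw [diracBounded, smul_apply, sum_apply]
  rfl

theorem multiplierHom_lineDeriv (e : PhaseSpace N) (χ : 𝓢(PhaseSpace N, Spinor N)) :
    multiplierHom (symbolS (PhaseSpace N)) ((∂_{e} χ : 𝓢(PhaseSpace N, Spinor N)).toLp 2) =
      (2 * Real.pi * Complex.I : ℂ) • multiplierHom (symbolP e) (χ.toLp 2) := by
  have hS : (symbolS (PhaseSpace N) : PhaseSpace N → ℝ).HasTemperateGrowth :=
    hasTemperateGrowth_japaneseInv
  have hI : (inner ℝ · e : PhaseSpace N → ℝ).HasTemperateGrowth := by fun_prop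
  have hP : (symbolP e : PhaseSpace N → ℝ) = (symbolS (PhaseSpace N) : PhaseSpace N → ℝ) *
    (inner ℝ · e) := by ext ξ; simp [mul_comm]
  rw [multiplierHom_toLp hS, multiplierHom_toLp (by rw [hP]; exact hS.mul hI),
    lineDeriv_eq_fourierMultiplierCLM, hP, ← fourierMultiplierCLM_fourierMultiplierCLM_apply hS hI]
  rw [fourierMultiplierCLM_apply, FourierTransform.fourier_smul]
  have e1 : ∀ (c : ℂ) (f : 𝓢(PhaseSpace N, Spinor N)),
      smulLeftCLM (Spinor N) (symbolS (PhaseSpace N) : PhaseSpace N → ℝ) (c • f) =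
      c • smulLeftCLM (Spinor N) (symbolS (PhaseSpace N) : PhaseSpace N → ℝ) f := by
    intro c f
    ext1 x
    simp only [smulLeftCLM_apply_apply hS, smul_apply]
    rw [smul_comm]
  rw [e1, FourierTransform.fourierInv_smul, ← fourierMultiplierCLM_apply]
  rfl

theorem toLp_diracSchwartz (γ : Fin N ⊕ Fin N → Matrix (Fin (2 ^ N)) (Fin (2 ^ N)) ℂ)
    (χ : 𝓢(PhaseSpace N, Spinor N)) :
    ((diracSchwartz γ χ).toLp 2 : SpinorL2 N) = -Complex.I • ∑ μ, spinorHom N (γ μ)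
      ((∂_{(EuclideanSpace.single μ (1 : ℝ) : PhaseSpace N)} χ :
        𝓢(PhaseSpace N, Spinor N)).toLp 2) := by
  simp only [spinorHom_toLp]
  simp only [diracSchwartz, ← toLpCLM_apply (𝕜 := ℂ)]
  rw [map_smul, map_sum]

theorem multiplierHom_spinorHom (M : Matrix (Fin (2 ^ N)) (Fin (2 ^ N)) ℂ)
    (r : PhaseSpace N →ᵇ ℝ) (f : SpinorL2 N) :
    multiplierHom r (spinorHom N M f) = spinorHom N M (multiplierHom r f) := by
  have h := congrArg (fun X : SpinorL2 N →L[ℂ] SpinorL2 N => X f)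
    (commute_spinorHom_multiplierHom M r).eq
  simp only [mul_apply_eq_comp] at h
  exact h.symm

theorem map_neg_I_smul_sum {H ι : Type*} [NormedAddCommGroup H] [NormedSpace ℂ H] [Fintype ι]
    (T : H →L[ℂ] H) (x y : ι → H)
    (h : ∀ i, T (x i) = (2 * Real.pi * Complex.I : ℂ) • y i) :
    T (-Complex.I • ∑ i, x i) = ((2 * Real.pi : ℝ) : ℂ) • ∑ i, y i := by
  have h3 : -Complex.I * (2 * Real.pi * Complex.I : ℂ) = ((2 * Real.pi : ℝ) : ℂ) := by
    push_cast
    linear_combination (-2 * (Real.pi : ℂ)) * Complex.I_mul_I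
  rw [map_smul, map_sum, Finset.sum_congr rfl fun i _ => h i, ← Finset.smul_sum, smul_smul, h3]

theorem multiplierHom_diracSchwartz (γ : Fin N ⊕ Fin N → Matrix (Fin (2 ^ N)) (Fin (2 ^ N)) ℂ)
    (χ : 𝓢(PhaseSpace N, Spinor N)) :
    multiplierHom (symbolS (PhaseSpace N)) ((diracSchwartz γ χ).toLp 2) =
      diracBounded γ (χ.toLp 2) := by
  refine (congrArg (multiplierHom (symbolS (PhaseSpace N))) (toLp_diracSchwartz γ χ)).trans
    (Eq.trans ?_ (diracBounded_apply γ (χ.toLp 2)).symm)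
  refine map_neg_I_smul_sum (H := SpinorL2 N) (multiplierHom (symbolS (PhaseSpace N))) _ _ fun μ => ?_
  refine (multiplierHom_spinorHom (γ μ) (symbolS (PhaseSpace N)) _).trans ?_
  refine (congrArg (spinorHom N (γ μ)) (multiplierHom_lineDeriv _ _)).trans ?_
  exact (spinorHom N (γ μ)).map_smul _ _

end Dirac

end MoyalPlane

/-! ### The absolute value of D and its smooth domain -/

namespace MoyalPlane

noncomputable section AbsoluteValue

open FourierTransform
open scoped BoundedContinuousFunction InnerProductSpace

section Abstract

variable {H R ι : Type*} [NormedAddCommGroup H] [InnerProductSpace ℂ H] [CommRing R] [Algebra ℝ R]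
  {φ : R →ₐ[ℝ] (H →L[ℂ] H)} {s q : R} {κ : ℝ}

theorem IsBoundedPair.of_algHom
    (hφ : ∀ r x y, inner ℂ (φ r x) y = inner ℂ x (φ r y)) (hs : ∀ x, φ s x = 0 → x = 0)
    (hsq : s ^ 2 + κ • q ^ 2 = 1) : IsBoundedPair (φ s) (φ q) κ where
  symm_left := hφ s
  symm_right := hφ q
  comm x := by rw [← mul_apply_eq_comp, ← mul_apply_eq_comp, (commute_map φ s q).eq]
  inj := hs
  sq_add_sq x := by
    have h := congrArg (fun X => X x) (congrArg φ hsq)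
    simp only [map_add, map_mul, map_smul, map_one, pow_two, add_apply, smul_apply,
      mul_apply_eq_comp, one_apply_eq_self] at h
    rw [Complex.coe_smul]
    exact h

/-- Adding the double sum to its transpose brings in the anticommutators, which keep only the
diagonal, counted twice. -/
theorem sum_clifford_mul_self {A : Type*} [Ring A] [Algebra ℂ A] [Fintype ι] [DecidableEq ι]
    (M P : ι → A) (hM : ∀ i j, M i * M j + M j * M i = if i = j then 2 else 0)
    (hP : ∀ i j, Commute (P i) (P j)) (hMP : ∀ i j, Commute (M i) (P j)) :
    (∑ i, M i * P i) * ∑ i, M i * P i = ∑ i, P i * P i := by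
  have e : ∀ i j, M i * P i * (M j * P j) = M i * M j * (P i * P j) := fun i j => by
    rw [mul_assoc, ← mul_assoc (P i), ← (hMP j i).eq]; simp only [mul_assoc]
  have h1 : (∑ i, M i * P i) * ∑ i, M i * P i = ∑ i, ∑ j, M i * M j * (P i * P j) := by
    rw [Finset.sum_mul_sum]; simp only [e]
  have h2 : (∑ i, M i * P i) * ∑ i, M i * P i = ∑ i, ∑ j, M j * M i * (P i * P j) := by
    rw [h1, Finset.sum_comm]; simp only [(hP _ _).eq]
  have h3 : (2 : ℂ) • ((∑ i, M i * P i) * ∑ i, M i * P i) = (2 : ℂ) • ∑ i, P i * P i := by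
    rw [two_smul]
    nth_rewrite 1 [h1]
    rw [h2, ← Finset.sum_add_distrib]
    simp only [← Finset.sum_add_distrib, ← add_mul, hM, ite_mul, zero_mul, Finset.sum_ite_eq,
      Finset.mem_univ, if_true]
    rw [← Finset.mul_sum, two_smul, two_mul]
  exact (isUnit_iff_ne_zero.2 (two_ne_zero (α := ℂ))).smul_left_cancel.1 h3

theorem IsBoundedPair.of_clifford [Fintype ι] [DecidableEq ι] {p : ι → R} {M : ι → H →L[ℂ] H}
    {c : ℝ} (hpair : IsBoundedPair (φ s) (φ q) κ)
    (hφ : ∀ r x y, inner ℂ (φ r x) y = inner ℂ x (φ r y))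
    (hM : ∀ i x y, inner ℂ (M i x) y = inner ℂ x (M i y))
    (hMM : ∀ i j, M i * M j + M j * M i = if i = j then 2 else 0)
    (hMφ : ∀ i r, Commute (M i) (φ r)) (hp : c ^ 2 • ∑ i, p i ^ 2 = q ^ 2) :
    IsBoundedPair (φ s) ((c : ℂ) • ∑ i, M i * φ (p i)) κ ∧
      ∀ x, φ q (φ q x) =
        ((c : ℂ) • ∑ i, M i * φ (p i)) (((c : ℂ) • ∑ i, M i * φ (p i)) x) := by
  have hcomm : Commute (φ s) ((c : ℂ) • ∑ i, M i * φ (p i)) :=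
    (Commute.sum_right _ _ _ fun i _ => ((hMφ i s).symm.mul_right (commute_map φ s (p i)))).smul_right _
  have hsq : φ q * φ q = ((c : ℂ) • ∑ i, M i * φ (p i)) * ((c : ℂ) • ∑ i, M i * φ (p i)) := by
    rw [smul_mul_smul_comm, sum_clifford_mul_self M (fun i => φ (p i)) hMM
      (fun i j => commute_map φ _ _) (fun i j => hMφ i _), ← map_mul, ← pow_two, ← hp, map_smul,
      map_sum]
    simp only [map_mul, pow_two]
    rw [← Complex.ofReal_mul, Complex.coe_smul]
  have hsq' : ∀ x, φ q (φ q x) =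
        ((c : ℂ) • ∑ i, M i * φ (p i)) (((c : ℂ) • ∑ i, M i * φ (p i)) x) := fun x => by
    rw [← mul_apply_eq_comp, hsq, mul_apply_eq_comp]
  refine ⟨⟨hpair.symm_left, fun x y => ?_, fun x => ?_, hpair.inj, fun x => ?_⟩, hsq'⟩
  · simp only [smul_apply, sum_apply, inner_smul_left, inner_smul_right, sum_inner, inner_sum,
      Complex.conj_ofReal]
    congr 1
    refine Finset.sum_congr rfl fun i _ => ?_
    rw [mul_apply_eq_comp, hM, hφ, ← mul_apply_eq_comp, ← (hMφ i (p i)).eq]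
  · rw [← mul_apply_eq_comp, ← mul_apply_eq_comp, hcomm.eq]
  · rw [← hsq']
    exact hpair.sq_add_sq x

theorem inDomainDeltaPow_of_commutatorSmooth [CompleteSpace H] [Fintype ι] {p : ι → R} {b v : R}
    {c : ℝ} {M : H →ₗ.[ℂ] H} (hpair : IsBoundedPair (φ s) (φ q) κ)
    (hM : M.graph = quotientGraph (φ s) (φ q)) (hq : q = algebraMap ℝ R c + b * s)
    (hv : v * (1 + s) = 1) (hp : ∑ i, p i ^ 2 + s ^ 2 = 1)
    (hc : ∀ X : H →L[ℂ] H, φ s * X * φ s = 0 → X = 0)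
    (hn1 : ∀ n : ℕ, ‖φ (s * v * (1 - 2 * (s * v)) ^ n)‖ ≤ 1 / (n + 1))
    (hn2 : ∀ n : ℕ, ‖φ ((s * v) ^ 2 * (1 - 2 * (s * v)) ^ n)‖ ≤ 1 / (n + 1) ^ 2)
    {n : ℕ} {T : H →L[ℂ] H} (hT : CommutatorSmooth φ s p (2 * n) T) :
    InDomainDeltaPow M n T := by
  induction n generalizing T with
  | zero => trivial
  | succ n ih =>
    obtain ⟨B, hB, hB'⟩ := CommutatorSmooth.exists_commutator v hv hp hc hn1 hn2
      (n := 2 * n) (T := T) hT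
    -- Since q/s = c/s + b, the commutator is c [1/s, T] + [b, T]. Multiplication by b costs no
    -- smoothness, as b commutes with the momenta.
    refine ⟨c • B + (φ b * T + (-1 : ℝ) • (T * φ b)), hpair.isCommutator hM ?_, ih ?_⟩
    · have e : φ q = c • (1 : H →L[ℂ] H) + φ b * φ s := by
        rw [hq, map_add, AlgHom.commutes, map_mul, Algebra.algebraMap_eq_smul_one]
      have e' := (commute_map φ b s).eq
      rw [e]
      simp only [add_mul, mul_add, smul_mul_assoc, mul_smul_comm, one_mul, mul_one]
      rw [← hB, e']
      simp only [mul_assoc, e', smul_sub, neg_smul, one_smul]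
      abel
    · have hT' := (hT.of_succ (n := 2 * n + 1)).of_succ
      exact (hB'.smul c).add ((hT'.mul_left _ fun r => commute_map φ b r).add
        ((hT'.mul_right _ fun r => commute_map φ b r).smul (-1)))

end Abstract

variable {N : ℕ}

theorem symbolS_ne_zero (ξ : PhaseSpace N) : symbolS (PhaseSpace N) ξ ≠ 0 :=
  (japaneseInv_pos ξ).ne'

theorem isBoundedPair_multiplierHom :
    IsBoundedPair (multiplierHom (F := Spinor N) (symbolS (PhaseSpace N)))
      (multiplierHom (symbolQ (PhaseSpace N))) ((2 * Real.pi) ^ 2)⁻¹ :=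
  IsBoundedPair.of_algHom inner_multiplierHom (fun _ => multiplierHom_injective symbolS_ne_zero)
    symbolS_sq_add

theorem sum_symbolP_single_sq : ∑ μ : Fin N ⊕ Fin N,
    symbolP (EuclideanSpace.single μ (1 : ℝ) : PhaseSpace N) ^ 2 =
      ((2 * Real.pi) ^ 2)⁻¹ • symbolQ (PhaseSpace N) ^ 2 := by
  have h := sum_symbolP_sq (EuclideanSpace.basisFun (Fin N ⊕ Fin N) ℝ)
  simpa only [EuclideanSpace.basisFun_apply] using h

variable {γ : Fin N ⊕ Fin N → Matrix (Fin (2 ^ N)) (Fin (2 ^ N)) ℂ}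

theorem isBoundedPair_diracBounded (hγ : IsDiracMatrices γ) :
    IsBoundedPair (multiplierHom (F := Spinor N) (symbolS (PhaseSpace N)))
      (diracBounded γ) ((2 * Real.pi) ^ 2)⁻¹ ∧
      ∀ x, multiplierHom (symbolQ (PhaseSpace N)) (multiplierHom (symbolQ (PhaseSpace N)) x) =
        diracBounded γ (diracBounded γ x) := by
  refine isBoundedPair_multiplierHom.of_clifford
    (p := fun μ => symbolP (EuclideanSpace.single μ (1 : ℝ) : PhaseSpace N))
    (M := fun μ => spinorHom N (γ μ)) (c := 2 * Real.pi) inner_multiplierHom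
    (fun μ => inner_spinorHom (hγ.1 μ)) (fun μ ν => ?_)
    (fun μ r => commute_spinorHom_multiplierHom _ r) ?_
  · rw [← map_mul, ← map_mul, ← map_add, hγ.2, apply_ite (spinorHom N), map_zero, map_ofNat]
  · have h : (2 * Real.pi) ^ 2 ≠ 0 := by positivity
    rw [sum_symbolP_single_sq, smul_smul, mul_inv_cancel₀ h, one_smul]

/-- The distributional domain is compared with the quotient by choosing test spinors sζ: D(sζ) is
the bounded operator `diracBounded γ` applied to ζ, and symmetry moves both operators to the other
side. Conversely, pairs (Sz, Qz) satisfy the weak equation because SDχ = Qχ for Schwartz χ. -/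
theorem graph_dirac_eq (hγ : IsDiracMatrices γ) :
    (dirac γ).graph = quotientGraph (multiplierHom (symbolS (PhaseSpace N))) (diracBounded γ) := by
  have h := (isBoundedPair_diracBounded hγ).1
  rw [graph_dirac]
  ext ⟨x, y⟩
  constructor
  · intro hxy
    rw [mem_quotientGraph]
    refine ext_inner_left ℂ fun z => ?_
    refine denseRange_toLp_spinor.induction_on (p := fun z => inner ℂ z (diracBounded γ x) =
      inner ℂ z (multiplierHom (symbolS (PhaseSpace N)) y)) z
      (isClosed_eq (by fun_prop) (by fun_prop)) fun ζ => ?_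
    have e1 := multiplierHom_toLp (r := symbolS (PhaseSpace N)) hasTemperateGrowth_japaneseInv ζ
    have e2 := hxy (SchwartzMap.fourierMultiplierCLM (Spinor N)
      (symbolS (PhaseSpace N) : PhaseSpace N → ℝ) ζ)
    have e3 : (diracSchwartz γ (SchwartzMap.fourierMultiplierCLM (Spinor N)
      (symbolS (PhaseSpace N) : PhaseSpace N → ℝ) ζ)).toLp 2 = diracBounded γ (ζ.toLp 2) := by
      refine sub_eq_zero.1 (h.inj _ ?_)
      rw [map_sub, multiplierHom_diracSchwartz, ← e1, h.comm, sub_self]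
    rw [e3, ← e1] at e2
    exact (h.symm_right _ _).symm.trans (e2.trans (h.symm_left _ _))
  · intro hxy χ
    obtain ⟨z, rfl, rfl⟩ := h.exists_of_mem_graph hxy
    refine (h.symm_left _ _).symm.trans ?_
    rw [multiplierHom_diracSchwartz]
    exact h.symm_right _ _

/-- The operator `|D|`. -/
def absDirac (N : ℕ) : SpinorL2 N →ₗ.[ℂ] SpinorL2 N :=
  (quotientGraph (multiplierHom (symbolS (PhaseSpace N)))
    (multiplierHom (symbolQ (PhaseSpace N)))).toLinearPMap

theorem graph_absDirac : (absDirac N).graph = quotientGraph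
    (multiplierHom (symbolS (PhaseSpace N))) (multiplierHom (symbolQ (PhaseSpace N))) :=
  isBoundedPair_multiplierHom.graph_toLinearPMap

theorem re_inner_multiplierHom_nonneg {r : PhaseSpace N →ᵇ ℝ} {t : PhaseSpace N →ᵇ ℝ}
    (h : r = t * t) (z : SpinorL2 N) : 0 ≤ (inner ℂ z (multiplierHom r z)).re := by
  rw [h, map_mul, mul_apply_eq_comp, ← inner_multiplierHom]
  exact inner_self_nonneg (𝕜 := ℂ)

theorem isAbsoluteValue_absDirac (hγ : IsDiracMatrices γ) :
    IsAbsoluteValue (dirac γ) (absDirac N) := by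
  have h := isBoundedPair_diracBounded hγ
  refine isBoundedPair_multiplierHom.isAbsoluteValue h.1 graph_absDirac (graph_dirac_eq hγ) h.2
    fun z => ?_
  rw [inner_multiplierHom, ← mul_apply_eq_comp, ← map_mul]
  have h0 : ∀ ξ, 0 ≤ (symbolS (PhaseSpace N) * symbolQ (PhaseSpace N)) ξ := fun ξ => by
    have := (japaneseInv_pos ξ).le
    have := norm_nonneg ξ
    have := Real.pi_pos.le
    simp only [BoundedContinuousFunction.coe_mul, Pi.mul_apply, symbolS_apply, symbolQ_apply]
    positivity
  -- Positivity: the symbol of s · q is nonnegative, hence the square of a bounded continuous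
  -- symbol.
  refine re_inner_multiplierHom_nonneg (t := .ofNormedAddCommGroup
    (fun ξ => √((symbolS (PhaseSpace N) * symbolQ (PhaseSpace N)) ξ))
    ((map_continuous _).sqrt) (√‖symbolS (PhaseSpace N) * symbolQ (PhaseSpace N)‖) fun ξ => ?_) ?_ z
  · rw [Real.norm_of_nonneg (Real.sqrt_nonneg _)]
    exact Real.sqrt_le_sqrt ((le_abs_self _).trans
      ((symbolS (PhaseSpace N) * symbolQ (PhaseSpace N)).norm_coe_le_norm ξ))
  · ext ξ
    exact (Real.mul_self_sqrt (h0 ξ)).symm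

/-- The square-integrable spinor operators whose iterated commutators with the momenta of order at
most `n` are bounded. -/
abbrev MomentumSmooth (N n : ℕ) (T : SpinorL2 N →L[ℂ] SpinorL2 N) : Prop :=
  CommutatorSmooth multiplierHom (symbolS (PhaseSpace N))
    (fun μ : Fin N ⊕ Fin N => symbolP (EuclideanSpace.single μ (1 : ℝ) : PhaseSpace N)) n T

theorem inSmoothDomain_of_momentumSmooth {T : SpinorL2 N →L[ℂ] SpinorL2 N}
    (hT : ∀ n, MomentumSmooth N n T) : InSmoothDomain (absDirac N) T := by
  intro n
  refine inDomainDeltaPow_of_commutatorSmooth isBoundedPair_multiplierHom graph_absDirac symbolQ_eq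
    symbolV_mul ?_ (eq_zero_of_multiplierHom_mul_mul symbolS_ne_zero)
    (fun n => (norm_multiplierHom_le _).trans (norm_symbol_pow_le n).1)
    (fun n => (norm_multiplierHom_le _).trans (norm_symbol_pow_le n).2) (hT (2 * n))
  rw [sum_symbolP_single_sq, add_comm, symbolS_sq_add]

end AbsoluteValue

end MoyalPlane

/-! ### Gaussian windows and the short-time Fourier transform -/

namespace MoyalPlane

noncomputable section GaussianWindow

open FourierTransform
open scoped InnerProductSpace ENNReal

variable {V : Type*} [NormedAddCommGroup V]

/-- The Gaussian `e^{-a|x|²}`. -/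
def gaussian (a : ℝ) (x : V) : ℝ := Real.exp (-a * ‖x‖ ^ 2)

theorem gaussian_pos (a : ℝ) (x : V) : 0 < gaussian a x := Real.exp_pos _

theorem gaussian_le_one {a : ℝ} (ha : 0 ≤ a) (x : V) : gaussian a x ≤ 1 :=
  Real.exp_le_one_iff.2 (by nlinarith [mul_nonneg ha (sq_nonneg ‖x‖)])

@[fun_prop]
theorem continuous_gaussian (a : ℝ) : Continuous (gaussian a : V → ℝ) := by
  unfold gaussian; fun_prop

theorem gaussian_neg (a : ℝ) (x : V) : gaussian a (-x) = gaussian a x := by simp [gaussian]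

theorem gaussian_sub_comm (a : ℝ) (x y : V) : gaussian a (x - y) = gaussian a (y - x) := by
  rw [← neg_sub, gaussian_neg]

variable [InnerProductSpace ℝ V]

theorem hasTemperateGrowth_gaussian {a : ℝ} (ha : 0 ≤ a) :
    (gaussian a : V → ℝ).HasTemperateGrowth := by
  have h : (fun x : V => -a * ‖x‖ ^ 2).HasTemperateGrowth :=
    (Function.HasTemperateGrowth.const (-a)).mul (Function.hasTemperateGrowth_norm_sq V)
  -- The exponential has bounded derivatives only on a half line; the exponent -a‖x‖² stays in (-∞,
  -- 0].
  refine Function.HasTemperateGrowth.comp' (g := Real.exp) (t := Set.Iic 0) ?_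
    (uniqueDiffOn_Iic 0) Real.contDiff_exp.contDiffOn (fun N => ⟨0, 1, zero_le_one, ?_⟩) h
  · rintro _ ⟨x, rfl⟩
    simp only [Set.mem_Iic]
    nlinarith [mul_nonneg ha (sq_nonneg ‖x‖)]
  · intro n _ x hx
    rw [norm_iteratedFDerivWithin_eq_norm_iteratedDerivWithin,
      iteratedDerivWithin_eq_iteratedDeriv (uniqueDiffOn_Iic 0) Real.contDiff_exp.contDiffAt hx,
      iteratedDeriv_eq_iterate, Real.iter_deriv_exp, Real.norm_of_nonneg (Real.exp_pos _).le]
    simpa using hx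

/-- Multiplication of a Schwartz function by a translated Gaussian. -/
def windowed (a : ℝ) (p : V) (h : 𝓢(V, ℂ)) : 𝓢(V, ℂ) :=
  smulLeftCLM ℂ (fun z => gaussian a (z - p)) h

theorem windowed_apply {a : ℝ} (ha : 0 ≤ a) (p : V) (h : 𝓢(V, ℂ)) (z : V) :
    windowed a p h z = gaussian a (z - p) * h z := by
  have h1 : (fun z : V => gaussian a (z - p)).HasTemperateGrowth :=
    (hasTemperateGrowth_gaussian ha).comp
      (Function.HasTemperateGrowth.id'.sub (Function.HasTemperateGrowth.const p))
  rw [windowed, smulLeftCLM_apply_apply h1, Complex.real_smul]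

variable [FiniteDimensional ℝ V] [MeasurableSpace V] [BorelSpace V]

theorem integrable_gaussian {a : ℝ} (ha : 0 < a) : Integrable (gaussian a : V → ℝ) := by
  have h := (GaussianFourier.integrable_cexp_neg_mul_sq_norm_add (b := a) (V := V)
    (by simpa using ha) 0 0).norm
  refine h.congr (Filter.Eventually.of_forall fun x => ?_)
  simp only [zero_mul, add_zero, Complex.norm_exp, gaussian]
  norm_cast

/-- The twisted convolution of two Gaussians. -/
theorem integral_gaussian_mul_gaussian (S : V ≃ₗᵢ[ℝ] V) (hS : ∀ x, inner ℝ x (S x) = 0) {a : ℝ}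
    (ha : 0 < a) (κ : ℝ) (s : V) :
    ∫ t, ((gaussian a (s - t) * gaussian a t : ℝ) : ℂ) *
        Complex.exp ((κ * inner ℝ s (S t) : ℝ) * Complex.I) =
      ((∫ t : V, gaussian (2 * a) t) * gaussian (a / 2 + κ ^ 2 / (8 * a)) s : ℝ) := by
  -- Centring at s/2 removes the cross terms in the exponent and leaves the phase alone, as s · Ss =
  -- 0. What remains is e^{-a|s|²/2} times the Fourier transform of a Gaussian of parameter 2a,
  -- which contributes κ²/(8a).
  rw [← integral_add_right_eq_self _ ((1 / 2 : ℝ) • s)]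
  have e1 : ∀ t : V, ((gaussian a (s - (t + (1 / 2 : ℝ) • s)) * gaussian a (t + (1 / 2 : ℝ) • s) : ℝ) : ℂ) *
        Complex.exp ((κ * inner ℝ s (S (t + (1 / 2 : ℝ) • s)) : ℝ) * Complex.I) =
      (gaussian (a / 2) s : ℂ) * Complex.exp (-((2 * a : ℝ) : ℂ) * ‖t‖ ^ 2 +
        (κ * Complex.I) * (inner ℝ (S.symm s) t : ℝ)) := by
    intro t
    have h1 : ‖s - (t + (1 / 2 : ℝ) • s)‖ ^ 2 + ‖t + (1 / 2 : ℝ) • s‖ ^ 2 =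
        2 * ‖t‖ ^ 2 + ‖s‖ ^ 2 / 2 := by
      have e : s - (t + (1 / 2 : ℝ) • s) = (1 / 2 : ℝ) • s - t := by module
      rw [e, norm_sub_sq_real, norm_add_sq_real, norm_smul, real_inner_comm]
      norm_num
      ring
    have h2 : inner ℝ s (S (t + (1 / 2 : ℝ) • s)) = inner ℝ (S.symm s) t := by
      rw [map_add, map_smul, inner_add_right, inner_smul_right, hS, mul_zero, add_zero,
        LinearIsometryEquiv.inner_map_eq_flip, LinearIsometryEquiv.symm_symm]
    rw [h2, gaussian, gaussian, gaussian, ← Real.exp_add, ← mul_add, h1]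
    push_cast
    rw [← Complex.exp_add, ← Complex.exp_add]
    congr 1
    ring
  simp_rw [e1]
  rw [integral_const_mul, GaussianFourier.integral_cexp_neg_mul_sq_norm_add (by simpa using ha)]
  have h0 := GaussianFourier.integral_cexp_neg_mul_sq_norm (b := ((2 * a : ℝ) : ℂ)) (V := V)
    (by simpa using ha)
  have h3 : ((∫ t : V, gaussian (2 * a) t : ℝ) : ℂ) =
      (Real.pi / ((2 * a : ℝ) : ℂ)) ^ (Module.finrank ℝ V / 2 : ℂ) := by
    rw [← h0, ← integral_complex_ofReal]
    refine integral_congr_ae (Filter.Eventually.of_forall fun t => ?_)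
    simp [gaussian]
  rw [← h3, S.symm.norm_map]
  push_cast
  have h4 : (gaussian (a / 2) s : ℂ) * Complex.exp ((κ * Complex.I) ^ 2 * ‖s‖ ^ 2 / (4 * (2 * a))) =
      (gaussian (a / 2 + κ ^ 2 / (8 * a)) s : ℂ) := by
    simp only [gaussian]
    push_cast
    rw [← Complex.exp_add]
    congr 1
    have : (a : ℂ) ≠ 0 := by exact_mod_cast ha.ne'
    field_simp
    rw [Complex.I_sq]
    ring
  rw [← h4]
  ring

theorem lintegral_enorm_sq_fourier (u : 𝓢(V, ℂ)) : ∫⁻ ξ, ‖𝓕 u ξ‖ₑ ^ 2 = ∫⁻ x, ‖u x‖ₑ ^ 2 := by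
  have key : ∀ v : 𝓢(V, ℂ), ∫⁻ x, ‖v x‖ₑ ^ 2 = ENNReal.ofReal (∫ x, ‖v x‖ ^ 2) := fun v => by
    have hi : Integrable fun x => ‖v x‖ ^ 2 :=
      (v.memLp 2 volume).integrable_norm_pow (by norm_num)
    rw [ofReal_integral_eq_lintegral_ofReal hi
      (Filter.Eventually.of_forall fun x => by positivity)]
    simp only [← ofReal_norm, ENNReal.ofReal_pow (norm_nonneg _)]
  rw [key, key, integral_norm_sq_fourier]

theorem exists_lintegral_comp_le (L : V ≃L[ℝ] V) : ∃ C : ℝ≥0∞, C ≠ ⊤ ∧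
    ∀ F : V → ℝ≥0∞, Measurable F → ∫⁻ w, F (L w) ≤ C * ∫⁻ ξ, F ξ := by
  have hdet : LinearMap.det (L.toLinearEquiv : V →ₗ[ℝ] V) ≠ 0 := L.toLinearEquiv.isUnit_det'.ne_zero
  refine ⟨ENNReal.ofReal |(LinearMap.det (L.toLinearEquiv : V →ₗ[ℝ] V))⁻¹|, ENNReal.ofReal_ne_top,
    fun F hF => ?_⟩
  have h := Measure.map_linearMap_addHaar_eq_smul_addHaar (volume : Measure V) hdet
  rw [← smul_eq_mul, ← lintegral_smul_measure, ← h, lintegral_map hF (by exact L.continuous.measurable)]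
  exact le_rfl

/-- Square-integrability of the short-time Fourier transform. -/
theorem exists_lintegral_windowed_le (S : V ≃ₗᵢ[ℝ] V) {κ : ℝ} (hκ : κ ≠ 0) :
    ∃ C : ℝ≥0∞, C ≠ ⊤ ∧ ∀ a : ℝ, 0 < a → ∀ h : 𝓢(V, ℂ),
      ∫⁻ p, ∫⁻ w, ‖∫ z, windowed a p h z *
        Complex.exp ((κ * inner ℝ z (S w) : ℝ) * Complex.I)‖ₑ ^ 2 ≤
      C * (ENNReal.ofReal (∫ t : V, gaussian (2 * a) t) * ∫⁻ x, ‖h x‖ₑ ^ 2) := by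
  have hc : -(κ / (2 * Real.pi)) ≠ 0 := neg_ne_zero.2 (div_ne_zero hκ (by positivity))
  obtain ⟨C, hC, hC'⟩ := exists_lintegral_comp_le
    ((S.toContinuousLinearEquiv).trans (ContinuousLinearEquiv.smulLeft (Units.mk0 _ hc)))
  refine ⟨C, hC, fun a ha h => ?_⟩
  have e1 : ∀ p w, ∫ z, windowed a p h z * Complex.exp ((κ * inner ℝ z (S w) : ℝ) * Complex.I) =
      𝓕 (windowed a p h) (-(κ / (2 * Real.pi)) • S w) := by
    intro p w
    rw [fourier_coe, Real.fourier_eq']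
    refine integral_congr_ae (Filter.Eventually.of_forall fun z => ?_)
    simp only [smul_eq_mul, inner_smul_right]
    rw [mul_comm]
    congr 4
    field_simp
  have e2 : ∀ p, ∫⁻ w, ‖∫ z, windowed a p h z *
      Complex.exp ((κ * inner ℝ z (S w) : ℝ) * Complex.I)‖ₑ ^ 2 ≤
      C * ∫⁻ x, ‖windowed a p h x‖ₑ ^ 2 := by
    intro p
    simp_rw [e1]
    rw [← lintegral_enorm_sq_fourier]
    exact hC' (fun ξ => ‖𝓕 (windowed a p h) ξ‖ₑ ^ 2)
      ((𝓕 (windowed a p h)).continuous.enorm.measurable.pow_const 2)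
  -- After Plancherel in w, the integral over p only meets the squared window, whose mass does not
  -- depend on z.
  have e3 : ∀ z : V, ∫⁻ p, ENNReal.ofReal (gaussian (2 * a) (z - p)) =
      ENNReal.ofReal (∫ t : V, gaussian (2 * a) t) := fun z => by
    rw [ofReal_integral_eq_lintegral_ofReal (integrable_gaussian (by positivity))
      (Filter.Eventually.of_forall fun x => (gaussian_pos _ _).le)]
    exact lintegral_sub_left_eq_self (fun t => ENNReal.ofReal (gaussian (2 * a) t)) z
  calc _ ≤ ∫⁻ p, C * ∫⁻ x, ‖windowed a p h x‖ₑ ^ 2 := lintegral_mono e2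
    _ = C * ∫⁻ p, ∫⁻ x, ‖windowed a p h x‖ₑ ^ 2 := lintegral_const_mul' _ _ hC
    _ = C * ∫⁻ p, ∫⁻ z, ENNReal.ofReal (gaussian (2 * a) (z - p)) * ‖h z‖ₑ ^ 2 := by
      congr 1
      refine lintegral_congr fun p => lintegral_congr fun z => ?_
      rw [windowed_apply ha.le, enorm_mul, mul_pow]
      congr 1
      rw [← ofReal_norm, Complex.norm_real, Real.norm_of_nonneg (gaussian_pos _ _).le,
        ← ENNReal.ofReal_pow (gaussian_pos _ _).le, gaussian, gaussian, ← Real.exp_nat_mul]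
      congr 2
      push_cast
      ring
    _ = C * ∫⁻ z, ∫⁻ p, ENNReal.ofReal (gaussian (2 * a) (z - p)) * ‖h z‖ₑ ^ 2 := by
      congr 1
      refine lintegral_lintegral_swap (Measurable.aemeasurable ?_)
      exact Measurable.mul
        (ENNReal.measurable_ofReal.comp (by fun_prop : Continuous fun p : V × V =>
          gaussian (2 * a) (p.2 - p.1)).measurable)
        ((h.continuous.enorm.measurable.pow_const 2).comp measurable_snd)
    _ = _ := by
      congr 1
      simp_rw [lintegral_mul_const' _ _ (ENNReal.pow_ne_top enorm_ne_top), e3]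
      rw [lintegral_const_mul' _ _ ENNReal.ofReal_ne_top]

end GaussianWindow

end MoyalPlane

/-! ### The twisted form of a Gaussian symbol -/

namespace MoyalPlane

noncomputable section AntiWick

open FourierTransform
open scoped InnerProductSpace ENNReal

/-- By translation invariance the inner integral of the majorant is ∫ρ for every x, whatever the
shift g; no regularity of g is needed. -/
theorem integrable_mul_prod_of_norm_le {X W : Type*} [MeasurableSpace X] [MeasurableSpace W]
    [AddCommGroup W] [MeasurableAdd₂ W] [MeasurableNeg W] {μ : Measure X} [SFinite μ]
    {ν : Measure W} [SFinite ν] [ν.IsAddRightInvariant] {F : X → ℂ} (hF : Integrable F μ)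
    {k : X × W → ℂ} (hk : AEStronglyMeasurable k (μ.prod ν)) {ρ : W → ℝ} (hρ : Integrable ρ ν)
    {g : X → W} (hkρ : ∀ p, ‖k p‖ ≤ ρ (p.2 - g p.1)) :
    Integrable (fun p : X × W => F p.1 * k p) (μ.prod ν) := by
  have hm : AEStronglyMeasurable (fun p : X × W => F p.1 * k p) (μ.prod ν) :=
    hF.aestronglyMeasurable.comp_fst.mul hk
  have hρ' : ∀ x, Integrable (fun w => ‖F x‖ * ρ (w - g x)) ν := fun x =>
    (hρ.comp_sub_right (g x)).const_mul _
  have hle : ∀ x w, ‖F x * k (x, w)‖ ≤ ‖F x‖ * ρ (w - g x) := fun x w => by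
    rw [norm_mul]
    exact mul_le_mul_of_nonneg_left (hkρ (x, w)) (norm_nonneg _)
  refine (integrable_prod_iff hm).2 ⟨?_, ?_⟩
  · filter_upwards [hm.prodMk_left] with x hx
    exact (hρ' x).mono' hx (Filter.Eventually.of_forall (hle x))
  · refine (hF.norm.mul_const (∫ w, ρ w ∂ν)).mono' hm.norm.integral_prod_right'
      (Filter.Eventually.of_forall fun x => ?_)
    rw [Real.norm_of_nonneg (integral_nonneg fun _ => norm_nonneg _)]
    -- Measurability of the slices is available only for almost every x; on a nonintegrable slice
    -- the integral has the default value 0.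
    by_cases hx : Integrable (fun w => ‖F x * k (x, w)‖) ν
    · refine (integral_mono hx (hρ' x) (hle x)).trans_eq ?_
      rw [integral_const_mul, integral_sub_right_eq_self]
    · rw [integral_undef hx]
      refine mul_nonneg (norm_nonneg _) ?_
      rw [← integral_sub_right_eq_self ρ (g x)]
      exact integral_nonneg fun w => (norm_nonneg _).trans (hkρ (x, w))

variable {V : Type*} [NormedAddCommGroup V] [InnerProductSpace ℝ V]

/-- The phase `e^{iκ z·Sη}`. -/
def twist (κ : ℝ) (S : V ≃ₗᵢ[ℝ] V) (z η : V) : ℂ :=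
  Complex.exp ((κ * inner ℝ z (S η) : ℝ) * Complex.I)

@[simp]
theorem norm_twist (κ : ℝ) (S : V ≃ₗᵢ[ℝ] V) (z η : V) : ‖twist κ S z η‖ = 1 :=
  Complex.norm_exp_ofReal_mul_I _

@[fun_prop]
theorem Continuous.twist {X : Type*} [TopologicalSpace X] {κ : ℝ} {S : V ≃ₗᵢ[ℝ] V} {f g : X → V}
    (hf : Continuous f) (hg : Continuous g) : Continuous fun x => twist κ S (f x) (g x) := by
  have : Continuous fun x => S (g x) := S.continuous.comp hg
  unfold MoyalPlane.twist
  fun_prop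

theorem inner_apply_eq_neg {S : V ≃ₗᵢ[ℝ] V} (hS : ∀ x, inner ℝ x (S x) = 0) (x y : V) :
    inner ℝ x (S y) = -inner ℝ y (S x) := by
  have h := hS (x + y)
  rw [map_add, inner_add_left, inner_add_right, inner_add_right, hS, hS] at h
  linarith

/-- The right side has no factor mixing z and η, so the integral over (z, η) splits into two
short-time Fourier transforms. -/
theorem twist_phase {S : V ≃ₗᵢ[ℝ] V} (hS : ∀ x, inner ℝ x (S x) = 0) (κ : ℝ) (z η y w : V) :
    twist κ S z η * twist κ S (z - y - η) (w - η) =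
      twist (-κ) S y w * (twist κ S z w * twist (-κ) S η (w + y)) := by
  simp only [twist, ← Complex.exp_add, ← add_mul, ← Complex.ofReal_add]
  congr 3
  simp only [map_sub, map_add, inner_sub_left, inner_sub_right, inner_add_right, hS]
  rw [inner_apply_eq_neg hS y η]
  ring

variable [FiniteDimensional ℝ V] [MeasurableSpace V] [BorelSpace V]

/-- The form `∬ G(η) h(z) e^{iκ z·Sη} f(z - η) dz dη`. -/
def twistedForm (κ : ℝ) (S : V ≃ₗᵢ[ℝ] V) (f : V → ℂ) (G h : 𝓢(V, ℂ)) : ℂ :=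
  ∫ p : V × V, (h p.1 * G p.2 * twist κ S p.1 p.2) * f (p.1 - p.2)

theorem integrable_mul_twist (κ : ℝ) (S : V ≃ₗᵢ[ℝ] V) (G h : 𝓢(V, ℂ)) :
    Integrable fun p : V × V => h p.1 * G p.2 * twist κ S p.1 p.2 := by
  refine (h.integrable.mul_prod G.integrable).mul_bdd (c := 1)
    (Continuous.aestronglyMeasurable (by fun_prop)) (Filter.Eventually.of_forall fun p => ?_)
  rw [norm_twist]

/-- The short-time Fourier transform with Gaussian window. -/
def stft (κ : ℝ) (S : V ≃ₗᵢ[ℝ] V) (a : ℝ) (h : 𝓢(V, ℂ)) (p w : V) : ℂ :=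
  ∫ z, windowed a p h z * twist κ S z w

theorem measurable_enorm_stft (κ : ℝ) (S : V ≃ₗᵢ[ℝ] V) {a : ℝ} (ha : 0 < a) (h : 𝓢(V, ℂ)) :
    Measurable fun q : V × V => ‖stft κ S a h q.1 q.2‖ₑ := by
  have : Continuous fun q : (V × V) × V => windowed a q.1.1 h q.2 * twist κ S q.2 q.1.2 := by
    simp only [windowed_apply ha.le]
    have := h.continuous
    fun_prop
  exact this.stronglyMeasurable.integral_prod_right'.enorm

/-- Cauchy–Schwarz in (y, w); both shears preserve the measure. -/
theorem lintegral_shear_mul_le {A B : V × V → ℝ≥0∞} (hA : Measurable A) (hB : Measurable B) :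
    ∫⁻ y : V, ∫⁻ w : V, A (w + y, w) * B (w, w + y) ≤
      (∫⁻ p : V, ∫⁻ w : V, A (p, w) ^ 2) ^ (1 / 2 : ℝ) *
        (∫⁻ p : V, ∫⁻ w : V, B (p, w) ^ 2) ^ (1 / 2 : ℝ) := by
  have mA : Measurable fun q : V × V => A (q.2 + q.1, q.2) := hA.comp (by fun_prop)
  have mB : Measurable fun q : V × V => B (q.2, q.2 + q.1) := hB.comp (by fun_prop)
  have eA : ∫⁻ q : V × V, A (q.2 + q.1, q.2) ^ (2 : ℝ) = ∫⁻ p : V, ∫⁻ w : V, A (p, w) ^ 2 := by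
    have m2 : Measurable fun q : V × V => A q ^ 2 := hA.pow_const 2
    simp only [ENNReal.rpow_two]
    rw [Measure.volume_eq_prod, lintegral_prod_symm' _ (mA.pow_const 2),
      lintegral_lintegral_swap (f := fun p w => A (p, w) ^ 2) m2.aemeasurable]
    exact lintegral_congr fun w => lintegral_add_left_eq_self (fun p => A (p, w) ^ 2) w
  have eB : ∫⁻ q : V × V, B (q.2, q.2 + q.1) ^ (2 : ℝ) = ∫⁻ p : V, ∫⁻ w : V, B (p, w) ^ 2 := by
    simp only [ENNReal.rpow_two]
    rw [Measure.volume_eq_prod, lintegral_prod_symm' _ (mB.pow_const 2)]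
    exact lintegral_congr fun w => lintegral_add_left_eq_self (fun p => B (w, p) ^ 2) w
  rw [← eA, ← eB, ← lintegral_prod (fun q : V × V => A (q.2 + q.1, q.2) * B (q.2, q.2 + q.1))
    (mA.mul mB).aemeasurable]
  exact ENNReal.lintegral_mul_le_Lp_mul_Lq _ Real.HolderConjugate.two_two mA.aemeasurable
    mB.aemeasurable

theorem integrable_gaussian_kernel (κ : ℝ) (S : V ≃ₗᵢ[ℝ] V) {c : ℝ} (hc : 0 < c) (G h : 𝓢(V, ℂ))
    {m : V → ℂ} (hm : Continuous m) {M : ℝ} (hM : ∀ x, ‖m x‖ ≤ M) :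
    Integrable fun q : (V × V) × V => (h q.1.1 * G q.1.2 * twist κ S q.1.1 q.1.2) *
      (gaussian c (q.1.1 - q.1.2 - q.2) * m q.2) := by
  refine integrable_mul_prod_of_norm_le (integrable_mul_twist κ S G h)
    (k := fun q => (gaussian c (q.1.1 - q.1.2 - q.2) : ℂ) * m q.2)
    (Continuous.aestronglyMeasurable (by fun_prop)) ((integrable_gaussian hc).mul_const M)
    (g := fun p => p.1 - p.2) fun q => ?_
  rw [norm_mul, Complex.norm_real, Real.norm_of_nonneg (gaussian_pos _ _).le, gaussian_sub_comm]
  exact mul_le_mul_of_nonneg_left (hM _) (gaussian_pos _ _).le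

/-- Exchange of the smoothing by a Gaussian with the integral in the twisted form. -/
theorem twistedForm_gaussian_smoothing (κ : ℝ) (S : V ≃ₗᵢ[ℝ] V) {c : ℝ} (hc : 0 < c)
    (G h : 𝓢(V, ℂ)) {m : V → ℂ} (hm : Continuous m) {M : ℝ} (hM : ∀ x, ‖m x‖ ≤ M) :
    twistedForm κ S (fun x => ∫ y, gaussian c (x - y) * m y) G h =
      ∫ y, m y * twistedForm κ S (fun x => gaussian c (x - y)) G h := by
  have hi := integrable_gaussian_kernel κ S hc G h hm hM
  simp only [twistedForm, ← integral_const_mul]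
  rw [integral_integral_swap hi]
  refine integral_congr_ae (Filter.Eventually.of_forall fun y =>
    integral_congr_ae (Filter.Eventually.of_forall fun p => ?_))
  ring

/-- The anti-Wick mechanism: a translated Gaussian is a twisted convolution of two Gaussians
(`integral_gaussian_mul_gaussian` at z - y - η), one localising z and one localising η. The form
becomes a superposition of rank-one forms. -/
theorem twistedForm_gaussian_eq {S : V ≃ₗᵢ[ℝ] V} (hS : ∀ x, inner ℝ x (S x) = 0) (κ : ℝ) {a : ℝ}
    (ha : 0 < a) (G h : 𝓢(V, ℂ)) (y : V) :
    ((∫ t : V, gaussian (2 * a) t : ℝ) : ℂ) *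
        twistedForm κ S (fun x => gaussian (a / 2 + κ ^ 2 / (8 * a)) (x - y)) G h =
      ∫ w, twist (-κ) S y w * (stft κ S a h (w + y) w * stft (-κ) S a G w (w + y)) := by
  have e1 : ∀ z η : V, ((∫ t : V, gaussian (2 * a) t : ℝ) : ℂ) *
      ((h z * G η * twist κ S z η) * gaussian (a / 2 + κ ^ 2 / (8 * a)) (z - η - y)) =
      ∫ w, (h z * G η * twist κ S z η) * ((gaussian a (z - (w + y)) * gaussian a (η - w) : ℝ) *
        twist κ S (z - y - η) (w - η)) := by
    intro z η
    have h1 := integral_gaussian_mul_gaussian S hS ha κ (z - y - η)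
    rw [← integral_sub_right_eq_self _ η] at h1
    have h2 : ∀ w, z - y - η - (w - η) = z - (w + y) := fun w => by abel
    rw [integral_const_mul]
    simp only [twist, gaussian_sub_comm a η]
    simp only [h2] at h1
    rw [h1, sub_right_comm z η y]
    push_cast
    ring
  have hi : Integrable fun q : (V × V) × V => (h q.1.1 * G q.1.2 * twist κ S q.1.1 q.1.2) *
      ((gaussian a (q.1.1 - (q.2 + y)) * gaussian a (q.1.2 - q.2) : ℝ) *
        twist κ S (q.1.1 - y - q.1.2) (q.2 - q.1.2)) := by
    refine integrable_mul_prod_of_norm_le (integrable_mul_twist κ S G h)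
      (k := fun q => ((gaussian a (q.1.1 - (q.2 + y)) * gaussian a (q.1.2 - q.2) : ℝ) : ℂ) *
        twist κ S (q.1.1 - y - q.1.2) (q.2 - q.1.2))
      (Continuous.aestronglyMeasurable (by fun_prop)) (integrable_gaussian ha)
      (g := fun p => p.2) fun q => ?_
    rw [norm_mul, norm_twist, mul_one, Complex.norm_real, Real.norm_of_nonneg
      (mul_nonneg (gaussian_pos _ _).le (gaussian_pos _ _).le), gaussian_sub_comm a q.1.2]
    exact mul_le_of_le_one_left (gaussian_pos _ _).le (gaussian_le_one ha.le _)
  rw [twistedForm, ← integral_const_mul]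
  simp only [e1]
  rw [integral_integral_swap hi]
  refine integral_congr_ae (Filter.Eventually.of_forall fun w => ?_)
  simp only [stft]
  rw [Measure.volume_eq_prod, ← integral_prod_mul, ← integral_const_mul]
  refine integral_congr_ae (Filter.Eventually.of_forall fun p => ?_)
  simp only [windowed_apply ha.le]
  have := twist_phase hS κ p.1 p.2 y w
  push_cast
  linear_combination (h p.1 * G p.2 * (gaussian a (p.1 - (w + y)) * gaussian a (p.2 - w))) * this

/-- The mass of the squared window appears once on the left through `twistedForm_gaussian_eq`, and
twice to the power 1/2 on the right. It cancels, so the constant is uniform in a. -/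
theorem exists_lintegral_twistedForm_gaussian_le {S : V ≃ₗᵢ[ℝ] V}
    (hS : ∀ x, inner ℝ x (S x) = 0) {κ : ℝ} (hκ : κ ≠ 0) :
    ∃ C : ℝ≥0∞, C ≠ ⊤ ∧ ∀ a : ℝ, 0 < a → ∀ G h : 𝓢(V, ℂ),
      ∫⁻ y, ‖twistedForm κ S (fun x => gaussian (a / 2 + κ ^ 2 / (8 * a)) (x - y)) G h‖ₑ ≤
        C * (∫⁻ x, ‖G x‖ₑ ^ 2) ^ (1 / 2 : ℝ) * (∫⁻ x, ‖h x‖ₑ ^ 2) ^ (1 / 2 : ℝ) := by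
  obtain ⟨C₁, h₁, hC₁⟩ := exists_lintegral_windowed_le S hκ
  obtain ⟨C₂, h₂, hC₂⟩ := exists_lintegral_windowed_le S (neg_ne_zero.2 hκ)
  refine ⟨C₁ ^ (1 / 2 : ℝ) * C₂ ^ (1 / 2 : ℝ), ENNReal.mul_ne_top
    (ENNReal.rpow_ne_top_of_nonneg (by norm_num) h₁)
    (ENNReal.rpow_ne_top_of_nonneg (by norm_num) h₂), fun a ha G h => ?_⟩
  set c := ENNReal.ofReal (∫ t : V, gaussian (2 * a) t) with hc
  have hcpos : 0 < ∫ t : V, gaussian (2 * a) t := by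
    simp only [gaussian]
    rw [GaussianFourier.integral_rexp_neg_mul_sq_norm (by positivity)]
    positivity
  have hc0 : c ≠ 0 := by simpa [hc] using hcpos
  have hct : c ≠ ⊤ := ENNReal.ofReal_ne_top
  rw [← ENNReal.mul_le_mul_iff_right hc0 hct, ← lintegral_const_mul' _ _ hct]
  have hce : c = ‖((∫ t : V, gaussian (2 * a) t : ℝ) : ℂ)‖ₑ := by
    rw [← ofReal_norm, Complex.norm_real, Real.norm_of_nonneg hcpos.le]
  have hle : ∀ y, c * ‖twistedForm κ S (fun x => gaussian (a / 2 + κ ^ 2 / (8 * a)) (x - y)) G h‖ₑ ≤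
      ∫⁻ w, ‖stft κ S a h (w + y) w‖ₑ * ‖stft (-κ) S a G w (w + y)‖ₑ := by
    intro y
    rw [hce, ← enorm_mul, twistedForm_gaussian_eq hS κ ha]
    refine (enorm_integral_le_lintegral_enorm _).trans (lintegral_mono fun w => ?_)
    rw [enorm_mul, enorm_mul, ← ofReal_norm (twist _ _ _ _), norm_twist, ENNReal.ofReal_one,
      one_mul]
  calc _ ≤ _ := lintegral_mono hle
    _ ≤ _ := lintegral_shear_mul_le (measurable_enorm_stft κ S ha h)
      (measurable_enorm_stft (-κ) S ha G)
    _ ≤ (C₁ * (c * ∫⁻ x, ‖h x‖ₑ ^ 2)) ^ (1 / 2 : ℝ) *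
        (C₂ * (c * ∫⁻ x, ‖G x‖ₑ ^ 2)) ^ (1 / 2 : ℝ) := by
      gcongr
      · exact hC₁ a ha h
      · exact hC₂ a ha G
    _ = _ := by
      simp only [ENNReal.mul_rpow_of_nonneg _ _ (by norm_num : (0 : ℝ) ≤ 1 / 2)]
      have : c ^ (1 / 2 : ℝ) * c ^ (1 / 2 : ℝ) = c := by
        rw [← ENNReal.rpow_add_of_nonneg _ _ (by norm_num) (by norm_num)]
        norm_num
      conv_rhs => rw [← this]
      ring

end AntiWick

end MoyalPlane

/-! ### Bounded smooth functions and integration by parts against a Gaussian -/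

namespace MoyalPlane

noncomputable section HeatFlow

open FourierTransform
open scoped InnerProductSpace ENNReal

variable {V : Type*} [NormedAddCommGroup V] [InnerProductSpace ℝ V]

/-- Smooth functions that are bounded together with all their derivatives. -/
def IsSmoothBounded (f : V → ℂ) : Prop :=
  ContDiff ℝ ∞ f ∧ ∀ n : ℕ, ∃ K : ℝ, ∀ x, ‖iteratedFDeriv ℝ n f x‖ ≤ K

namespace IsSmoothBounded

variable {f : V → ℂ}

theorem exists_norm_le (hf : IsSmoothBounded f) : ∃ K : ℝ, 0 ≤ K ∧ ∀ x, ‖f x‖ ≤ K := by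
  obtain ⟨K, hK⟩ := hf.2 0
  exact ⟨K, (norm_nonneg _).trans (hK 0), fun x => by simpa using hK x⟩

theorem exists_norm_fderiv_le (hf : IsSmoothBounded f) : ∃ K : ℝ, 0 ≤ K ∧ ∀ x, ‖fderiv ℝ f x‖ ≤ K := by
  obtain ⟨K, hK⟩ := hf.2 1
  refine ⟨K, (norm_nonneg _).trans (hK 0), fun x => ?_⟩
  rw [← norm_iteratedFDeriv_one]
  exact hK x

theorem differentiable (hf : IsSmoothBounded f) : Differentiable ℝ f :=
  hf.1.differentiable (by simp)

theorem continuous (hf : IsSmoothBounded f) : Continuous f := hf.1.continuous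

theorem fderiv_apply (hf : IsSmoothBounded f) (e : V) : IsSmoothBounded fun x => fderiv ℝ f x e := by
  have h : ContDiff ℝ ∞ (fderiv ℝ f) := hf.1.fderiv_right (by simp)
  refine ⟨h.clm_apply contDiff_const, fun n => ?_⟩
  obtain ⟨K, hK⟩ := hf.2 (n + 1)
  refine ⟨‖e‖ * K, fun x => ?_⟩
  refine (norm_iteratedFDeriv_clm_apply_const (h.contDiffAt (x := x)) (by exact_mod_cast le_top)).trans ?_
  rw [norm_iteratedFDeriv_fderiv]
  exact mul_le_mul_of_nonneg_left (hK x) (norm_nonneg e)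

end IsSmoothBounded

theorem hasFDerivAt_gaussian (a : ℝ) (x : V) :
    HasFDerivAt (gaussian a : V → ℝ) ((-2 * a * gaussian a x) • innerSL ℝ x) x := by
  have h := ((hasStrictFDerivAt_norm_sq x).hasFDerivAt.const_mul (-a)).exp
  refine h.congr_fderiv ?_
  ext e
  simp [gaussian]
  ring

variable [FiniteDimensional ℝ V] [MeasurableSpace V] [BorelSpace V]

theorem integrable_norm_mul_gaussian {a : ℝ} (ha : 0 < a) :
    Integrable fun x : V => ‖x‖ * gaussian a x := by
  have h : Integrable fun x : V => Real.sqrt (1 / a) * gaussian (a / 2) x :=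
    (integrable_gaussian (by positivity)).const_mul _
  refine h.mono' (Continuous.aestronglyMeasurable (by fun_prop))
    (Filter.Eventually.of_forall fun x => ?_)
  rw [Real.norm_of_nonneg (mul_nonneg (norm_nonneg x) (gaussian_pos _ _).le)]
  have e : gaussian a x = gaussian (a / 2) x * gaussian (a / 2) x := by
    simp only [gaussian, ← Real.exp_add]; congr 1; ring
  rw [e, ← mul_assoc]
  refine mul_le_mul_of_nonneg_right ?_ (gaussian_pos _ _).le
  -- Half of the Gaussian absorbs ‖x‖: its square times a‖x‖² is at most 1, because 1 + u ≤ e^u.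
  refine Real.le_sqrt_of_sq_le ?_
  have h1 := Real.add_one_le_exp (a * ‖x‖ ^ 2)
  have h2 : gaussian (a / 2) x ^ 2 * Real.exp (a * ‖x‖ ^ 2) = 1 := by
    rw [pow_two, ← e, gaussian, ← Real.exp_add]; simp
  rw [mul_pow, le_div_iff₀ ha]
  have := sq_nonneg (gaussian (a / 2) x)
  nlinarith

/-- Integration by parts in the derivative of the heat flow. -/
theorem integral_gaussian_mul_fderiv {ι : Type*} [Fintype ι] (b : OrthonormalBasis ι ℝ V)
    {f : V → ℂ} (hf : IsSmoothBounded f) (x : V) (r : ℝ) :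
    ∫ y, (gaussian 1 y : ℂ) * -fderiv ℝ f (x - r • y) y =
      ∑ i, (r / 2 : ℂ) * ∫ y, (gaussian 1 y : ℂ) *
        fderiv ℝ (fun x => fderiv ℝ f x (b i)) (x - r • y) (b i) := by
  have hfi : ∀ i, IsSmoothBounded fun x => fderiv ℝ f x (b i) := fun i => hf.fderiv_apply (b i)
  have hg : ∀ (y e : V), HasFDerivAt (fun y : V => (gaussian 1 y : ℂ))
      (Complex.ofRealCLM.comp ((-2 * 1 * gaussian 1 y) • innerSL ℝ y)) y := fun y e =>
    Complex.ofRealCLM.hasFDerivAt.comp y (hasFDerivAt_gaussian 1 y)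
  have hgd : ∀ (y e : V), fderiv ℝ (fun y : V => (gaussian 1 y : ℂ)) y e =
      ((-2 * gaussian 1 y * inner ℝ y e : ℝ) : ℂ) := fun y e => by
    rw [(hg y e).fderiv]; simp
  have hc : ∀ y : V, HasFDerivAt (fun y : V => x - r • y) (-(r • ContinuousLinearMap.id ℝ V)) y :=
    fun y => ((hasFDerivAt_id y).const_smul r).const_sub x
  have hd : ∀ i (y : V), HasFDerivAt (fun y : V => fderiv ℝ f (x - r • y) (b i))
      ((fderiv ℝ (fun x => fderiv ℝ f x (b i)) (x - r • y)).comp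
        (-(r • ContinuousLinearMap.id ℝ V))) y := fun i y =>
    HasFDerivAt.comp (g := fun x => fderiv ℝ f x (b i)) y
      ((hfi i).differentiable (x - r • y)).hasFDerivAt (hc y)
  have hdd : ∀ i (y : V), fderiv ℝ (fun y : V => fderiv ℝ f (x - r • y) (b i)) y (b i) =
      -(r * fderiv ℝ (fun x => fderiv ℝ f x (b i)) (x - r • y) (b i)) := fun i y => by
    rw [(hd i y).fderiv]; simp
  have cont : ∀ i, Continuous fun y : V => fderiv ℝ f (x - r • y) (b i) := fun i =>
    (hfi i).continuous.comp (by fun_prop)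
  have i1 : ∀ i, Integrable fun y : V => ((-2 * gaussian 1 y * inner ℝ y (b i) : ℝ) : ℂ) *
      fderiv ℝ f (x - r • y) (b i) := fun i => by
    obtain ⟨K, _, hK⟩ := (hfi i).exists_norm_le
    refine Integrable.mul_bdd (c := K) ?_ (cont i).aestronglyMeasurable
      (Filter.Eventually.of_forall fun y => hK _)
    refine Integrable.ofReal (f := fun y : V => -2 * gaussian 1 y * inner ℝ y (b i))
      (((integrable_norm_mul_gaussian (V := V) one_pos).const_mul 2).mono'
      (Continuous.aestronglyMeasurable (by fun_prop))
      (Filter.Eventually.of_forall fun y => ?_))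
    rw [norm_mul, norm_mul, Real.norm_of_nonneg (gaussian_pos _ _).le]
    have h1 := norm_inner_le_norm (𝕜 := ℝ) y (b i)
    rw [b.norm_eq_one, mul_one] at h1
    rw [show ‖(-2 : ℝ)‖ = 2 by norm_num]
    linarith [mul_le_mul_of_nonneg_left h1 (gaussian_pos 1 y).le]
  have i2 : ∀ i, Integrable fun y : V => (gaussian 1 y : ℂ) *
      -(r * fderiv ℝ (fun x => fderiv ℝ f x (b i)) (x - r • y) (b i)) := fun i => by
    obtain ⟨K, _, hK⟩ := ((hfi i).fderiv_apply (b i)).exists_norm_le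
    refine Integrable.mul_bdd (c := |r| * K) (integrable_gaussian one_pos).ofReal
      (Continuous.aestronglyMeasurable ?_) (Filter.Eventually.of_forall fun y => ?_)
    · exact (continuous_const.mul (((hfi i).fderiv_apply (b i)).continuous.comp
        (by fun_prop : Continuous fun y : V => x - r • y))).neg
    · rw [norm_neg, norm_mul, Complex.norm_real, Real.norm_eq_abs]
      exact mul_le_mul_of_nonneg_left (hK _) (abs_nonneg r)
  have i3 : ∀ i, Integrable fun y : V => (gaussian 1 y : ℂ) * fderiv ℝ f (x - r • y) (b i) :=
    fun i => by
    obtain ⟨K, _, hK⟩ := (hfi i).exists_norm_le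
    exact Integrable.mul_bdd (c := K) (integrable_gaussian one_pos).ofReal
      (cont i).aestronglyMeasurable (Filter.Eventually.of_forall fun y => hK _)
  have parts : ∀ i, ∫ y, (gaussian 1 y : ℂ) *
      -(r * fderiv ℝ (fun x => fderiv ℝ f x (b i)) (x - r • y) (b i)) =
      -∫ y, ((-2 * gaussian 1 y * inner ℝ y (b i) : ℝ) : ℂ) * fderiv ℝ f (x - r • y) (b i) := by
    intro i
    have h := integral_mul_fderiv_eq_neg_fderiv_mul_of_integrable (μ := (volume : Measure V))
      (f := fun y : V => (gaussian 1 y : ℂ))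
      (g := fun y : V => fderiv ℝ f (x - r • y) (b i)) (v := b i)
      (by simpa only [hgd] using i1 i) (by simpa only [hdd] using i2 i) (i3 i)
      (fun y _ => (hg y y).differentiableAt) (fun y _ => (hd i y).differentiableAt)
    simpa only [hgd, hdd] using h
  -- The factor y is half the negative gradient of the Gaussian up to the Gaussian itself; moving
  -- that gradient onto f(x - ry) produces the gain r/2 and a second derivative.
  have e1 : ∀ y : V, (gaussian 1 y : ℂ) * -fderiv ℝ f (x - r • y) y =
      ∑ i, (1 / 2 : ℂ) * (((-2 * gaussian 1 y * inner ℝ y (b i) : ℝ) : ℂ) *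
        fderiv ℝ f (x - r • y) (b i)) := fun y => by
    conv_lhs => rw [← b.sum_repr' y, map_sum, ← Finset.sum_neg_distrib, Finset.mul_sum]
    rw [b.sum_repr' y]
    refine Finset.sum_congr rfl fun i _ => ?_
    rw [map_smul, Complex.real_smul, real_inner_comm]
    push_cast
    ring
  simp_rw [e1]
  rw [integral_finsetSum _ fun i _ => (i1 i).const_mul _]
  refine Finset.sum_congr rfl fun i _ => ?_
  rw [integral_const_mul, ← neg_eq_iff_eq_neg.2 (parts i), ← integral_neg, ← integral_const_mul,
    ← integral_const_mul]
  refine integral_congr_ae (Filter.Eventually.of_forall fun y => ?_)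
  ring

end HeatFlow

end MoyalPlane

/-! ### The Calderón–Vaillancourt bound by heat flow -/

namespace MoyalPlane

noncomputable section TwistedBound

open FourierTransform
open scoped InnerProductSpace ENNReal

variable {V : Type*} [NormedAddCommGroup V] [InnerProductSpace ℝ V]
  [FiniteDimensional ℝ V] [MeasurableSpace V] [BorelSpace V]

/-- The heat flow at time proportional to `r²`. -/
def heat (f : V → ℂ) (r : ℝ) (x : V) : ℂ := ∫ y, gaussian 1 y * f (x - r • y)

variable (κ : ℝ) (S : V ≃ₗᵢ[ℝ] V) (G h : 𝓢(V, ℂ)) {f : V → ℂ}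

theorem integrable_twist_mul_gaussian : Integrable fun q : (V × V) × V =>
    (h q.1.1 * G q.1.2 * twist κ S q.1.1 q.1.2) * (gaussian 1 q.2 : ℂ) :=
  (integrable_mul_twist κ S G h).mul_prod (integrable_gaussian one_pos).ofReal

theorem integrable_heat (hf : IsSmoothBounded f) (r : ℝ) : Integrable fun q : (V × V) × V =>
    (h q.1.1 * G q.1.2 * twist κ S q.1.1 q.1.2) *
      ((gaussian 1 q.2 : ℂ) * f (q.1.1 - q.1.2 - r • q.2)) := by
  obtain ⟨K, _, hK⟩ := hf.exists_norm_le
  have hc := hf.continuous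
  have := (integrable_twist_mul_gaussian κ S G h).mul_bdd (c := K)
    (g := fun q : (V × V) × V => f (q.1.1 - q.1.2 - r • q.2))
    (Continuous.aestronglyMeasurable (by fun_prop)) (Filter.Eventually.of_forall fun q => hK _)
  simpa only [mul_assoc] using this

theorem twistedForm_heat (hf : IsSmoothBounded f) (r : ℝ) : twistedForm κ S (heat f r) G h =
    ∫ q : (V × V) × V, (h q.1.1 * G q.1.2 * twist κ S q.1.1 q.1.2) *
      ((gaussian 1 q.2 : ℂ) * f (q.1.1 - q.1.2 - r • q.2)) := by
  rw [Measure.volume_eq_prod (V × V) V, integral_prod _ (integrable_heat κ S G h hf r)]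
  simp only [integral_const_mul]
  rfl

theorem hasDerivAt_twistedForm_heat {ι : Type*} [Fintype ι] (b : OrthonormalBasis ι ℝ V)
    (hf : IsSmoothBounded f) (r : ℝ) :
    HasDerivAt (fun r => twistedForm κ S (heat f r) G h)
      (∑ i, (r / 2 : ℂ) * twistedForm κ S
        (heat (fun x => fderiv ℝ (fun x => fderiv ℝ f x (b i)) x (b i)) r) G h) r := by
  obtain ⟨K, hK0, hK⟩ := hf.exists_norm_fderiv_le
  have hcf := hf.continuous
  have hcd : Continuous (fderiv ℝ f) := hf.1.continuous_fderiv (by simp)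
  -- The majorant comes from the bound K on the first derivative of f and does not depend on r, so
  -- domination holds on the whole line.
  have hbd : Integrable fun q : (V × V) × V =>
      ‖h q.1.1 * G q.1.2 * twist κ S q.1.1 q.1.2‖ * (K * (‖q.2‖ * gaussian 1 q.2)) :=
    (integrable_mul_twist κ S G h).norm.mul_prod
      ((integrable_norm_mul_gaussian one_pos).const_mul K)
  have hle : ∀ (q : (V × V) × V) (r : ℝ), ‖(h q.1.1 * G q.1.2 * twist κ S q.1.1 q.1.2) *
      ((gaussian 1 q.2 : ℂ) * -fderiv ℝ f (q.1.1 - q.1.2 - r • q.2) q.2)‖ ≤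
      ‖h q.1.1 * G q.1.2 * twist κ S q.1.1 q.1.2‖ * (K * (‖q.2‖ * gaussian 1 q.2)) := by
    intro q r
    refine (norm_mul _ _).trans_le (mul_le_mul_of_nonneg_left ?_ (norm_nonneg _))
    rw [norm_mul, norm_neg, Complex.norm_real, Real.norm_of_nonneg (gaussian_pos _ _).le]
    have := (fderiv ℝ f (q.1.1 - q.1.2 - r • q.2)).le_of_opNorm_le (hK _) q.2
    have := mul_le_mul_of_nonneg_left this (gaussian_pos 1 q.2).le
    linarith
  have hmeas : ∀ r : ℝ, AEStronglyMeasurable (fun q : (V × V) × V =>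
      (h q.1.1 * G q.1.2 * twist κ S q.1.1 q.1.2) *
      ((gaussian 1 q.2 : ℂ) * -fderiv ℝ f (q.1.1 - q.1.2 - r • q.2) q.2)) := by
    intro r
    have hh := h.continuous
    have hG := G.continuous
    have : Continuous fun q : (V × V) × V => fderiv ℝ f (q.1.1 - q.1.2 - r • q.2) q.2 :=
      (hcd.comp (by fun_prop)).clm_apply continuous_snd
    exact Continuous.aestronglyMeasurable (by fun_prop)
  have key := (hasDerivAt_integral_of_dominated_loc_of_deriv_le
    (μ := (volume : Measure ((V × V) × V))) (𝕜 := ℝ) (x₀ := r) (s := Set.univ)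
    (F := fun r q => (h q.1.1 * G q.1.2 * twist κ S q.1.1 q.1.2) *
      ((gaussian 1 q.2 : ℂ) * f (q.1.1 - q.1.2 - r • q.2)))
    (F' := fun r q => (h q.1.1 * G q.1.2 * twist κ S q.1.1 q.1.2) *
      ((gaussian 1 q.2 : ℂ) * -fderiv ℝ f (q.1.1 - q.1.2 - r • q.2) q.2))
    Filter.univ_mem
    (Filter.Eventually.of_forall fun r => (integrable_heat κ S G h hf r).aestronglyMeasurable)
    (integrable_heat κ S G h hf r) (hmeas r)
    (Filter.Eventually.of_forall fun q r _ => hle q r) hbd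
    (Filter.Eventually.of_forall fun q r _ => ?_)).2
  · have hint := hbd.mono' (hmeas r) (Filter.Eventually.of_forall fun q => hle q r)
    simp only [twistedForm_heat κ S G h hf]
    refine key.congr_deriv ?_
    rw [Measure.volume_eq_prod (V × V) V, integral_prod _ hint]
    simp only [integral_const_mul, integral_gaussian_mul_fderiv b hf, Finset.mul_sum]
    rw [integral_finsetSum]
    · refine Finset.sum_congr rfl fun i _ => ?_
      rw [twistedForm, ← integral_const_mul]
      refine integral_congr_ae (Filter.Eventually.of_forall fun p => ?_)
      simp only [heat]
      ring
    · intro i _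
      have h1 := (integrable_heat κ S G h ((hf.fderiv_apply (b i)).fderiv_apply (b i)) r).integral_prod_left
      simp only [integral_const_mul] at h1
      refine (h1.const_mul (r / 2 : ℂ)).congr (Filter.Eventually.of_forall fun p => ?_)
      ring
  · have h1 : HasDerivAt (fun r : ℝ => q.1.1 - q.1.2 - r • q.2) (-q.2) r := by
      simpa using ((hasDerivAt_id r).smul_const q.2).const_sub (q.1.1 - q.1.2)
    have h2 := (hf.differentiable (q.1.1 - q.1.2 - r • q.2)).hasFDerivAt.comp_hasDerivAt r h1
    rw [map_neg] at h2
    exact (h2.const_mul _).const_mul _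

theorem lintegral_enorm_sq_rpow (u : 𝓢(V, ℂ)) :
    (∫⁻ x, ‖u x‖ₑ ^ 2) ^ (1 / 2 : ℝ) = ENNReal.ofReal ‖u.toLp 2‖ := by
  have hu := (u.memLp 2 volume).eLpNorm_ne_top
  rw [norm_toLp, ENNReal.ofReal_toReal hu,
    eLpNorm_eq_lintegral_rpow_enorm_toReal (by norm_num) (by norm_num)]
  simp

theorem heat_eq (f : V → ℂ) {r : ℝ} (hr : 0 < r) :
    heat f r = fun x => ((r⁻¹ ^ Module.finrank ℝ V : ℝ) : ℂ) *
      ∫ y, gaussian (1 / r ^ 2) (x - y) * f y := by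
  have hgr : ∀ y : V, gaussian (1 / r ^ 2) (r • y) = gaussian 1 y := fun y => by
    rw [gaussian, gaussian, norm_smul, mul_pow, Real.norm_eq_abs, sq_abs]
    congr 1
    field_simp
  ext x
  have h1 := Measure.integral_comp_smul (volume : Measure V)
    (fun u => (gaussian (1 / r ^ 2) u : ℂ) * f (x - u)) r
  rw [abs_of_nonneg (by positivity), ← inv_pow, Complex.real_smul] at h1
  rw [← integral_sub_left_eq_self _ _ x]
  simp only [sub_sub_cancel]
  rw [← h1, heat]
  simp only [hgr]

/-- By the arithmetic-geometric mean inequality a/2 + κ²/(8a) ≥ |κ|/2, so 1/r² is attained exactly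
when r²|κ| ≤ 2. The witness is the larger root of a² - 2a/r² + κ²/4 = 0. -/
theorem exists_gaussian_parameter {κ r : ℝ} (hr : 0 < r) (hrκ : r ^ 2 * |κ| ≤ 2) :
    ∃ a : ℝ, 0 < a ∧ 0 < a / 2 + κ ^ 2 / (8 * a) ∧ a / 2 + κ ^ 2 / (8 * a) = 1 / r ^ 2 := by
  set c : ℝ := 1 / r ^ 2 with hc
  have hcpos : 0 < c := by positivity
  have hcκ : κ ^ 2 / 4 ≤ c ^ 2 := by
    have h1 : |κ| / 2 ≤ c := by
      rw [hc, le_div_iff₀ (by positivity)]; linarith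
    have h2 : 0 ≤ |κ| / 2 := by positivity
    have := pow_le_pow_left₀ h2 h1 2
    rw [div_pow, sq_abs] at this
    linarith
  have hapos : 0 < c + √(c ^ 2 - κ ^ 2 / 4) := by positivity
  have h1 : √(c ^ 2 - κ ^ 2 / 4) ^ 2 = c ^ 2 - κ ^ 2 / 4 := Real.sq_sqrt (by linarith)
  refine ⟨c + √(c ^ 2 - κ ^ 2 / 4), hapos, by positivity, ?_⟩
  generalize √(c ^ 2 - κ ^ 2 / 4) = t at h1 hapos ⊢
  rw [div_add_div _ _ two_ne_zero (by positivity), div_eq_iff (by positivity)]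
  linear_combination 8 * h1

/-- The `L²` norm of a Schwartz function bounds the twisted form of a Gaussian smoothing. -/
theorem exists_norm_twistedForm_heat_le {S : V ≃ₗᵢ[ℝ] V}
    (hS : ∀ x, inner ℝ x (S x) = 0) {κ : ℝ} (hκ : κ ≠ 0) {f : V → ℂ} (hf : IsSmoothBounded f) :
    ∃ C : ℝ, 0 ≤ C ∧ ∀ (G h : 𝓢(V, ℂ)) (r : ℝ), 0 < r → r ^ 2 * |κ| ≤ 2 →
      ‖twistedForm κ S (heat f r) G h‖ ≤
        C * r⁻¹ ^ Module.finrank ℝ V * (‖G.toLp 2‖ * ‖h.toLp 2‖) := by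
  obtain ⟨C, hC, hle⟩ := exists_lintegral_twistedForm_gaussian_le hS hκ
  obtain ⟨K, hK0, hK⟩ := hf.exists_norm_le
  refine ⟨K * C.toReal, by positivity, fun G h r hr hrκ => ?_⟩
  obtain ⟨a, hapos, hcpos, hac⟩ := exists_gaussian_parameter hr hrκ
  set c := a / 2 + κ ^ 2 / (8 * a)
  -- The unnormalised Gaussian of width r costs the Jacobian r^{-dim V}; the remaining y-integral is
  -- bounded by sup |f| uniformly in r.
  have e1 : twistedForm κ S (heat f r) G h = ((r⁻¹ ^ Module.finrank ℝ V : ℝ) : ℂ) *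
      ∫ y, f y * twistedForm κ S (fun x => gaussian c (x - y)) G h := by
    rw [← twistedForm_gaussian_smoothing κ S hcpos G h hf.continuous hK, heat_eq f hr, ← hac, twistedForm,
      twistedForm, ← integral_const_mul]
    refine integral_congr_ae (Filter.Eventually.of_forall fun p => ?_)
    ring
  have e2 : ‖∫ y, f y * twistedForm κ S (fun x => gaussian c (x - y)) G h‖ₑ ≤
      ENNReal.ofReal (K * C.toReal * (‖G.toLp 2‖ * ‖h.toLp 2‖)) := by
    calc _ ≤ ∫⁻ y, ‖f y * twistedForm κ S (fun x => gaussian c (x - y)) G h‖ₑ :=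
          enorm_integral_le_lintegral_enorm _
      _ ≤ ∫⁻ y, ENNReal.ofReal K * ‖twistedForm κ S (fun x => gaussian c (x - y)) G h‖ₑ := by
          refine lintegral_mono fun y => ?_
          rw [enorm_mul]
          gcongr
          rw [← ofReal_norm]
          exact ENNReal.ofReal_le_ofReal (hK y)
      _ = ENNReal.ofReal K * ∫⁻ y, ‖twistedForm κ S (fun x => gaussian c (x - y)) G h‖ₑ :=
          lintegral_const_mul' _ _ ENNReal.ofReal_ne_top
      _ ≤ _ := by
          have := hle a hapos G h
          rw [lintegral_enorm_sq_rpow, lintegral_enorm_sq_rpow] at this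
          refine (mul_le_mul' le_rfl this).trans_eq ?_
          rw [ENNReal.ofReal_mul (by positivity), ENNReal.ofReal_mul hK0,
            ENNReal.ofReal_mul (norm_nonneg _), ENNReal.ofReal_toReal hC]
          ring
  rw [← ofReal_norm, ENNReal.ofReal_le_ofReal_iff (by positivity)] at e2
  rw [e1, norm_mul, Complex.norm_real, Real.norm_of_nonneg (by positivity)]
  refine (mul_le_mul_of_nonneg_left e2 (by positivity)).trans_eq ?_
  ring

/-- The bound for the heat flow improves down to time zero. -/
theorem exists_norm_twistedForm_heat_le_pow {S : V ≃ₗᵢ[ℝ] V} {κ r₀ : ℝ} (hr₀ : 0 < r₀) (m n : ℕ)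
    (hbase : ∀ f : V → ℂ, IsSmoothBounded f →
      ∃ C : ℝ, 0 ≤ C ∧ ∀ (G h : 𝓢(V, ℂ)) (r : ℝ), 0 < r → r ≤ r₀ →
      ‖twistedForm κ S (heat f r) G h‖ ≤ C * r⁻¹ ^ (m + n) * (‖G.toLp 2‖ * ‖h.toLp 2‖)) :
    ∀ f : V → ℂ, IsSmoothBounded f →
      ∃ C : ℝ, 0 ≤ C ∧ ∀ (G h : 𝓢(V, ℂ)) (r : ℝ), 0 < r → r ≤ r₀ →
      ‖twistedForm κ S (heat f r) G h‖ ≤ C * r⁻¹ ^ m * (‖G.toLp 2‖ * ‖h.toLp 2‖) := by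
  induction n with
  | zero => exact hbase
  | succ n ih =>
    -- It suffices to lower the exponent by one, from m + n + 1 to m + n, for all bounded smooth f
    -- simultaneously.
    refine ih fun f hf => ?_
    set k := m + n
    let b := stdOrthonormalBasis ℝ V
    choose C hC0 hC using fun i =>
      hbase _ ((hf.fderiv_apply (b i)).fderiv_apply (b i))
    obtain ⟨C', hC'0, hC'⟩ := hbase f hf
    have hsum : 0 ≤ ∑ i, C i := Finset.sum_nonneg fun i _ => hC0 i
    refine ⟨C' * r₀⁻¹ + 1 / 2 * (∑ i, C i) * r₀, by positivity, fun G h r hr hrr => ?_⟩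
    set n2 := ‖G.toLp 2‖ * ‖h.toLp 2‖ with hn2
    have hn20 : 0 ≤ n2 := by positivity
    -- The base bound applies to the second derivatives of f, and the factor ρ/2 pays for one power
    -- of ρ⁻¹.
    have hder : ∀ ρ ∈ Set.Icc r r₀, ‖∑ i, (ρ / 2 : ℂ) * twistedForm κ S
        (heat (fun x => fderiv ℝ (fun x => fderiv ℝ f x (b i)) x (b i)) ρ) G h‖ ≤
        1 / 2 * (∑ i, C i) * r⁻¹ ^ k * n2 := by
      intro ρ hρ
      have hρ0 : 0 < ρ := hr.trans_le hρ.1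
      refine (norm_sum_le _ _).trans ?_
      rw [Finset.mul_sum, Finset.sum_mul, Finset.sum_mul]
      refine Finset.sum_le_sum fun i _ => ?_
      have e : ‖(ρ / 2 : ℂ)‖ = ρ / 2 := by
        rw [norm_div, Complex.norm_real, Real.norm_of_nonneg hρ0.le]; norm_num
      rw [norm_mul, e]
      calc _ ≤ ρ / 2 * (C i * ρ⁻¹ ^ (k + 1) * n2) :=
            mul_le_mul_of_nonneg_left (hC i G h ρ hρ0 hρ.2) (by positivity)
        _ = 1 / 2 * C i * ρ⁻¹ ^ k * n2 := by
            rw [pow_succ]; field_simp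
        _ ≤ _ := by
            have := hC0 i
            have := hρ.1
            gcongr
    have hmv := Convex.norm_image_sub_le_of_norm_hasDerivWithin_le
      (fun ρ hρ => (hasDerivAt_twistedForm_heat κ S G h b hf ρ).hasDerivWithinAt) hder
      (convex_Icc r r₀) (Set.right_mem_Icc.2 hrr) (Set.left_mem_Icc.2 hrr)
    have hend : ‖twistedForm κ S (heat f r₀) G h‖ ≤ C' * r₀⁻¹ * r⁻¹ ^ k * n2 := by
      refine (hC' G h r₀ hr₀ le_rfl).trans ?_
      have : r₀⁻¹ ^ (m + (n + 1)) ≤ r₀⁻¹ * r⁻¹ ^ k := by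
        rw [← add_assoc, pow_succ']
        gcongr
      calc _ ≤ C' * (r₀⁻¹ * r⁻¹ ^ k) * n2 := by gcongr
        _ = _ := by ring
    have hdist : ‖r - r₀‖ ≤ r₀ := by
      rw [Real.norm_eq_abs, abs_le]; constructor <;> linarith
    calc _ ≤ ‖twistedForm κ S (heat f r₀) G h‖ +
          ‖twistedForm κ S (heat f r) G h - twistedForm κ S (heat f r₀) G h‖ := by
          rw [add_comm]; exact norm_le_norm_sub_add _ _
      _ ≤ C' * r₀⁻¹ * r⁻¹ ^ k * n2 + 1 / 2 * (∑ i, C i) * r⁻¹ ^ k * n2 * r₀ := by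
          refine add_le_add hend (hmv.trans ?_)
          gcongr
      _ = _ := by ring

/-- The Calderón–Vaillancourt bound for twisted convolution operators. -/
theorem exists_norm_twistedForm_le {S : V ≃ₗᵢ[ℝ] V}
    (hS : ∀ x, inner ℝ x (S x) = 0) {κ : ℝ} (hκ : κ ≠ 0) {f : V → ℂ} (hf : IsSmoothBounded f) :
    ∃ C : ℝ, 0 ≤ C ∧ ∀ G h : 𝓢(V, ℂ),
      ‖twistedForm κ S f G h‖ ≤ C * (‖G.toLp 2‖ * ‖h.toLp 2‖) := by
  have hκ' : 0 < |κ| := abs_pos.2 hκ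
  set r₀ : ℝ := √(2 / |κ|)
  have hr₀ : 0 < r₀ := Real.sqrt_pos.2 (by positivity)
  have hr₀κ : r₀ ^ 2 * |κ| = 2 := by
    rw [Real.sq_sqrt (by positivity)]; field_simp
  obtain ⟨C, hC0, hC⟩ := exists_norm_twistedForm_heat_le_pow hr₀ 0 (Module.finrank ℝ V)
    (κ := κ) (S := S) (fun f hf => by
      obtain ⟨C, hC0, hC⟩ := exists_norm_twistedForm_heat_le hS hκ hf
      refine ⟨C, hC0, fun G h r hr hrr => ?_⟩
      rw [zero_add]
      refine hC G h r hr ?_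
      rw [← hr₀κ]
      gcongr) f hf
  set g := ∫ y : V, gaussian 1 y with hg
  have hgpos : 0 < g := by
    simp only [hg, gaussian]
    rw [GaussianFourier.integral_rexp_neg_mul_sq_norm (by positivity)]
    positivity
  refine ⟨g⁻¹ * C, by positivity, fun G h => ?_⟩
  -- The Gaussian is not normalised, so at r = 0 the flow returns f times its mass g.
  have e0 : twistedForm κ S (heat f 0) G h = (g : ℂ) * twistedForm κ S f G h := by
    rw [twistedForm, twistedForm, ← integral_const_mul]
    refine integral_congr_ae (Filter.Eventually.of_forall fun p => ?_)
    simp only [heat, zero_smul, sub_zero]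
    rw [integral_mul_const, integral_complex_ofReal]
    ring
  have hcont : Filter.Tendsto (fun r => ‖twistedForm κ S (heat f r) G h‖)
      (nhdsWithin 0 (Set.Ioi 0)) (nhds ‖twistedForm κ S (heat f 0) G h‖) :=
    ((hasDerivAt_twistedForm_heat κ S G h (stdOrthonormalBasis ℝ V) hf
      0).continuousAt.norm.tendsto).mono_left nhdsWithin_le_nhds
  have hlim : ‖twistedForm κ S (heat f 0) G h‖ ≤ C * (‖G.toLp 2‖ * ‖h.toLp 2‖) := by
    refine le_of_tendsto hcont ?_
    filter_upwards [Ioc_mem_nhdsGT hr₀] with r hr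
    simpa using hC G h r hr.1 hr.2
  rw [e0, norm_mul, Complex.norm_real, Real.norm_of_nonneg hgpos.le] at hlim
  rw [mul_assoc, ← div_eq_inv_mul, le_div_iff₀ hgpos, mul_comm]
  exact hlim

end TwistedBound

end MoyalPlane

/-! ### The twisted pairing, its Leibniz rule and its triple integral -/

namespace MoyalPlane

noncomputable section TwistedPairing

open FourierTransform
open scoped InnerProductSpace ENNReal

variable {V : Type*} [NormedAddCommGroup V] [InnerProductSpace ℝ V]

theorem hasFDerivAt_twist (κ : ℝ) (S : V ≃ₗᵢ[ℝ] V) (z η : V) :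
    HasFDerivAt (fun z => twist κ S z η)
      (twist κ S z η • (innerSL ℝ (S η)).smulRight (κ * Complex.I)) z := by
  have h := ((innerSL ℝ (S η)).smulRight (κ * Complex.I)).hasFDerivAt (x := z) |>.cexp
  have e : ∀ z, Complex.exp ((innerSL ℝ (S η)).smulRight (κ * Complex.I) z) = twist κ S z η := by
    intro z
    rw [twist, ContinuousLinearMap.smulRight_apply, innerSL_apply_apply, real_inner_comm,
      Complex.real_smul]
    push_cast
    congr 1
    ring
  simpa only [e] using h

/-- The linear map `η ↦ (κ / 2π) S η`. -/
def frequencyEquiv {κ : ℝ} (hκ : κ ≠ 0) (S : V ≃ₗᵢ[ℝ] V) : V ≃L[ℝ] V :=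
  S.toContinuousLinearEquiv.trans (ContinuousLinearEquiv.smulLeft
    (Units.mk0 (κ / (2 * Real.pi)) (div_ne_zero hκ (by positivity))))

theorem frequencyEquiv_apply {κ : ℝ} (hκ : κ ≠ 0) (S : V ≃ₗᵢ[ℝ] V) (η : V) :
    frequencyEquiv hκ S η = (κ / (2 * Real.pi)) • S η := rfl

variable [FiniteDimensional ℝ V] [MeasurableSpace V] [BorelSpace V]

/-- The Fourier transform `η ↦ ∫ g(y) e^{-iκ y·Sη} dy`. -/
def twistedFourier {κ : ℝ} (hκ : κ ≠ 0) (S : V ≃ₗᵢ[ℝ] V) : 𝓢(V, ℂ) →L[ℂ] 𝓢(V, ℂ) :=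
  compCLMOfContinuousLinearEquiv ℂ (frequencyEquiv hκ S) ∘L fourierTransformCLM ℂ

theorem twistedFourier_apply {κ : ℝ} (hκ : κ ≠ 0) (S : V ≃ₗᵢ[ℝ] V) (g : 𝓢(V, ℂ)) (η : V) :
    twistedFourier hκ S g η = ∫ y, g y * twist (-κ) S y η := by
  change 𝓕 g (frequencyEquiv hκ S η) = _
  rw [frequencyEquiv_apply, fourier_coe, Real.fourier_eq']
  refine integral_congr_ae (Filter.Eventually.of_forall fun y => ?_)
  simp only [smul_eq_mul, inner_smul_right, twist]
  rw [mul_comm]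
  congr 4
  field_simp

theorem twistedFourier_lineDeriv {κ : ℝ} (hκ : κ ≠ 0) (S : V ≃ₗᵢ[ℝ] V) (g : 𝓢(V, ℂ)) (e η : V) :
    twistedFourier hκ S (∂_{e} g) η =
      (κ * Complex.I) * (inner ℝ e (S η) : ℝ) * twistedFourier hκ S g η := by
  change 𝓕 (∂_{e} g : 𝓢(V, ℂ)) (frequencyEquiv hκ S η) = _ * 𝓕 g (frequencyEquiv hκ S η)
  have hI : (inner ℝ · e : V → ℝ).HasTemperateGrowth := by fun_prop
  rw [fourier_lineDerivOp_eq, smul_apply, smulLeftCLM_apply_apply hI, frequencyEquiv_apply,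
    real_inner_smul_left, real_inner_comm, smul_eq_mul, Complex.real_smul]
  push_cast
  field_simp

theorem exists_norm_twistedFourier_le {κ : ℝ} (hκ : κ ≠ 0) (S : V ≃ₗᵢ[ℝ] V) :
    ∃ C : ℝ, 0 ≤ C ∧ ∀ g : 𝓢(V, ℂ), ‖(twistedFourier hκ S g).toLp 2‖ ≤ C * ‖g.toLp 2‖ := by
  obtain ⟨C, hC, hle⟩ := exists_lintegral_comp_le (frequencyEquiv hκ S)
  refine ⟨(C ^ (1 / 2 : ℝ)).toReal, ENNReal.toReal_nonneg, fun g => ?_⟩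
  rw [← ENNReal.ofReal_le_ofReal_iff (by positivity), ENNReal.ofReal_mul ENNReal.toReal_nonneg,
    ← lintegral_enorm_sq_rpow, ← lintegral_enorm_sq_rpow,
    ENNReal.ofReal_toReal (ENNReal.rpow_ne_top_of_nonneg (by norm_num) hC),
    ← ENNReal.mul_rpow_of_nonneg _ _ (by norm_num), ← lintegral_enorm_sq_fourier g]
  refine ENNReal.rpow_le_rpow ?_ (by norm_num)
  exact hle (fun ξ => ‖𝓕 g ξ‖ₑ ^ 2) ((𝓕 g).continuous.enorm.measurable.pow_const 2)

theorem integrable_twistedForm (κ : ℝ) (S : V ≃ₗᵢ[ℝ] V) (G h : 𝓢(V, ℂ)) {f : V → ℂ}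
    (hf : IsSmoothBounded f) :
    Integrable fun p : V × V => (h p.1 * G p.2 * twist κ S p.1 p.2) * f (p.1 - p.2) := by
  obtain ⟨K, _, hK⟩ := hf.exists_norm_le
  have hc := hf.continuous
  exact (integrable_mul_twist κ S G h).mul_bdd (c := K)
    (Continuous.aestronglyMeasurable (by fun_prop)) (Filter.Eventually.of_forall fun p => hK _)

/-- Integration by parts in one variable of the twisted form. -/
theorem integral_twist_mul_fderiv (κ : ℝ) (S : V ≃ₗᵢ[ℝ] V) (h : 𝓢(V, ℂ)) {f : V → ℂ}
    (hf : IsSmoothBounded f) (e η : V) :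
    ∫ z, (h z * twist κ S z η) * fderiv ℝ f (z - η) e = -∫ z, ((∂_{e} h : 𝓢(V, ℂ)) z * twist κ S z η +
      h z * (twist κ S z η * ((κ * Complex.I) * (inner ℝ e (S η) : ℝ)))) * f (z - η) := by
  obtain ⟨K, _, hK⟩ := hf.exists_norm_le
  obtain ⟨K', _, hK'⟩ := (hf.fderiv_apply e).exists_norm_le
  have cf := hf.continuous
  have cf' := (hf.fderiv_apply e).continuous
  have hu : ∀ z, HasFDerivAt (fun z => h z * twist κ S z η) _ z := fun z =>
    (h.differentiableAt (x := z)).hasFDerivAt.mul (hasFDerivAt_twist κ S z η)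
  have hu' : ∀ z, fderiv ℝ (fun z => h z * twist κ S z η) z e =
      (∂_{e} h : 𝓢(V, ℂ)) z * twist κ S z η +
      h z * (twist κ S z η * ((κ * Complex.I) * (inner ℝ e (S η) : ℝ))) := fun z => by
    rw [(hu z).fderiv, lineDerivOp_apply_eq_fderiv]
    simp [real_inner_comm]
    ring
  have hv : ∀ z, HasFDerivAt (fun z => f (z - η)) (fderiv ℝ f (z - η)) z := fun z =>
    (hf.differentiable (z - η)).hasFDerivAt.comp z ((hasFDerivAt_id z).sub_const η)
  have tw : ∀ u : 𝓢(V, ℂ), Integrable fun z => u z * twist κ S z η := fun u =>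
    u.integrable.mul_bdd (c := 1) (Continuous.aestronglyMeasurable (by fun_prop))
      (Filter.Eventually.of_forall fun z => by rw [norm_twist])
  have bd : ∀ {F : V → ℂ}, Integrable F → Integrable fun z => F z * f (z - η) := fun hF =>
    hF.mul_bdd (c := K) (Continuous.aestronglyMeasurable (by fun_prop))
      (Filter.Eventually.of_forall fun z => hK _)
  have key := integral_mul_fderiv_eq_neg_fderiv_mul_of_integrable (μ := (volume : Measure V))
    (f := fun z => h z * twist κ S z η) (g := fun z => f (z - η)) (v := e) ?_ ?_ (bd (tw h))
    (fun z _ => (hu z).differentiableAt) (fun z _ => (hv z).differentiableAt)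
  · simpa only [hu', (hv _).fderiv] using key
  · simp only [hu']
    refine bd ((tw (∂_{e} h)).add ?_)
    simpa only [mul_assoc] using (tw h).mul_const ((κ * Complex.I) * (inner ℝ e (S η) : ℝ))
  · simp only [(hv _).fderiv]
    exact (tw h).mul_bdd (c := K') (cf'.comp (continuous_sub_right η)).aestronglyMeasurable
      (Filter.Eventually.of_forall fun z => hK' _)

/-- The pairing of a bounded smooth function with a twisted product of Schwartz functions. -/
def twistedPairing {κ : ℝ} (hκ : κ ≠ 0) (S : V ≃ₗᵢ[ℝ] V) (f : V → ℂ) (g h : 𝓢(V, ℂ)) : ℂ :=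
  twistedForm κ S f (twistedFourier hκ S g) h

variable {κ : ℝ} (hκ : κ ≠ 0) (S : V ≃ₗᵢ[ℝ] V) {f : V → ℂ}

/-- The Leibniz rule for the pairing. -/
theorem twistedPairing_fderiv (hf : IsSmoothBounded f) (g h : 𝓢(V, ℂ)) (e : V) :
    twistedPairing hκ S (fun x => fderiv ℝ f x e) g h =
      -(twistedPairing hκ S f (∂_{e} g) h + twistedPairing hκ S f g (∂_{e} h)) := by
  have i1 := integrable_twistedForm κ S (twistedFourier hκ S g) h (hf.fderiv_apply e)
  have i2 := integrable_twistedForm κ S (twistedFourier hκ S (∂_{e} g)) h hf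
  have i3 := integrable_twistedForm κ S (twistedFourier hκ S g) (∂_{e} h) hf
  have e2 : twistedPairing hκ S f (∂_{e} g) h + twistedPairing hκ S f g (∂_{e} h) = _ :=
    (integral_add' i2 i3).symm
  rw [e2, twistedPairing, twistedForm, Measure.volume_eq_prod, integral_prod_symm _ i1,
    integral_prod_symm _ (i2.add i3), ← integral_neg]
  refine integral_congr_ae (Filter.Eventually.of_forall fun η => ?_)
  -- Integration by parts in z also differentiates the phase; the resulting factor iκ e · Sη is the
  -- symbol of ∂_e under `twistedFourier`, which turns it into the term with ∂_e g.
  have h1 := congrArg (fun c => twistedFourier hκ S g η * c) (integral_twist_mul_fderiv κ S h hf e η)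
  simp only [← integral_neg, ← integral_const_mul] at h1
  simp only [← integral_neg]
  refine Eq.trans (integral_congr_ae (Filter.Eventually.of_forall fun z => ?_)) (h1.trans
    (integral_congr_ae (Filter.Eventually.of_forall fun z => ?_)))
  · simp only
    ring
  · simp only [twistedFourier_lineDeriv, Pi.add_apply]
    ring

theorem twistedPairing_add_left (hf : IsSmoothBounded f) (g g' h : 𝓢(V, ℂ)) :
    twistedPairing hκ S f (g + g') h = twistedPairing hκ S f g h + twistedPairing hκ S f g' h := by
  simp only [twistedPairing, twistedForm, map_add]
  rw [← integral_add (integrable_twistedForm κ S _ h hf) (integrable_twistedForm κ S _ h hf)]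
  refine integral_congr_ae (Filter.Eventually.of_forall fun p => ?_)
  simp only [add_apply]
  ring

theorem twistedPairing_add_right (hf : IsSmoothBounded f) (g h h' : 𝓢(V, ℂ)) :
    twistedPairing hκ S f g (h + h') = twistedPairing hκ S f g h + twistedPairing hκ S f g h' := by
  simp only [twistedPairing, twistedForm]
  rw [← integral_add (integrable_twistedForm κ S _ h hf) (integrable_twistedForm κ S _ h' hf)]
  refine integral_congr_ae (Filter.Eventually.of_forall fun p => ?_)
  simp only [add_apply]
  ring

theorem twistedPairing_smul_left (f : V → ℂ) (c : ℂ) (g h : 𝓢(V, ℂ)) :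
    twistedPairing hκ S f (c • g) h = c * twistedPairing hκ S f g h := by
  simp only [twistedPairing, twistedForm, map_smul]
  rw [← integral_const_mul]
  refine integral_congr_ae (Filter.Eventually.of_forall fun p => ?_)
  simp only [smul_apply, smul_eq_mul]
  ring

theorem twistedPairing_smul_right (f : V → ℂ) (c : ℂ) (g h : 𝓢(V, ℂ)) :
    twistedPairing hκ S f g (c • h) = c * twistedPairing hκ S f g h := by
  simp only [twistedPairing, twistedForm]
  rw [← integral_const_mul]
  refine integral_congr_ae (Filter.Eventually.of_forall fun p => ?_)
  simp only [smul_apply, smul_eq_mul]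
  ring

/-- The pairing as a bilinear map on Schwartz functions. -/
def twistedPairingBilin (hf : IsSmoothBounded f) : 𝓢(V, ℂ) →ₗ[ℂ] 𝓢(V, ℂ) →ₗ[ℂ] ℂ :=
  LinearMap.mk₂ ℂ (twistedPairing hκ S f) (twistedPairing_add_left hκ S hf)
    (twistedPairing_smul_left hκ S f) (twistedPairing_add_right hκ S hf)
    (twistedPairing_smul_right hκ S f)

theorem exists_norm_twistedPairing_le {S : V ≃ₗᵢ[ℝ] V} (hS : ∀ x, inner ℝ x (S x) = 0)
    (hf : IsSmoothBounded f) : ∃ C : ℝ, 0 ≤ C ∧ ∀ g h : 𝓢(V, ℂ),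
      ‖twistedPairing hκ S f g h‖ ≤ C * (‖g.toLp 2‖ * ‖h.toLp 2‖) := by
  obtain ⟨C₁, h₁, hC₁⟩ := exists_norm_twistedForm_le hS hκ hf
  obtain ⟨C₂, h₂, hC₂⟩ := exists_norm_twistedFourier_le hκ S
  refine ⟨C₁ * C₂, by positivity, fun g h => (hC₁ _ h).trans ?_⟩
  rw [mul_assoc, ← mul_assoc C₂]
  gcongr
  exact hC₂ g

/-- The pairing as a triple integral. -/
theorem integral_mul_integral_twist (hS : ∀ x, inner ℝ x (S x) = 0) (hf : IsSmoothBounded f)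
    (g h : 𝓢(V, ℂ)) :
    ∫ x, f x * ∫ y, ∫ z, g y * h z * twist (-κ) S (x - y) (x - z) = twistedPairing hκ S f g h := by
  have hi := integrable_twistedForm κ S (twistedFourier hκ S g) h hf
  -- Integrating in y first yields the transform of g at η = z - x; the later substitution x = z - η
  -- then gives f(z - η).
  have e1 : ∀ x z : V, ∫ y, g y * h z * twist (-κ) S (x - y) (x - z) =
      h z * twistedFourier hκ S g (z - x) * twist κ S z (z - x) := by
    intro x z
    rw [twistedFourier_apply, mul_assoc, ← integral_mul_const, ← integral_const_mul]
    refine integral_congr_ae (Filter.Eventually.of_forall fun y => ?_)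
    have : twist (-κ) S (x - y) (x - z) = twist (-κ) S y (z - x) * twist κ S z (z - x) := by
      simp only [twist, ← Complex.exp_add, ← add_mul, ← Complex.ofReal_add]
      congr 3
      simp only [map_sub, inner_sub_left, inner_sub_right, hS]
      rw [inner_apply_eq_neg hS z x]
      ring
    simp only [this]
    ring
  have e2 : ∀ x : V, ∫ y, ∫ z, g y * h z * twist (-κ) S (x - y) (x - z) =
      ∫ z, h z * twistedFourier hκ S g (z - x) * twist κ S z (z - x) := by
    intro x
    rw [integral_integral_swap]
    · simp only [e1]
    · exact (g.integrable.mul_prod h.integrable).mul_bdd (c := 1)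
        (Continuous.aestronglyMeasurable (by fun_prop))
        (Filter.Eventually.of_forall fun p => by rw [norm_twist])
  obtain ⟨K, hK0, hK⟩ := hf.exists_norm_le
  have cf := hf.continuous
  have hi' : Integrable fun q : V × V => h q.1 *
      (f q.2 * twistedFourier hκ S g (q.1 - q.2) * twist κ S q.1 (q.1 - q.2)) := by
    have cG := (twistedFourier hκ S g).continuous
    refine integrable_mul_prod_of_norm_le h.integrable
      (k := fun q => f q.2 * twistedFourier hκ S g (q.1 - q.2) * twist κ S q.1 (q.1 - q.2))
      (Continuous.aestronglyMeasurable (by fun_prop))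
      (ρ := fun w => K * ‖twistedFourier hκ S g (-w)‖)
      ((twistedFourier hκ S g).integrable.norm.comp_neg.const_mul K) (g := id) fun q => ?_
    rw [norm_mul, norm_twist, mul_one, norm_mul, id, neg_sub]
    exact mul_le_mul_of_nonneg_right (hK _) (norm_nonneg _)
  simp only [e2, ← integral_const_mul]
  have e3 : ∀ x z : V, f x * (h z * twistedFourier hκ S g (z - x) * twist κ S z (z - x)) =
      h z * (f x * twistedFourier hκ S g (z - x) * twist κ S z (z - x)) := fun x z => by ring
  simp only [e3]
  rw [← integral_integral_swap hi', twistedPairing, twistedForm, Measure.volume_eq_prod,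
    integral_prod _ hi]
  refine integral_congr_ae (Filter.Eventually.of_forall fun z => ?_)
  simp only
  rw [← integral_sub_left_eq_self _ _ z]
  refine integral_congr_ae (Filter.Eventually.of_forall fun η => ?_)
  simp only [sub_sub_cancel]
  ring

end TwistedPairing

end MoyalPlane

/-! ### The bounded operators of left Moyal multiplication -/

namespace MoyalPlane

noncomputable section MoyalOperators

open FourierTransform
open scoped InnerProductSpace ComplexConjugate

/-- A bounded sesquilinear form on a dense subspace comes from a bounded operator. -/
theorem exists_clm_of_form {E H : Type*} [AddCommGroup E] [Module ℂ E] [NormedAddCommGroup H]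
    [InnerProductSpace ℂ H] [CompleteSpace H] (ι : E →ₗ[ℂ] H) (hι : DenseRange ι)
    (B : E →ₗ⋆[ℂ] E →ₗ[ℂ] ℂ) {C : ℝ} (hC : 0 ≤ C) (hB : ∀ x y, ‖B x y‖ ≤ C * (‖ι x‖ * ‖ι y‖)) :
    ∃ A : H →L[ℂ] H, ∀ x y, inner ℂ (ι x) (A (ι y)) = B x y := by
  have hB' : ∀ x y, ‖B x y‖ ≤ C * ‖ι x‖ * ‖ι y‖ := fun x y => by rw [mul_assoc]; exact hB x y
  have hd : ∀ {x x' : H}, (∀ y, inner ℂ x (ι y) = inner ℂ x' (ι y)) → x = x' := fun h =>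
    ext_inner_right ℂ fun v => hι.induction_on v (isClosed_eq (by fun_prop) (by fun_prop)) h
  let u : E → H := fun x => (InnerProductSpace.toDual ℂ H).symm ((B x).extendOfNorm ι)
  have hu : ∀ x y, inner ℂ (u x) (ι y) = B x y := fun x y => by
    rw [InnerProductSpace.toDual_symm_apply, LinearMap.extendOfNorm_eq hι ⟨_, hB' x⟩]
  have hun : ∀ x, ‖u x‖ ≤ C * ‖ι x‖ := fun x => by
    rw [LinearIsometryEquiv.norm_map]
    exact ContinuousLinearMap.opNorm_le_bound _ (by positivity)
      (LinearMap.norm_extendOfNorm_apply_le hι _ (hB' x))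
  -- The Riesz vector of a conjugate-linear family of functionals depends linearly on x; the
  -- operator sought is the adjoint of the extension of T.
  let T : E →ₗ[ℂ] H :=
    { toFun := u
      map_add' := fun x x' => hd fun y => by
        rw [inner_add_left, hu, hu, hu, map_add, LinearMap.add_apply]
      map_smul' := fun c x => hd fun y => by
        rw [inner_smul_left, hu, hu, map_smulₛₗ, LinearMap.smul_apply]; rfl }
  refine ⟨ContinuousLinearMap.adjoint (T.extendOfNorm ι), fun x y => ?_⟩
  rw [ContinuousLinearMap.adjoint_inner_right, LinearMap.extendOfNorm_eq hι ⟨C, hun⟩]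
  exact hu x y

/-- The symplectic matrix as an isometry. -/
def symplecticIsometry (N : ℕ) : PhaseSpace N ≃ₗᵢ[ℝ] PhaseSpace N :=
  LinearIsometryEquiv.mk
    { toFun := fun x => WithLp.toLp 2 ((symplecticMatrix N).mulVec x.ofLp)
      invFun := fun x => -WithLp.toLp 2 ((symplecticMatrix N).mulVec x.ofLp)
      map_add' := fun x y => by simp [Matrix.mulVec_add]
      map_smul' := fun c x => by simp [Matrix.mulVec_smul]
      left_inv := fun x => by
        ext i
        rcases i with i | i <;> simp [symplecticMatrix, Matrix.fromBlocks_mulVec, Matrix.neg_mulVec]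
      right_inv := fun x => by
        ext i
        rcases i with i | i <;> simp [symplecticMatrix, Matrix.fromBlocks_mulVec, Matrix.mulVec_neg, Matrix.neg_mulVec] }
    (fun x => by
      rw [EuclideanSpace.norm_eq, EuclideanSpace.norm_eq]
      simp [symplecticMatrix, Matrix.fromBlocks_mulVec, Fintype.sum_sum_type, Matrix.neg_mulVec]
      rw [add_comm])

variable {N : ℕ}

theorem inner_symplecticIsometry (x y : PhaseSpace N) :
    inner ℝ x (symplecticIsometry N y) = symplecticPairing x y := by
  rw [symplecticPairing, dotProduct_comm]
  rfl

theorem inner_symplecticIsometry_self (x : PhaseSpace N) :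
    inner ℝ x (symplecticIsometry N x) = 0 := by
  rw [inner_symplecticIsometry, symplecticPairing, symplecticMatrix]
  simp [Matrix.fromBlocks_mulVec, dotProduct, Fintype.sum_sum_type, mul_comm, Matrix.neg_mulVec]

theorem neg_two_div_ne_zero {θ : ℝ} (hθ : θ ≠ 0) : -(2 / θ) ≠ 0 :=
  neg_ne_zero.2 (div_ne_zero two_ne_zero hθ)

/-- The triple integral of `integral_mul_integral_twist` has phase parameter -κ, hence the choice κ
= -2/θ. -/
theorem integral_mul_moyalProduct {θ : ℝ} (hθ : θ ≠ 0) {f : PhaseSpace N → ℂ}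
    (hf : IsSmoothBounded f) (g h : 𝓢(PhaseSpace N, ℂ)) :
    ∫ x, f x * moyalProduct θ g h x = (((Real.pi * θ) ^ (2 * N))⁻¹ : ℝ) *
      twistedPairing (neg_two_div_ne_zero hθ) (symplecticIsometry N) f g h := by
  rw [← integral_mul_integral_twist _ _ inner_symplecticIsometry_self hf, ← integral_const_mul]
  refine integral_congr_ae (Filter.Eventually.of_forall fun x => ?_)
  simp only [moyalProduct, twist, neg_neg, inner_symplecticIsometry]
  ring

/-- The components of a Schwartz spinor. -/
def component (j : Fin (2 ^ N)) : 𝓢(PhaseSpace N, Spinor N) →L[ℂ] 𝓢(PhaseSpace N, ℂ) :=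
  postcompCLM (EuclideanSpace.proj j)

/-- The complex conjugates of the components of a Schwartz spinor. -/
def conjComponent (j : Fin (2 ^ N)) : 𝓢(PhaseSpace N, Spinor N) →ₗ⋆[ℂ] 𝓢(PhaseSpace N, ℂ) where
  toFun Ψ := postcompCLM (𝕜 := ℝ) (Complex.conjCLE : ℂ →L[ℝ] ℂ) (component j Ψ)
  map_add' Ψ Φ := by rw [map_add, map_add]
  map_smul' c Ψ := by ext x; simp [component]

@[simp] theorem component_apply (j : Fin (2 ^ N)) (Ψ : 𝓢(PhaseSpace N, Spinor N))
    (x : PhaseSpace N) : component j Ψ x = Ψ x j := rfl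

@[simp] theorem conjComponent_apply (j : Fin (2 ^ N)) (Ψ : 𝓢(PhaseSpace N, Spinor N))
    (x : PhaseSpace N) : conjComponent j Ψ x = conj (Ψ x j) := rfl

theorem norm_toLp_le_of_norm_le {F G : Type*} [NormedAddCommGroup F] [NormedSpace ℝ F]
    [NormedAddCommGroup G] [NormedSpace ℝ G] (u : 𝓢(PhaseSpace N, F)) (v : 𝓢(PhaseSpace N, G))
    (h : ∀ x, ‖u x‖ ≤ ‖v x‖) : ‖u.toLp 2‖ ≤ ‖v.toLp 2‖ := by
  have hv := (v.memLp 2 volume).eLpNorm_ne_top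
  rw [norm_toLp, norm_toLp]
  exact ENNReal.toReal_mono hv (eLpNorm_mono h)

variable {θ : ℝ} (hθ : θ ≠ 0) {f : PhaseSpace N → ℂ}

/-- The sesquilinear form of left Moyal multiplication by `f` on Schwartz spinors. -/
def moyalForm (f : PhaseSpace N → ℂ) (Φ Ψ : 𝓢(PhaseSpace N, Spinor N)) : ℂ :=
  (((Real.pi * θ) ^ (2 * N))⁻¹ : ℝ) * ∑ j, twistedPairing (neg_two_div_ne_zero hθ)
    (symplecticIsometry N) f (component j Ψ) (conjComponent j Φ)

theorem moyalForm_add_left (hf : IsSmoothBounded f) (Φ Φ' Ψ : 𝓢(PhaseSpace N, Spinor N)) :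
    moyalForm hθ f (Φ + Φ') Ψ = moyalForm hθ f Φ Ψ + moyalForm hθ f Φ' Ψ := by
  simp only [moyalForm, map_add, twistedPairing_add_right _ _ hf, mul_add, Finset.sum_add_distrib]

theorem moyalForm_add_right (hf : IsSmoothBounded f) (Φ Ψ Ψ' : 𝓢(PhaseSpace N, Spinor N)) :
    moyalForm hθ f Φ (Ψ + Ψ') = moyalForm hθ f Φ Ψ + moyalForm hθ f Φ Ψ' := by
  simp only [moyalForm, map_add, twistedPairing_add_left _ _ hf, mul_add, Finset.sum_add_distrib]

theorem moyalForm_smul_left (c : ℂ) (Φ Ψ : 𝓢(PhaseSpace N, Spinor N)) :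
    moyalForm hθ f (c • Φ) Ψ = conj c * moyalForm hθ f Φ Ψ := by
  simp only [moyalForm, map_smulₛₗ, twistedPairing_smul_right, ← Finset.mul_sum]
  ring

theorem moyalForm_smul_right (c : ℂ) (Φ Ψ : 𝓢(PhaseSpace N, Spinor N)) :
    moyalForm hθ f Φ (c • Ψ) = c * moyalForm hθ f Φ Ψ := by
  simp only [moyalForm, map_smul, twistedPairing_smul_left, ← Finset.mul_sum]
  ring

theorem exists_norm_moyalForm_le (hf : IsSmoothBounded f) : ∃ C : ℝ, 0 ≤ C ∧
    ∀ Φ Ψ : 𝓢(PhaseSpace N, Spinor N),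
      ‖moyalForm hθ f Φ Ψ‖ ≤ C * (‖Φ.toLp 2‖ * ‖Ψ.toLp 2‖) := by
  obtain ⟨C, hC0, hC⟩ := exists_norm_twistedPairing_le (neg_two_div_ne_zero hθ)
    (inner_symplecticIsometry_self (N := N)) hf
  refine ⟨|((Real.pi * θ) ^ (2 * N))⁻¹| * ∑ _j : Fin (2 ^ N), C,
    mul_nonneg (abs_nonneg _) (Finset.sum_nonneg fun _ _ => hC0), fun Φ Ψ => ?_⟩
  rw [moyalForm, norm_mul, Complex.norm_real, Real.norm_eq_abs, mul_assoc, Finset.sum_mul]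
  refine mul_le_mul_of_nonneg_left (norm_sum_le_of_le _ fun j _ => ?_) (abs_nonneg _)
  refine (hC _ _).trans (mul_le_mul_of_nonneg_left ?_ hC0)
  rw [mul_comm]
  refine mul_le_mul (norm_toLp_le_of_norm_le _ _ fun x => ?_)
    (norm_toLp_le_of_norm_le _ _ fun x => ?_) (norm_nonneg _) (norm_nonneg _)
  · rw [conjComponent_apply, RCLike.norm_conj]; exact PiLp.norm_apply_le _ j
  · exact PiLp.norm_apply_le _ j

theorem exists_moyalOperator (hf : IsSmoothBounded f) : ∃ A : SpinorL2 N →L[ℂ] SpinorL2 N,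
    ∀ Φ Ψ : 𝓢(PhaseSpace N, Spinor N),
      inner ℂ (Φ.toLp 2) (A (Ψ.toLp 2)) = moyalForm hθ f Φ Ψ := by
  obtain ⟨C, hC0, hC⟩ := exists_norm_moyalForm_le hθ hf
  exact exists_clm_of_form (toLpCLM ℂ (Spinor N) 2 (volume : Measure (PhaseSpace N))).toLinearMap
    denseRange_toLp_spinor (LinearMap.mk₂'ₛₗ (starRingEnd ℂ) (RingHom.id ℂ) (moyalForm hθ f)
      (moyalForm_add_left hθ hf) (moyalForm_smul_left hθ)
      (moyalForm_add_right hθ hf) (moyalForm_smul_right hθ)) hC0 hC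

/-- The pure spinor with components `conj h δ_{jk}`. -/
def conjSingle (j : Fin (2 ^ N)) (h : 𝓢(PhaseSpace N, ℂ)) : 𝓢(PhaseSpace N, Spinor N) :=
  postcompCLM (𝕜 := ℂ)
    (ContinuousLinearMap.toSpanSingleton ℂ (EuclideanSpace.single j (1 : ℂ) : Spinor N))
    (postcompCLM (𝕜 := ℝ) (Complex.conjCLE : ℂ →L[ℝ] ℂ) h)

theorem conjSingle_apply (j : Fin (2 ^ N)) (h : 𝓢(PhaseSpace N, ℂ)) (x : PhaseSpace N) :
    conjSingle j h x = conj (h x) • EuclideanSpace.single j (1 : ℂ) := rfl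

theorem moyalForm_conjSingle (hf : IsSmoothBounded f) (j : Fin (2 ^ N)) (h : 𝓢(PhaseSpace N, ℂ))
    (Ψ : 𝓢(PhaseSpace N, Spinor N)) : moyalForm hθ f (conjSingle j h) Ψ =
      ∫ x, f x * moyalProduct θ (component j Ψ) h x := by
  have e2 : ∀ k, k ≠ j → conjComponent k (conjSingle j h) = 0 := fun k hk => by
    ext x
    simp [conjSingle_apply, hk]
  have e3 : conjComponent j (conjSingle j h) = h := by
    ext x
    simp [conjSingle_apply]
  rw [integral_mul_moyalProduct hθ hf, moyalForm, Finset.sum_eq_single j, e3]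
  · intro k _ hk
    have := twistedPairing_smul_right (neg_two_div_ne_zero hθ) (symplecticIsometry N) f 0
      (component k Ψ) 0
    rwa [zero_smul, zero_mul, ← e2 k hk] at this
  · exact fun hj => absurd (Finset.mem_univ j) hj

theorem inner_toLp_conjSingle (j : Fin (2 ^ N)) (h : 𝓢(PhaseSpace N, ℂ)) (F : SpinorL2 N) :
    inner ℂ ((conjSingle j h).toLp 2) F = ∫ x, F x j * h x := by
  rw [L2.inner_def]
  refine integral_congr_ae ?_
  filter_upwards [(conjSingle j h).coeFn_toLp 2 volume] with x hx
  rw [hx, conjSingle_apply, inner_smul_left, EuclideanSpace.inner_single_left]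
  simp [mul_comm]

/-- A bounded operator with the form of left Moyal multiplication is left Moyal multiplication. -/
theorem isMoyalRep_of_form (hf : IsSmoothBounded f) {A : SpinorL2 N →L[ℂ] SpinorL2 N}
    (hA : ∀ Φ Ψ : 𝓢(PhaseSpace N, Spinor N),
      inner ℂ (Φ.toLp 2) (A (Ψ.toLp 2)) = moyalForm hθ f Φ Ψ) : IsMoyalRep θ f A := by
  intro Ψ j h
  refine (inner_toLp_conjSingle j h (A (Ψ.toLp 2))).symm.trans ?_
  exact (hA (conjSingle j h) Ψ).trans (moyalForm_conjSingle hθ hf j h Ψ)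

end MoyalOperators

end MoyalPlane

/-! ### Commutators of Moyal multiplication with momenta and Dirac matrices -/

namespace MoyalPlane

noncomputable section Main

open FourierTransform
open scoped InnerProductSpace ComplexConjugate

section Abstract

variable {H E : Type*} [NormedAddCommGroup H] [InnerProductSpace ℂ H]

theorem ext_of_form {ι : E → H} (hι : DenseRange ι) {X Y : H →L[ℂ] H}
    (h : ∀ u v, inner ℂ (ι u) (X (ι v)) = inner ℂ (ι u) (Y (ι v))) : X = Y := by
  ext1 y
  refine hι.induction_on y (isClosed_eq (by fun_prop) (by fun_prop)) fun v => ?_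
  exact ext_inner_left ℂ fun x => hι.induction_on x (isClosed_eq (by fun_prop) (by fun_prop))
    fun u => h u v

theorem commute_of_form {ι : E → H} (hι : DenseRange ι) {M A : H →L[ℂ] H} {m : E → E}
    (hM : ∀ x y, inner ℂ (M x) y = inner ℂ x (M y)) (hm : ∀ u, M (ι u) = ι (m u))
    (h : ∀ u v, inner ℂ (ι (m u)) (A (ι v)) = inner ℂ (ι u) (A (ι (m v)))) : Commute M A :=
  ext_of_form hι fun u v => by
    rw [mul_apply_eq_comp, mul_apply_eq_comp, ← hM, hm, hm, h]

theorem eq_smul_of_commute {s p : H →L[ℂ] H} {x y z : H} {c : ℂ} (hsp : Commute s p)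
    (hs : ∀ x, s x = 0 → x = 0) (hz : s z = c • p y) (hy : y = s x) : z = c • p x := by
  refine sub_eq_zero.1 (hs _ ?_)
  have h : s (p x) = p (s x) := by rw [← mul_apply_eq_comp, hsp.eq, mul_apply_eq_comp]
  rw [map_sub, hz, map_smul, h, hy, sub_self]

/-- Form version of [∂_e, A] = A₁: `D u` is the derivative of the smoothed vector `ι' u`, and ∂_e =
2πi p/s, which accounts for the factor -i/(2π). -/
theorem intertwining_of_form {ι ι' D : E → H} (hι : DenseRange ι) {s p A A₁ : H →L[ℂ] H}
    (hs : ∀ x y, inner ℂ (s x) y = inner ℂ x (s y)) (hp : ∀ x y, inner ℂ (p x) y = inner ℂ x (p y))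
    (hι' : ∀ u, s (ι u) = ι' u) (hD : ∀ u, D u = (2 * Real.pi * Complex.I : ℂ) • p (ι u))
    (hA : ∀ u v, inner ℂ (ι' u) (A₁ (ι' v)) =
      -(inner ℂ (D u) (A (ι' v)) + inner ℂ (ι' u) (A (D v)))) :
    p * A * s - s * A * p = s * ((-Complex.I / (2 * Real.pi)) • A₁) * s := by
  have hpi : (Real.pi : ℂ) ≠ 0 := by exact_mod_cast Real.pi_ne_zero
  refine ext_of_form hι fun u v => ?_
  have h := hA u v
  simp only [hD, map_smul, inner_smul_left, inner_smul_right, ← hι'] at h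
  simp only [sub_apply, mul_apply_eq_comp, inner_sub_right, smul_apply, map_smul, inner_smul_right]
  rw [← hp, ← hs, ← hs, h]
  simp only [map_mul, Complex.conj_I, Complex.conj_ofReal, map_ofNat]
  field_simp
  rw [Complex.I_sq]
  ring

theorem CommutatorSmooth.sum {R A ι κ : Type*} [CommRing R] [Algebra ℝ R] [NormedRing A]
    [NormedAlgebra ℝ A] {φ : R →ₐ[ℝ] A} {s : R} {p : ι → R} {n : ℕ} (t : Finset κ) {T : κ → A}
    (hT : ∀ k ∈ t, CommutatorSmooth φ s p n (T k)) : CommutatorSmooth φ s p n (∑ k ∈ t, T k) := by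
  classical
  induction t using Finset.induction_on with
  | empty =>
    rw [Finset.sum_empty]
    clear hT
    induction n with
    | zero => trivial
    | succ n ih => exact fun i => ⟨0, by simp [Intertwines], ih⟩
  | insert a t ha ih =>
    rw [Finset.sum_insert ha]
    exact (hT a (Finset.mem_insert_self a t)).add
      (ih fun k hk => hT k (Finset.mem_insert_of_mem hk))

/-- The matrices commute with both s and T, so the commutator with Σ M_i P_i/s falls on the P_i/s
alone. -/
theorem clifford_commutator {ι : Type*} [Fintype ι] {A : Type*} [Ring A] [Algebra ℂ A]
    (c : ℂ) (s T : A) (M P T' : ι → A) (hMs : ∀ i, Commute (M i) s)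
    (hMT : ∀ i, Commute (M i) T) (hT : ∀ i, P i * T * s - s * T * P i = s * T' i * s) :
    (c • ∑ i, M i * P i) * T * s - s * T * (c • ∑ i, M i * P i) =
      s * (c • ∑ i, M i * T' i) * s := by
  simp only [smul_mul_assoc, mul_smul_comm, Finset.sum_mul, Finset.mul_sum, ← smul_sub,
    ← Finset.sum_sub_distrib]
  congr 1
  refine Finset.sum_congr rfl fun i _ => ?_
  have e1 : s * T * (M i * P i) = M i * (s * T * P i) := by
    rw [← mul_assoc, mul_assoc s, ← (hMT i).eq, ← mul_assoc s, ← (hMs i).eq]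
    simp only [mul_assoc]
  have e2 : s * (M i * T' i) * s = M i * (s * T' i * s) := by
    rw [← mul_assoc s, ← (hMs i).eq]; simp only [mul_assoc]
  rw [e1, e2, ← hT]
  simp only [mul_sub, mul_assoc]

end Abstract

variable {N : ℕ} {θ : ℝ} (hθ : θ ≠ 0) {f : PhaseSpace N → ℂ}

theorem component_lineDeriv (j : Fin (2 ^ N)) (e : PhaseSpace N) (Ψ : 𝓢(PhaseSpace N, Spinor N)) :
    component j (∂_{e} Ψ : 𝓢(PhaseSpace N, Spinor N)) = ∂_{e} (component j Ψ) := by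
  ext x
  have h := ((EuclideanSpace.proj (𝕜 := ℂ) j : Spinor N →L[ℂ] ℂ).restrictScalars ℝ).hasFDerivAt.comp x
    (Ψ.differentiableAt (x := x)).hasFDerivAt
  rw [component_apply, lineDerivOp_apply_eq_fderiv, lineDerivOp_apply_eq_fderiv]
  exact (congrArg (fun L : PhaseSpace N →L[ℝ] ℂ => L e) h.fderiv).symm

theorem conjComponent_lineDeriv (j : Fin (2 ^ N)) (e : PhaseSpace N)
    (Ψ : 𝓢(PhaseSpace N, Spinor N)) :
    conjComponent j (∂_{e} Ψ : 𝓢(PhaseSpace N, Spinor N)) = ∂_{e} (conjComponent j Ψ) := by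
  ext x
  have h := ((Complex.conjCLE : ℂ →L[ℝ] ℂ).comp
    ((EuclideanSpace.proj (𝕜 := ℂ) j : Spinor N →L[ℂ] ℂ).restrictScalars ℝ)).hasFDerivAt.comp x
    (Ψ.differentiableAt (x := x)).hasFDerivAt
  rw [conjComponent_apply, lineDerivOp_apply_eq_fderiv, lineDerivOp_apply_eq_fderiv]
  exact (congrArg (fun L : PhaseSpace N →L[ℝ] ℂ => L e) h.fderiv).symm

theorem moyalForm_fderiv (hf : IsSmoothBounded f) (e : PhaseSpace N)
    (Φ Ψ : 𝓢(PhaseSpace N, Spinor N)) : moyalForm hθ (fun x => fderiv ℝ f x e) Φ Ψ =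
      -(moyalForm hθ f (∂_{e} Φ) Ψ + moyalForm hθ f Φ (∂_{e} Ψ)) := by
  simp only [moyalForm, twistedPairing_fderiv _ _ hf, component_lineDeriv, conjComponent_lineDeriv,
    Finset.sum_neg_distrib, Finset.sum_add_distrib]
  ring

/-- The Schwartz spinor `(1 + |P|²)^{-1/2} Ψ`. -/
def smoothing (Ψ : 𝓢(PhaseSpace N, Spinor N)) : 𝓢(PhaseSpace N, Spinor N) :=
  SchwartzMap.fourierMultiplierCLM (Spinor N) (symbolS (PhaseSpace N) : PhaseSpace N → ℝ) Ψ

theorem toLp_smoothing (Ψ : 𝓢(PhaseSpace N, Spinor N)) :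
    multiplierHom (symbolS (PhaseSpace N)) (Ψ.toLp 2) = (smoothing Ψ).toLp 2 :=
  multiplierHom_toLp hasTemperateGrowth_japaneseInv Ψ

theorem toLp_lineDeriv_smoothing (e : PhaseSpace N) (Ψ : 𝓢(PhaseSpace N, Spinor N)) :
    ((∂_{e} (smoothing Ψ) : 𝓢(PhaseSpace N, Spinor N)).toLp 2 : SpinorL2 N) =
      (2 * Real.pi * Complex.I : ℂ) • multiplierHom (symbolP e) (Ψ.toLp 2) := by
  have h : Commute (multiplierHom (F := Spinor N) (symbolS (PhaseSpace N)))
      (multiplierHom (symbolP e)) :=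
    commute_map (multiplierHom (F := Spinor N)) (symbolS (PhaseSpace N)) (symbolP e)
  have hs : ∀ f : SpinorL2 N, multiplierHom (symbolS (PhaseSpace N)) f = 0 → f = 0 :=
    fun _ => multiplierHom_injective symbolS_ne_zero
  exact eq_smul_of_commute h hs (multiplierHom_lineDeriv e (smoothing Ψ)) (toLp_smoothing Ψ).symm

theorem intertwines_moyalOperator (hf : IsSmoothBounded f) (e : PhaseSpace N)
    {A A₁ : SpinorL2 N →L[ℂ] SpinorL2 N}
    (hA : ∀ Φ Ψ : 𝓢(PhaseSpace N, Spinor N),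
      inner ℂ (Φ.toLp 2) (A (Ψ.toLp 2)) = moyalForm hθ f Φ Ψ)
    (hA₁ : ∀ Φ Ψ : 𝓢(PhaseSpace N, Spinor N),
      inner ℂ (Φ.toLp 2) (A₁ (Ψ.toLp 2)) = moyalForm hθ (fun x => fderiv ℝ f x e) Φ Ψ) :
    Intertwines multiplierHom (symbolS (PhaseSpace N)) (symbolP e) A
      ((-Complex.I / (2 * Real.pi)) • A₁) :=
  intertwining_of_form denseRange_toLp_spinor
    (inner_multiplierHom (symbolS (PhaseSpace N))) (inner_multiplierHom (symbolP e))
    toLp_smoothing (fun Ψ => toLp_lineDeriv_smoothing e Ψ) fun Φ Ψ => by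
      rw [hA₁, moyalForm_fderiv hθ hf, hA, hA]

theorem momentumSmooth_moyalOperator (n : ℕ) (hf : IsSmoothBounded f)
    {A : SpinorL2 N →L[ℂ] SpinorL2 N}
    (hA : ∀ Φ Ψ : 𝓢(PhaseSpace N, Spinor N),
      inner ℂ (Φ.toLp 2) (A (Ψ.toLp 2)) = moyalForm hθ f Φ Ψ) : MomentumSmooth N n A := by
  induction n generalizing f A with
  | zero => trivial
  | succ n ih =>
    intro μ
    obtain ⟨A₁, hA₁⟩ := exists_moyalOperator hθ (hf.fderiv_apply (EuclideanSpace.single μ (1 : ℝ)))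
    refine ⟨_, intertwines_moyalOperator hθ hf _ hA hA₁, ?_⟩
    -- The coefficient is complex while the algebra is real, so it is treated as left multiplication
    -- by a central element.
    rw [← smul_one_mul]
    exact (ih (hf.fderiv_apply _) hA₁).mul_left _ fun r => (Commute.one_left _).smul_left _

/-- Moyal multiplication is diagonal in the spinor index, so a hermitian matrix moves across by
exchanging two finite sums. -/
theorem moyalForm_postcomp (hf : IsSmoothBounded f)
    {M : Matrix (Fin (2 ^ N)) (Fin (2 ^ N)) ℂ} (hM : M.IsHermitian)
    (Φ Ψ : 𝓢(PhaseSpace N, Spinor N)) :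
    moyalForm hθ f (postcompCLM (Matrix.toEuclideanCLM (𝕜 := ℂ) M) Φ) Ψ =
      moyalForm hθ f Φ (postcompCLM (Matrix.toEuclideanCLM (𝕜 := ℂ) M) Ψ) := by
  have e1 : ∀ k, component k (postcompCLM (Matrix.toEuclideanCLM (𝕜 := ℂ) M) Ψ) =
      ∑ j, M k j • component j Ψ := fun k => by
    ext x
    simp [Matrix.mulVec, dotProduct]
  have e2 : ∀ j, conjComponent j (postcompCLM (Matrix.toEuclideanCLM (𝕜 := ℂ) M) Φ) =
      ∑ k, M k j • conjComponent k Φ := fun j => by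
    ext x
    simp [Matrix.mulVec, dotProduct]
    refine Finset.sum_congr rfl fun k _ => ?_
    rw [← hM.apply k j]; simp
  let B := twistedPairingBilin (neg_two_div_ne_zero hθ) (symplecticIsometry N) hf
  have hB : ∀ g h, twistedPairing (neg_two_div_ne_zero hθ) (symplecticIsometry N) f g h = B g h :=
    fun g h => rfl
  simp only [moyalForm, hB, e1, e2, map_sum, map_smul, LinearMap.sum_apply, LinearMap.smul_apply]
  rw [Finset.sum_comm]

theorem commute_spinorHom_moyalOperator (hf : IsSmoothBounded f)
    {A : SpinorL2 N →L[ℂ] SpinorL2 N}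
    (hA : ∀ Φ Ψ : 𝓢(PhaseSpace N, Spinor N),
      inner ℂ (Φ.toLp 2) (A (Ψ.toLp 2)) = moyalForm hθ f Φ Ψ)
    {M : Matrix (Fin (2 ^ N)) (Fin (2 ^ N)) ℂ} (hM : M.IsHermitian) :
    Commute (spinorHom N M) A := by
  refine commute_of_form denseRange_toLp_spinor (inner_spinorHom hM) (spinorHom_toLp M)
    fun Φ Ψ => ?_
  rw [hA, hA, moyalForm_postcomp hθ hf hM]

end Main

end MoyalPlane

theorem mainTheorem5 (N : ℕ) (θ : ℝ) (hθ : θ ≠ 0)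
    (γ : Fin N ⊕ Fin N → Matrix (Fin (2 ^ N)) (Fin (2 ^ N)) ℂ)
    (hγ : MoyalPlane.IsDiracMatrices γ) :
    ∃ absD : MoyalPlane.SpinorL2 N →ₗ.[ℂ] MoyalPlane.SpinorL2 N,
      MoyalPlane.IsAbsoluteValue (MoyalPlane.dirac γ) absD ∧
      ∀ f ∈ MoyalPlane.smoothBounded N,
        ∃ A C : MoyalPlane.SpinorL2 N →L[ℂ] MoyalPlane.SpinorL2 N,
          MoyalPlane.IsMoyalRep θ f A ∧
          MoyalPlane.IsCommutator (MoyalPlane.dirac γ) A C ∧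
          MoyalPlane.InSmoothDomain absD A ∧
          MoyalPlane.InSmoothDomain absD C := by
  refine ⟨MoyalPlane.absDirac N, MoyalPlane.isAbsoluteValue_absDirac hγ, fun f hf => ?_⟩
  have hf' : MoyalPlane.IsSmoothBounded f := hf
  obtain ⟨A, hA⟩ := MoyalPlane.exists_moyalOperator hθ hf'
  choose A₁ hA₁ using fun μ : Fin N ⊕ Fin N =>
    MoyalPlane.exists_moyalOperator hθ (hf'.fderiv_apply (EuclideanSpace.single μ (1 : ℝ)))
  -- The commutator is 2π Σ γ^μ (-i/2π) A₁ μ, that is, -i Σ γ^μ π(∂_μ f).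
  refine ⟨A, _, MoyalPlane.isMoyalRep_of_form hθ hf' hA,
    (MoyalPlane.isBoundedPair_diracBounded hγ).1.isCommutator (MoyalPlane.graph_dirac_eq hγ)
      (MoyalPlane.clifford_commutator ((2 * Real.pi : ℝ) : ℂ) _ A
        (fun μ => MoyalPlane.spinorHom N (γ μ)) _
        (fun μ => (-Complex.I / (2 * Real.pi)) • A₁ μ)
        (fun μ => MoyalPlane.commute_spinorHom_multiplierHom _ _)
        (fun μ => MoyalPlane.commute_spinorHom_moyalOperator hθ hf' hA (hγ.1 μ))
        (fun μ => MoyalPlane.intertwines_moyalOperator hθ hf' _ hA (hA₁ μ))),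
    MoyalPlane.inSmoothDomain_of_momentumSmooth fun n =>
      MoyalPlane.momentumSmooth_moyalOperator hθ n hf' hA,
    MoyalPlane.inSmoothDomain_of_momentumSmooth fun n => ?_⟩
  rw [← smul_one_mul]
  refine (MoyalPlane.CommutatorSmooth.sum _ fun μ _ => ?_).mul_left _
    fun r => (Commute.one_left _).smul_left _
  rw [← smul_one_mul _ (A₁ μ)]
  exact ((MoyalPlane.momentumSmooth_moyalOperator hθ n (hf'.fderiv_apply _) (hA₁ μ)).mul_left _
    fun r => (Commute.one_left _).smul_left _).mul_left _
    fun r => MoyalPlane.commute_spinorHom_multiplierHom _ r
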